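/- Let $k$ be an algebraically closed field of characteristic $0$, let $V=k^2$ be the standard representation of $\mathfrak{sl}_2=\mathfrak{sl}_2(k)$ with standard basis $x,y$, and let $TV\rtimes U(\mathfrak{sl}_2)$ be the semidirect product of the tensor algebra $TV$ with the universal enveloping algebra, i.e. the $k$-algebra generated by $\mathfrak{sl}_2$ and $V$ subject to $AB-BA=[A,B]$ and $Av-vA=A(v)$ for $A,B\in\mathfrak{sl}_2$, $v\in V$. For a central element $z$ of $U(\mathfrak{sl}_2)$ put $H_z=(TV\rtimes U(\mathfrak{sl}_2))/([x,y]-z)$. For $n\ge 0$ let $F_nH_z$ be the span of the products $u_0v_1u_1\cdots v_mu_m$ with $m\le n$, $u_i\in U(\mathfrak{sl}_2)$, $v_i\in V$. Then for every central $z\in U(\mathfrak{sl}_2)$: 1. The center $Z(H_z)$ is a polynomial algebra $k[t_z]$ in one variable, whose generator $t_z$ has filtration degree $2$, i.e. $t_z\in F_2H_z\setminus F_1H_z$. 2. If $z=0$, then there is a $k$-linear derivation $\mathrm{eu}$ of $H_0$ that vanishes on $U(\mathfrak{sl}_2)$ and satisfies $\mathrm{eu}(v)=v$ for $v\in V$ (the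 Euler derivation), and the first Hochschild cohomology $HH^1(H_0,H_0)$ (derivations modulo inner derivations) is a free module of rank one over the center $Z(H_0)$, with basis the class of $\mathrm{eu}$. If $z\neq 0$, then every $k$-linear derivation of $H_z$ is inner. -/

import Mathlib

namespace InfHecke

attribute [local instance 100] LieRing.ofAssociativeRing

section Algebra

variable (k : Type*) [Field k]

/-- The Lie algebra `sl₂` of trace-zero `2 × 2` matrices. -/
abbrev Sl2 : Type _ := LieAlgebra.SpecialLinear.sl (Fin 2) k

/-- The universal enveloping algebra `U(sl₂)`. -/
abbrev USl2 : Type _ := UniversalEnvelopingAlgebra k (Sl2 k)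

/-- The standard representation `V = k²`; `A ∈ sl₂` acts by `v ↦ A *ᵥ v`. -/
abbrev V : Type _ := Fin 2 → k

/-- The relations of the semidirect product `TV ⋊ U(sl₂)`, on the tensor algebra of `sl₂ × V`:
the bracket relations of `sl₂`, and `A v - v A = A(v)` for `A ∈ sl₂`, `v ∈ V`. -/
inductive SmashRel : TensorAlgebra k (Sl2 k × V k) → TensorAlgebra k (Sl2 k × V k) → Prop
  | lie (A B : Sl2 k) :
      SmashRel (TensorAlgebra.ι k (A, 0) * TensorAlgebra.ι k (B, 0))
        (TensorAlgebra.ι k (B, 0) * TensorAlgebra.ι k (A, 0) + TensorAlgebra.ι k (⁅A, B⁆, 0))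
  | act (A : Sl2 k) (v : V k) :
      SmashRel (TensorAlgebra.ι k (A, 0) * TensorAlgebra.ι k (0, v))
        (TensorAlgebra.ι k (0, v) * TensorAlgebra.ι k (A, 0) +
          TensorAlgebra.ι k (0, Matrix.mulVec A.1 v))

/-- The semidirect product algebra `TV ⋊ U(sl₂)`. -/
def Smash : Type _ := RingQuot (SmashRel k)

noncomputable instance : Ring (Smash k) := inferInstanceAs (Ring (RingQuot (SmashRel k)))

noncomputable instance : Algebra k (Smash k) := inferInstanceAs (Algebra k (RingQuot (SmashRel k)))

namespace Smash

/-- The quotient map onto `TV ⋊ U(sl₂)`. -/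
noncomputable def mk : TensorAlgebra k (Sl2 k × V k) →ₐ[k] Smash k :=
  RingQuot.mkAlgHom k (SmashRel k)

/-- The inclusion of `V` in `TV ⋊ U(sl₂)`. -/
noncomputable def ofV : V k →ₗ[k] Smash k :=
  (mk k).toLinearMap ∘ₗ TensorAlgebra.ι k ∘ₗ
    LinearMap.inr k (Sl2 k) (V k)

/-- The inclusion of `sl₂` in `TV ⋊ U(sl₂)`, a morphism of Lie algebras. -/
noncomputable def ofSl2 : Sl2 k →ₗ⁅k⁆ Smash k :=
  { (mk k).toLinearMap ∘ₗ TensorAlgebra.ι k ∘ₗ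
      LinearMap.inl k (Sl2 k) (V k) with
    map_lie' := by
      intro A B
      have h : mk k _ = mk k _ := RingQuot.mkAlgHom_rel k (SmashRel.lie A B)
      rw [map_add, map_mul, map_mul] at h
      simp [LieRing.of_associative_ring_bracket, h] }

/-- The canonical algebra morphism `U(sl₂) → TV ⋊ U(sl₂)`. -/
noncomputable def ofU : USl2 k →ₐ[k] Smash k :=
  UniversalEnvelopingAlgebra.lift k (ofSl2 k)

end Smash

variable {k}

/-- The relation `[x, y] = z`, where `x, y` is the standard basis of `V`. -/
inductive HRel (z : USl2 k) : Smash k → Smash k → Prop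
  | comm : HRel z
      (Smash.ofV k (Pi.single 0 1) * Smash.ofV k (Pi.single 1 1) -
        Smash.ofV k (Pi.single 1 1) * Smash.ofV k (Pi.single 0 1))
      (Smash.ofU k z)

/-- The infinitesimal Hecke algebra `H_z = (TV ⋊ U(sl₂)) / ([x, y] - z)`. -/
def H (z : USl2 k) : Type _ := RingQuot (HRel z)

noncomputable instance (z : USl2 k) : Ring (H z) := inferInstanceAs (Ring (RingQuot (HRel z)))

noncomputable instance (z : USl2 k) : Algebra k (H z) :=
  inferInstanceAs (Algebra k (RingQuot (HRel z)))

namespace H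

/-- The quotient map `TV ⋊ U(sl₂) → H_z`. -/
noncomputable def mk (z : USl2 k) : Smash k →ₐ[k] H z :=
  RingQuot.mkAlgHom k (HRel z)

/-- The image of `V` in `H_z`. -/
noncomputable def ofV (z : USl2 k) : V k →ₗ[k] H z :=
  (mk z).toLinearMap ∘ₗ Smash.ofV k

/-- The canonical algebra morphism `U(sl₂) → H_z`. -/
noncomputable def ofU (z : USl2 k) : USl2 k →ₐ[k] H z :=
  (mk z).comp (Smash.ofU k)

/-- The filtration of `H_z` in which `U(sl₂)` has degree `0` and `V` has degree `1`: the `n`-th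
term is spanned by the products `u₀ v₁ u₁ v₂ ⋯ vₘ uₘ` with `m ≤ n`, `uᵢ ∈ U(sl₂)`, `vᵢ ∈ V`. -/
noncomputable def filtration (z : USl2 k) (n : ℕ) : Submodule k (H z) :=
  LinearMap.range (ofU z).toLinearMap *
    ((1 ⊔ LinearMap.range (ofV z)) * LinearMap.range (ofU z).toLinearMap) ^ n

end H

end Algebra

section Hochschild

variable (k A : Type*) [Field k] [Ring A] [Algebra k A]

/-- The Hochschild differential `C⁰(A, A) → C¹(A, A)`, `a ↦ (b ↦ b a - a b)`,
linear over the center of `A`. -/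
def hochschildD0 : A →ₗ[Subalgebra.center k A] (A →ₗ[k] A) where
  toFun a := LinearMap.mulRight k a - LinearMap.mulLeft k a
  map_add' a b := by
    ext c
    simp [mul_add, add_mul]
    abel
  map_smul' c a := by
    ext b
    have h : b * (c : A) = (c : A) * b := (Subalgebra.mem_center_iff.mp c.2 b)
    simp [Subalgebra.smul_def, smul_eq_mul, mul_sub, ← mul_assoc, h]

/-- The Hochschild differential `C¹(A, A) → C²(A, A)`,
`f ↦ ((a, b) ↦ a f(b) - f(a b) + f(a) b)`, linear over the center of `A`. -/
def hochschildD1 : (A →ₗ[k] A) →ₗ[Subalgebra.center k A] (A →ₗ[k] A →ₗ[k] A) where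
  toFun f := (LinearMap.mul k A).compl₂ f - (LinearMap.mul k A).compr₂ f +
    (LinearMap.mul k A).comp f
  map_add' f g := by
    ext a b
    simp [mul_add]
    abel
  map_smul' c f := by
    ext a b
    have h : a * (c : A) = (c : A) * a := (Subalgebra.mem_center_iff.mp c.2 a)
    simp [Subalgebra.smul_def, smul_eq_mul, mul_sub, ← mul_assoc, h]

/-- The Hochschild `1`-cocycles of `A` with values in `A`, i.e. the `k`-linear derivations. -/
abbrev Cocycle1 : Submodule (Subalgebra.center k A) (A →ₗ[k] A) :=
  LinearMap.ker (hochschildD1 k A)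

/-- The first Hochschild cohomology `HH¹(A, A)`, as a module over the center of `A`. -/
abbrev HH1 : Type _ :=
  Cocycle1 k A ⧸ (LinearMap.range (hochschildD0 k A)).submoduleOf (Cocycle1 k A)

end Hochschild

end InfHecke

/-! A central `z` is a polynomial `p(c)` in the Casimir element `c = 4fe + (h+1)²`, and `H_z` is
studied through a faithful representation that turns its structure into difference calculus in one
variable. Over `K = k(λ)`, take functions on `ℤ × ℤ` with values in `K[t]`. On row `b` the Casimir
acts by `(λ+b)²`, on column `m` the element `h` acts by `m`, and `x`, `y` shift `b` by `±1`, the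
downward shift carrying the factor `t + g(λ+b)`. The relation `[x,y] = p(c)` becomes `g(X) - g(X+1)
= X p(X²)`, which has polynomial solutions (`exists_shift_potential`, `opX_mul_opY`). The twisted
commutator `xcy - ycx`, corrected by a polynomial `r(c)`, acts as the scalar `-4t`
(`Potential.act_t`). Faithfulness then makes the corresponding element `t` of `H_z` central.

Faithfulness (`actH_injective`) is a PBW theorem. An element of degree `n` has a leading coefficient
`u` in `U(sl₂)`, that of `xⁿ` modulo lower degree and left multiples of `y`. A symbol functional on
the module kills the latter and recovers `u` (`symb_wfil_one`, `symb_hX_pow`). Terms divisible by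
`y` are reached by applying `ad e`, which turns `y` into `x`.

Leading coefficients also control `sl₂`-equivariance. The leading coefficient of an element
commuting with `sl₂` commutes with `f` and has weight `-n`. It is therefore `f^m q(c)` with `n = 2m`
(`eq_of_lowest_weight`), up to sign that of `t^m q(c)`. So the centralizer of `sl₂` is `k[c,t]`
(`exists_evC_eq`). In the same way, every pair transforming like `(x,y)` is a combination of `(x,y)`
and `([c,x],[c,y])` over `k[c,t]` (`exists_isVRel_eq`). Since `Q(t,c)` acts on row `b` by
`Q(t,(λ+b)²)`, it is central only if it does not involve `c`, so the center is `k[t]`.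

A derivation is inner on `U(sl₂)` by Whitehead's first lemma (`exists_of_cocycle`). After
subtracting that part, it maps `(x,y)` to another such pair. The `[c,·]` component is again inner
(`exists_evLam_shift`), and what remains is `v ↦ v R(t,c)`. Compatibility with `[x,y] = z` makes
`(R(t,X²) + R(t,(X-1)²))(t + g(X))` invariant under `X ↦ X+1`, hence a polynomial `F(t)`. If `z ≠
0`, then `g` is not constant; setting `t = -g` gives `F = 0` and so `R = 0`. If `z = 0`, then `g =
0`, the polynomial `R` lies in `k[t]`, and the derivation is `R(t)` times the Euler derivation,
which is inner only for `R = 0`. -/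

open Polynomial

namespace InfHecke

attribute [local instance 100] LieRing.ofAssociativeRing

/-! ### Difference equations for polynomials in characteristic zero. -/

section Polynomials

/-- The value at `0` recurs at the points `n * s`, which are infinitely many in characteristic zero.
-/
theorem eq_C_of_comp_X_add_C_eq {R : Type*} [CommRing R] [IsDomain R] [CharZero R] {p : R[X]}
    {s : R} (hs : s ≠ 0) (h : p.comp (X + C s) = p) : p = C (p.eval 0) := by
  have key : ∀ n : ℕ, p.eval (n * s) = p.eval 0 := by
    intro n
    induction n with
    | zero => simp
    | succ n ih =>
      rw [← ih]
      conv_rhs => rw [← h]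
      simp [add_mul]
  apply eq_of_infinite_eval_eq
  refine Set.Infinite.mono (s := Set.range fun n : ℕ => (n : R) * s) ?_ ?_
  · rintro _ ⟨n, rfl⟩
    simp [key]
  · apply Set.infinite_range_of_injective
    intro a b hab
    simpa [hs] using hab

variable {k : Type*} [Field k] [CharZero k]

/-- The difference operator lowers degrees by exactly one, so the top coefficient of `q` can be
cancelled and the degree bound lowered. -/
theorem exists_comp_X_add_C_sub_eq {s : k} (hs : s ≠ 0) (q : k[X]) :
    ∃ p : k[X], p.comp (X + C s) - p = q := by
  suffices H : ∀ (N : ℕ) (q : k[X]), q.degree < N → ∃ p : k[X], p.comp (X + C s) - p = q from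
    H (q.natDegree + 1) q (lt_of_le_of_lt degree_le_natDegree (by exact_mod_cast Nat.lt_succ_self _))
  intro N
  induction N with
  | zero =>
    intro q hq
    refine ⟨0, ?_⟩
    have : q = 0 := by
      rw [degree_lt_iff_coeff_zero] at hq
      ext n
      simp [hq n]
    simp [this]
  | succ N ih =>
    intro q hq
    have hN : ((N : k) + 1) ≠ 0 := by exact_mod_cast Nat.succ_ne_zero N
    -- `(N + 1) * s` is the coefficient of `X ^ N` in `(X + s)^(N+1) - X^(N+1)`.
    set a : k := q.coeff N / ((N + 1) * s)
    obtain ⟨p, hp⟩ := ih (q - C a * ((X + C s) ^ (N + 1) - X ^ (N + 1))) (by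
      rw [degree_lt_iff_coeff_zero] at hq ⊢
      intro m hm
      rcases hm.eq_or_lt with rfl | hm
      · simp [coeff_X_add_C_pow, coeff_X_pow, a]
        field_simp
        simp
      · rw [coeff_sub, hq m hm, coeff_C_mul, coeff_sub, coeff_X_add_C_pow, coeff_X_pow]
        rcases (Nat.succ_le_of_lt hm).eq_or_lt with rfl | hm'
        · simp
        · rw [Nat.choose_eq_zero_of_lt hm', if_neg (by omega)]
          simp)
    refine ⟨p + C a * X ^ (N + 1), ?_⟩
    rw [add_comp, mul_comp, C_comp, pow_comp, X_comp]
    linear_combination hp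

theorem exists_expand_two_eq {p : k[X]} (h : p.comp (-X) = p) : ∃ q, p = expand k 2 q := by
  refine ⟨contract 2 p, ?_⟩
  ext n
  rw [coeff_expand (by norm_num), coeff_contract (by norm_num)]
  split_ifs with hn
  · rw [Nat.div_mul_cancel hn]
  · have h1 : p.coeff n = (-1) ^ n * p.coeff n := by
      conv_lhs => rw [← h]
      have := comp_C_mul_X_coeff (p := p) (r := (-1 : k)) (n := n)
      simp only [map_neg, map_one, neg_mul, one_mul] at this
      rw [this, mul_comm]
    rw [Odd.neg_one_pow (Nat.not_even_iff_odd.mp (by rwa [even_iff_two_dvd]))] at h1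
    have : (2 : k) * p.coeff n = 0 := by linear_combination h1
    simpa using this

/-- If `F` solves the equation, so does `F(-X)`, because the right side is odd; the average of the
two solutions is even. -/
theorem exists_expand_two_comp_sub_comp_eq (q : k[X]) :
    ∃ p : k[X], (expand k 2 p).comp (X + 1) - (expand k 2 p).comp (X - 1) =
      X * expand k 2 q := by
  obtain ⟨F, hF⟩ := exists_comp_X_add_C_sub_eq (two_ne_zero : (2 : k) ≠ 0)
    ((X * expand k 2 q).comp (X + 1))
  have h1 : F.comp (X + 1) - F.comp (X - 1) = X * expand k 2 q := by
    have := congrArg (fun r : k[X] => r.comp (X - 1)) hF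
    simp only [sub_comp, comp_assoc] at this
    simp only [add_comp, X_comp, C_comp, one_comp, sub_add_cancel, comp_X] at this
    rw [← this]
    congr 2
    rw [show (C 2 : k[X]) = 2 from rfl]
    ring
  have hq : (expand k 2 q).comp (-X) = expand k 2 q := by
    simp [expand_eq_comp_X_pow, comp_assoc]
  have h2 : F.comp (-X - 1) - F.comp (-X + 1) = X * expand k 2 q := by
    have := congrArg (fun r : k[X] => r.comp (-X)) h1
    simp only [sub_comp, comp_assoc, mul_comp, hq, add_comp, X_comp, one_comp] at this
    linear_combination -this
  obtain ⟨p, hp⟩ := exists_expand_two_eq (p := C (1 / 2) * (F + F.comp (-X))) (by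
    simp [comp_assoc, add_comm])
  refine ⟨p, ?_⟩
  rw [← hp]
  simp only [mul_comp, add_comp, C_comp, comp_assoc, neg_comp, X_comp]
  have h3 : (C (1 / 2) : k[X]) * 2 = 1 := by
    rw [show (2 : k[X]) = C 2 from rfl, ← C_mul]
    simp
  rw [neg_add', neg_sub, show (1 : k[X]) - X = -X + 1 by ring]
  linear_combination C (1 / 2) * h1 + C (1 / 2) * h2 + (X * expand k 2 q) * h3

/-- Solution of `g(X) - g(X + 1) = X p(X²)`, together with the polynomial `r` for which
`r(X²) = (X + 1)² p(X²) - 4 g(X)`. -/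
theorem exists_shift_potential (p : k[X]) :
    ∃ g r : k[X], g - g.comp (X + 1) = X * expand k 2 p ∧
      expand k 2 r = (X + 1) ^ 2 * expand k 2 p - 4 * g ∧ (p = 0 → g = 0) := by
  -- The difference equation fixes `g` only up to a constant; for `p = 0` the constant is normalized
  -- to zero.
  by_cases hp0 : p = 0
  · exact ⟨0, 0, by simp [hp0]⟩
  obtain ⟨G, hG⟩ := exists_comp_X_add_C_sub_eq (one_ne_zero : (1 : k) ≠ 0) (X * expand k 2 p)
  obtain ⟨g, hg⟩ : ∃ g : k[X], g = -G := ⟨_, rfl⟩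
  have h1 : g - g.comp (X + 1) = X * expand k 2 p := by
    rw [hg, neg_comp, ← hG, C_1]
    ring
  have hq : (expand k 2 p).comp (-X) = expand k 2 p := by
    simp [expand_eq_comp_X_pow, comp_assoc]
  have h2 : g.comp (-X) - g.comp (-X + 1) = - X * expand k 2 p := by
    have := congrArg (fun r : k[X] => r.comp (-X)) h1
    simpa only [sub_comp, comp_assoc, mul_comp, hq, add_comp, X_comp, one_comp] using this
  -- The difference `g(X) - g(1 - X)` is invariant under `X ↦ X + 1`, hence constant, and it
  -- vanishes at `1/2`.
  have h3 : g = g.comp (-X + 1) := by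
    have hs : (g - g.comp (-X + 1)).comp (X + C 1) = g - g.comp (-X + 1) := by
      simp only [sub_comp, comp_assoc, add_comp, neg_comp, X_comp, one_comp, C_1, neg_add']
      rw [sub_add_cancel]
      linear_combination -h1 - h2
    have h4 := eq_C_of_comp_X_add_C_eq one_ne_zero hs
    have h5 : (g - g.comp (-X + 1)).eval (1 / 2) = 0 := by
      rw [eval_sub, eval_comp]
      norm_num
    rw [h4, eval_C] at h5
    rw [h5, C_0] at h4
    exact sub_eq_zero.mp h4
  -- By the symmetry of `g`, replacing `X` by `-X` changes `4g` by `-4X p(X²)`, which is also the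
  -- change of `(X + 1)² p(X²)`.
  obtain ⟨r, hr⟩ := exists_expand_two_eq (p := (X + 1) ^ 2 * expand k 2 p - 4 * g) (by
    rw [sub_comp, mul_comp, hq, mul_comp, pow_comp, add_comp, X_comp, one_comp, ofNat_comp]
    linear_combination (-4 : k[X]) * h2 + 4 * h3)
  exact ⟨g, r, h1, hr.symm, fun h => absurd h hp0⟩

end Polynomials

/-! ### Whitehead's first lemma for locally nilpotent `sl₂`-modules. -/

section Whitehead

variable {k M : Type*} [Field k] [CharZero k] [AddCommGroup M] [Module k M]

omit [CharZero k] in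
-- Kernel and image of `H - μ` span the module: on an eigenspace with eigenvalue `ν ≠ μ` the
-- operator is invertible.
theorem exists_add_of_iSup_eigenspace_eq_top {H : Module.End k M}
    (hH : ⨆ μ, H.eigenspace μ = ⊤) (μ : k) (v : M) :
    ∃ v₀ w, v = v₀ + (H w - μ • w) ∧ H v₀ = μ • v₀ := by
  have hv : v ∈ ⨆ μ, H.eigenspace μ := hH ▸ Submodule.mem_top
  refine Submodule.iSup_induction _ (motive := fun v => ∃ v₀ w, v = v₀ + (H w - μ • w) ∧
    H v₀ = μ • v₀) hv ?_ ⟨0, 0, by simp, by simp⟩ ?_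
  · intro ν v hv
    rw [Module.End.mem_eigenspace_iff] at hv
    by_cases h : ν = μ
    · exact ⟨v, 0, by simp, by rw [hv, h]⟩
    · refine ⟨0, (ν - μ)⁻¹ • v, ?_, by simp⟩
      rw [map_smul, hv, smul_comm μ, ← smul_sub, ← sub_smul, smul_smul,
        inv_mul_cancel₀ (sub_ne_zero.mpr h)]
      simp
  · rintro v v' ⟨a, b, h1, h2⟩ ⟨a', b', h1', h2'⟩
    refine ⟨a + a', b + b', ?_, ?_⟩
    · rw [h1, h1', map_add, smul_add]
      abel
    · rw [map_add, h2, h2', smul_add]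

omit [CharZero k] in
-- Kernel and image of `H - μ` meet trivially: the image lies in the sum of the other eigenspaces.
theorem eq_zero_of_mem_eigenspace_of_eq_sub {H : Module.End k M}
    (hH : ⨆ μ, H.eigenspace μ = ⊤) {μ : k} {v w : M} (hv : H v = μ • v)
    (hw : H w - μ • w = v) : v = 0 := by
  have hind := Module.End.eigenspaces_iSupIndep H μ
  rw [disjoint_iff, Submodule.eq_bot_iff] at hind
  refine hind v ⟨Module.End.mem_eigenspace_iff.mpr hv, ?_⟩
  rw [← hw]
  have hw' : w ∈ ⨆ μ, H.eigenspace μ := hH ▸ Submodule.mem_top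
  refine Submodule.iSup_induction _ (motive := fun w => H w - μ • w ∈
    ⨆ j, ⨆ (_ : j ≠ μ), H.eigenspace j) hw' ?_ (by simp) ?_
  · intro ν u hu
    rw [Module.End.mem_eigenspace_iff] at hu
    by_cases h : ν = μ
    · simp [hu, h]
    · rw [hu, ← sub_smul]
      exact Submodule.smul_mem _ _ (Submodule.mem_iSup_of_mem ν (Submodule.mem_iSup_of_mem h
        (Module.End.mem_eigenspace_iff.mpr hu)))
  · intro a b ha hb
    rw [map_add, smul_add, add_sub_add_comm]
    exact add_mem ha hb

variable {E F H : Module.End k M} (hHE : ∀ v, H (E v) - E (H v) = (2 : k) • E v)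
  (hHF : ∀ v, H (F v) - F (H v) = (-2 : k) • F v) (hEF : ∀ v, E (F v) - F (E v) = H v)

include hHE in
theorem weight_pow_apply {μ : k} {v : M} (hv : H v = μ • v) (n : ℕ) :
    H ((E ^ n) v) = (μ + 2 * n) • (E ^ n) v := by
  induction n with
  | zero => simp [hv]
  | succ n ih =>
    rw [pow_succ', Module.End.mul_apply, sub_eq_iff_eq_add.mp (hHE _), ih, map_smul, ← add_smul]
    congr 1
    push_cast
    ring

include hHE hEF in
theorem pow_succ_apply_of_weight_two {v : M} (hv : H v = (2 : k) • v) (N : ℕ) :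
    (E ^ (N + 1)) (F v) = F ((E ^ (N + 1)) v) + (((N + 1) * (N + 2) : ℕ) : k) • (E ^ N) v := by
  induction N with
  | zero =>
    have := hEF v
    rw [hv] at this
    simp [← this]
  | succ N ih =>
    rw [pow_succ', Module.End.mul_apply, ih, map_add, map_smul, sub_eq_iff_eq_add.mp (hEF _),
      weight_pow_apply hHE hv, ← Module.End.mul_apply E (E ^ N), ← pow_succ',
      ← Module.End.mul_apply E (E ^ (N + 1)), ← pow_succ', add_right_comm, ← add_smul, add_comm]
    congr 2
    push_cast
    ring

include hHE hHF hEF in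
-- Subtracting a suitable multiple of `E (F v)` from `v` lowers by one the power of `E` needed to
-- kill it, and that multiple is `E` of a vector of weight zero.
theorem exists_apply_eq_of_weight_two {v : M} (hv : H v = (2 : k) • v)
    (hE : ∃ N, (E ^ N) v = 0) : ∃ u, H u = 0 ∧ E u = v := by
  obtain ⟨N, hN⟩ := hE
  induction N generalizing v with
  | zero => exact ⟨0, by simp, by simpa using hN.symm⟩
  | succ N ih =>
    have hc : (((N + 1) * (N + 2) : ℕ) : k) ≠ 0 := by
      exact Nat.cast_ne_zero.mpr (by positivity)
    set a : k := (((N + 1) * (N + 2) : ℕ) : k)⁻¹ with ha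
    have hFv : H (F v) = 0 := by
      rw [sub_eq_iff_eq_add.mp (hHF v), hv, map_smul, ← add_smul]
      simp
    have hEFv : H (E (F v)) = (2 : k) • E (F v) := by
      rw [sub_eq_iff_eq_add.mp (hHE _), hFv]
      simp
    obtain ⟨u, hu, hu'⟩ := ih (v := v - a • E (F v)) (by
        rw [map_sub, map_smul, hv, hEFv, smul_sub, smul_comm]) (by
        rw [map_sub, map_smul, ← Module.End.mul_apply, ← pow_succ,
          pow_succ_apply_of_weight_two hHE hEF hv, hN, map_zero, zero_add, smul_smul,
          inv_mul_cancel₀ hc, one_smul, sub_self])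
    refine ⟨u + a • F v, ?_, ?_⟩
    · simp [hu, hFv]
    · simp [hu']

include hHF hEF in
-- `E` maps `F^(j+1) b` to a nonzero multiple of `F^j b`, so the vanishing of one power of `F` on
-- `b` descends to `b` itself.
theorem eq_zero_of_weight_neg_two {b : M} (hb : H b = (-2 : k) • b) (hFE : F (E b) = 0)
    (hF : ∃ N, (F ^ N) b = 0) : b = 0 := by
  have hw : ∀ j : ℕ, H ((F ^ j) b) = (-2 - 2 * j : k) • (F ^ j) b := by
    intro j
    induction j with
    | zero => simp [hb]
    | succ j ih =>
      rw [pow_succ', Module.End.mul_apply, sub_eq_iff_eq_add.mp (hHF _), ih, map_smul, ← add_smul]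
      congr 1
      push_cast
      ring
  have key : ∀ j : ℕ, E ((F ^ (j + 1)) b) = (-((j + 1) * (j + 2) : ℕ) : k) • (F ^ j) b := by
    intro j
    induction j with
    | zero =>
      have := hEF b
      rw [hFE, hb] at this
      simpa using this
    | succ j ih =>
      rw [pow_succ', Module.End.mul_apply, sub_eq_iff_eq_add.mp (hEF _), ih, hw, map_smul,
        ← Module.End.mul_apply F, ← pow_succ', ← add_smul]
      congr 1
      push_cast
      ring
  obtain ⟨N, hN⟩ := hF
  induction N with
  | zero => simpa using hN
  | succ N ih =>
    apply ih
    have h := key N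
    rw [hN, map_zero] at h
    have hc : (-((N + 1) * (N + 2) : ℕ) : k) ≠ 0 := by
      rw [neg_ne_zero]
      exact Nat.cast_ne_zero.mpr (by positivity)
    exact (smul_eq_zero.mp h.symm).resolve_left hc

include hHE hHF hEF in
/-- The first Whitehead lemma for `sl₂` and a module on which `H` is diagonalizable and `E`, `F`
are locally nilpotent. -/
theorem exists_of_cocycle (hH : ⨆ μ, H.eigenspace μ = ⊤) (hE : ∀ v, ∃ N, (E ^ N) v = 0)
    (hF : ∀ v, ∃ N, (F ^ N) v = 0) {a b d : M} (h1 : H a - E d = (2 : k) • a)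
    (h2 : H b - F d = (-2 : k) • b) (h3 : E b - F a = d) :
    ∃ m, E m = a ∧ F m = b ∧ H m = d := by
  -- The coboundary of `m` removes from `d` everything but its weight-zero part `c`.
  obtain ⟨c, m, hd, hc⟩ := exists_add_of_iSup_eigenspace_eq_top hH 0 d
  rw [zero_smul, sub_zero] at hd
  rw [zero_smul] at hc
  have hEc : H (E c) = (2 : k) • E c := by
    rw [sub_eq_iff_eq_add.mp (hHE c), hc]
    simp
  have hFc : H (F c) = (-2 : k) • F c := by
    rw [sub_eq_iff_eq_add.mp (hHF c), hc]
    simp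
  have ha : H (a - E m) - (2 : k) • (a - E m) = E c := by
    rw [map_sub, sub_eq_iff_eq_add.mp (hHE m), sub_eq_iff_eq_add.mp h1, hd, smul_sub, map_add]
    abel
  have hb : H (b - F m) - (-2 : k) • (b - F m) = F c := by
    rw [map_sub, sub_eq_iff_eq_add.mp (hHF m), sub_eq_iff_eq_add.mp h2, hd, smul_sub, map_add]
    abel
  -- `E c` has weight two and lies in the image of `H - 2`, so it vanishes, and the corrected `a`
  -- has weight two.
  rw [eq_zero_of_mem_eigenspace_of_eq_sub hH hEc ha, sub_eq_zero] at ha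
  have hFc0 := eq_zero_of_mem_eigenspace_of_eq_sub hH hFc hb
  rw [hFc0, sub_eq_zero] at hb
  -- The second correction has weight zero, so it repairs `a` without disturbing `d`.
  obtain ⟨m', hm', hm''⟩ := exists_apply_eq_of_weight_two hHE hHF hEF ha (hE _)
  have hb' : H (b - F m - F m') = (-2 : k) • (b - F m - F m') := by
    rw [map_sub, hb, sub_eq_iff_eq_add.mp (hHF m'), hm', map_zero, add_zero, smul_sub (-2 : k) _ (F m')]
  have hEb : E (b - F m - F m') = c := by
    rw [map_sub, map_sub, sub_eq_iff_eq_add.mp (hEF m), sub_eq_iff_eq_add.mp (hEF m'), hm', hm'',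
      sub_eq_iff_eq_add.mp h3, hd, map_sub]
    abel
  have h0 := eq_zero_of_weight_neg_two hHF hEF hb' (by rw [hEb, hFc0]) (hF _)
  refine ⟨m + m', ?_, ?_, ?_⟩
  · rw [map_add, hm'']
    abel
  · rw [map_add]
    rw [sub_sub, sub_eq_zero] at h0
    exact h0.symm
  · rw [h0, map_zero] at hEb
    rw [map_add, hm', hd, ← hEb]
    abel

end Whitehead

/-! ### Inner derivations: local nilpotency and diagonalizability are checked on generators. -/

section Inner

variable {k A : Type*} [Field k] [Ring A] [Algebra k A]

variable (k) in
/-- The inner derivation `b ↦ a b - b a`. -/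
def adj (a : A) : Module.End k A := LinearMap.mulLeft k a - LinearMap.mulRight k a

theorem adj_apply (a b : A) : adj k a b = a * b - b * a := rfl

theorem adj_mul (a b c : A) : adj k a (b * c) = adj k a b * c + b * adj k a c := by
  simp only [adj_apply]
  noncomm_ring

/-- By the Leibniz rule, each term of the iterated derivation of `b * c` applies at least `m` of the
factors to `b` or at least `n` of them to `c`. -/
theorem adj_pow_mul_eq_zero (a : A) (N : ℕ) : ∀ (m n : ℕ) (b c : A), m + n = N →
    (adj k a ^ m) b = 0 → (adj k a ^ n) c = 0 → (adj k a ^ N) (b * c) = 0 := by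
  induction N with
  | zero =>
    intro m n b c h hb _
    obtain rfl : m = 0 := by omega
    simp_all
  | succ N ih =>
    intro m n b c h hb hc
    rw [pow_succ, Module.End.mul_apply, adj_mul, map_add]
    have h0 : ∀ (j : ℕ) (u v : A), u = 0 ∨ v = 0 → (adj k a ^ j) (u * v) = 0 := by
      rintro j u v (rfl | rfl) <;> simp
    rcases m with _ | m
    · obtain rfl : b = 0 := by simpa using hb
      simp
    rcases n with _ | n
    · obtain rfl : c = 0 := by simpa using hc
      simp
    rw [ih m (n + 1) (adj k a b) c (by omega) (by
        rwa [pow_succ, Module.End.mul_apply] at hb) hc, ih (m + 1) n b (adj k a c) (by omega) hb (by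
        rwa [pow_succ, Module.End.mul_apply] at hc), add_zero]

theorem exists_adj_pow_eq_zero {s : Set A} (hs : Algebra.adjoin k s = ⊤) (a : A)
    (h : ∀ b ∈ s, ∃ n : ℕ, (adj k a ^ n) b = 0) (b : A) : ∃ n : ℕ, (adj k a ^ n) b = 0 := by
  have hb : b ∈ Algebra.adjoin k s := hs ▸ Algebra.mem_top
  induction hb using Algebra.adjoin_induction with
  | mem x hx => exact h x hx
  | algebraMap r => exact ⟨1, by simp [adj_apply, Algebra.commutes]⟩
  | add x y _ _ hx hy =>
    obtain ⟨m, hm⟩ := hx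
    obtain ⟨n, hn⟩ := hy
    refine ⟨m + n, ?_⟩
    rw [map_add, pow_add, Module.End.mul_apply _ _ y, hn, ← pow_add, add_comm m n, pow_add,
      Module.End.mul_apply, hm, map_zero, map_zero, add_zero]
  | mul x y _ _ hx hy =>
    obtain ⟨m, hm⟩ := hx
    obtain ⟨n, hn⟩ := hy
    exact ⟨m + n, adj_pow_mul_eq_zero a _ m n x y rfl hm hn⟩

/-- Eigenvalues of a derivation add under multiplication, so products of eigenvectors are
eigenvectors. -/
theorem iSup_eigenspace_adj_eq_top {s : Set A} (hs : Algebra.adjoin k s = ⊤) (a : A)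
    (h : ∀ b ∈ s, ∃ μ : k, a * b - b * a = μ • b) : ⨆ μ, (adj k a).eigenspace μ = ⊤ := by
  rw [eq_top_iff]
  rintro b -
  have hb : b ∈ Algebra.adjoin k s := hs ▸ Algebra.mem_top
  induction hb using Algebra.adjoin_induction with
  | mem x hx =>
    obtain ⟨μ, hμ⟩ := h x hx
    exact Submodule.mem_iSup_of_mem μ (Module.End.mem_eigenspace_iff.mpr hμ)
  | algebraMap r =>
    exact Submodule.mem_iSup_of_mem 0 (Module.End.mem_eigenspace_iff.mpr (by
      simp [adj_apply, Algebra.commutes]))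
  | add x y _ _ hx hy => exact add_mem hx hy
  | mul x y _ _ hx hy =>
    refine Submodule.iSup_induction _ (motive := fun x => x * y ∈ ⨆ μ, (adj k a).eigenspace μ)
      hx ?_ (by simp) (fun u v hu hv => by rw [add_mul]; exact add_mem hu hv)
    intro μ u hu
    refine Submodule.iSup_induction _ (motive := fun y => u * y ∈ ⨆ μ, (adj k a).eigenspace μ)
      hy ?_ (by simp) (fun u v hu hv => by rw [mul_add]; exact add_mem hu hv)
    intro ν v hv
    refine Submodule.mem_iSup_of_mem (μ + ν) ?_
    rw [Module.End.mem_eigenspace_iff] at hu hv ⊢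
    rw [adj_mul, hu, hv, add_smul, smul_mul_assoc, mul_smul_comm]

end Inner

/-- The defining relations of `sl₂` for a triple of elements of an associative ring. -/
structure IsSl2Rel {A : Type*} [Ring A] (E F H : A) : Prop where
  he : H * E = E * H + 2 * E
  hf : H * F = F * H - 2 * F
  ef : E * F = F * E + H

/-! ### The Casimir element commutes with an `sl₂`-triple. -/

namespace IsSl2Rel

variable {A : Type*} [Ring A] {E F H : A} (r : IsSl2Rel E F H)

include r

theorem casimir_mul_e : (4 * F * E + (H + 1) ^ 2) * E = E * (4 * F * E + (H + 1) ^ 2) := by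
  have h1 : H * H * E = E * H * H + 4 * E * H + 4 * E := by
    rw [mul_assoc, r.he, mul_add, ← mul_assoc, r.he, two_mul, mul_add, r.he]
    noncomm_ring
  have h2 : E * F * E = F * E * E + E * H + 2 * E := by
    rw [r.ef, add_mul, r.he]
    noncomm_ring
  have h3 : (4 * F * E + (H + 1) ^ 2) * E = 4 * (F * E * E) + H * H * E + 2 * (H * E) + E := by
    noncomm_ring
  have h4 : E * (4 * F * E + (H + 1) ^ 2) = 4 * (E * F * E) + E * H * H + 2 * (E * H) + E := by
    noncomm_ring
  rw [h3, h4, h1, h2, r.he]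
  noncomm_ring

theorem casimir_mul_f : (4 * F * E + (H + 1) ^ 2) * F = F * (4 * F * E + (H + 1) ^ 2) := by
  have h1 : H * H * F = F * H * H - 4 * F * H + 4 * F := by
    rw [mul_assoc, r.hf, mul_sub, ← mul_assoc, r.hf, two_mul, mul_add, r.hf]
    noncomm_ring
  have h2 : F * E * F = F * F * E + F * H := by
    rw [mul_assoc, r.ef, mul_add, mul_assoc]
  have h3 : (4 * F * E + (H + 1) ^ 2) * F = 4 * (F * E * F) + H * H * F + 2 * (H * F) + F := by
    noncomm_ring
  have h4 : F * (4 * F * E + (H + 1) ^ 2) = 4 * (F * F * E) + F * H * H + 2 * (F * H) + F := by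
    noncomm_ring
  rw [h3, h4, h1, h2, r.hf]
  noncomm_ring

theorem casimir_mul_h : (4 * F * E + (H + 1) ^ 2) * H = H * (4 * F * E + (H + 1) ^ 2) := by
  have h1 : H * F * E = F * E * H := by
    rw [r.hf, sub_mul, mul_assoc F H E, r.he]
    noncomm_ring
  have h3 : H * (4 * F * E + (H + 1) ^ 2) = 4 * (H * F * E) + H * (H + 1) ^ 2 := by
    noncomm_ring
  rw [h3, h1]
  noncomm_ring

end IsSl2Rel

/-! ### Coordinates on `sl₂` and maps out of it. -/

section Generators

variable (k : Type*) [Field k]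

/-- The matrix `e`. -/
def slE : Sl2 k := LieAlgebra.SpecialLinear.single 0 1 (by decide) 1

/-- The matrix `f`. -/
def slF : Sl2 k := LieAlgebra.SpecialLinear.single 1 0 (by decide) 1

/-- The matrix `h`. -/
def slH : Sl2 k := LieAlgebra.SpecialLinear.singleSubSingle 0 1 1

variable {k}

theorem sl2_eq (A : Sl2 k) : A = A.1 0 1 • slE k + A.1 1 0 • slF k + A.1 0 0 • slH k := by
  have h : A.1 0 0 + A.1 1 1 = 0 := by
    have := A.2
    change Matrix.trace A.1 = 0 at this
    rwa [Matrix.trace_fin_two] at this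
  apply Subtype.ext
  ext i j
  fin_cases i <;> fin_cases j <;> simp [slE, slF, slH]
  linear_combination h

theorem sl2_bracket (A B : Sl2 k) :
    ⁅A, B⁆.1 0 0 = A.1 0 1 * B.1 1 0 - B.1 0 1 * A.1 1 0 ∧
    ⁅A, B⁆.1 0 1 = 2 * (A.1 0 0 * B.1 0 1 - B.1 0 0 * A.1 0 1) ∧
    ⁅A, B⁆.1 1 0 = 2 * (B.1 0 0 * A.1 1 0 - A.1 0 0 * B.1 1 0) := by
  have hA : A.1 1 1 = - A.1 0 0 := by
    have := A.2
    change Matrix.trace A.1 = 0 at this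
    rw [Matrix.trace_fin_two] at this
    linear_combination this
  have hB : B.1 1 1 = - B.1 0 0 := by
    have := B.2
    change Matrix.trace B.1 = 0 at this
    rw [Matrix.trace_fin_two] at this
    linear_combination this
  rw [LieAlgebra.SpecialLinear.sl_bracket]
  simp only [Matrix.sub_apply, Matrix.mul_apply, Fin.sum_univ_two, hA, hB]
  refine ⟨?_, ?_, ?_⟩ <;> ring

/-- The Lie algebra morphism from `sl₂` defined by a triple satisfying the relations. -/
def liftSl2 {A : Type*} [Ring A] [Algebra k A] {E F H : A} (r : IsSl2Rel E F H) : Sl2 k →ₗ⁅k⁆ A where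
  toFun a := a.1 0 1 • E + a.1 1 0 • F + a.1 0 0 • H
  map_add' a b := by
    change (a.1 0 1 + b.1 0 1) • E + (a.1 1 0 + b.1 1 0) • F + (a.1 0 0 + b.1 0 0) • H = _
    module
  map_smul' t a := by
    change (t * a.1 0 1) • E + (t * a.1 1 0) • F + (t * a.1 0 0) • H = t • (_ + _ + _)
    module
  map_lie' {a b} := by
    obtain ⟨h1, h2, h3⟩ := sl2_bracket a b
    rw [h1, h2, h3, LieRing.of_associative_ring_bracket]
    simp only [mul_add, add_mul, smul_mul_smul_comm, r.he, r.hf, r.ef, two_mul]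
    module

theorem liftSl2_apply {A : Type*} [Ring A] [Algebra k A] {E F H : A} (r : IsSl2Rel E F H)
    (a : Sl2 k) : liftSl2 r a = a.1 0 1 • E + a.1 1 0 • F + a.1 0 0 • H := rfl

theorem lieHom_eq_liftSl2 {A : Type*} [Ring A] [Algebra k A] {E F H : A} (r : IsSl2Rel E F H)
    (g : Sl2 k →ₗ⁅k⁆ A) (he : g (slE k) = E) (hf : g (slF k) = F) (hh : g (slH k) = H) :
    g = liftSl2 r := by
  ext a
  conv_lhs => rw [sl2_eq a]
  simp only [map_add, map_smul, he, hf, hh, liftSl2_apply]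

theorem slE_apply : (slE k).1 = !![0, 1; 0, 0] := by
  ext i j
  fin_cases i <;> fin_cases j <;> simp [slE]

theorem slF_apply : (slF k).1 = !![0, 0; 1, 0] := by
  ext i j
  fin_cases i <;> fin_cases j <;> simp [slF]

theorem slH_apply : (slH k).1 = !![1, 0; 0, -1] := by
  ext i j
  fin_cases i <;> fin_cases j <;> simp [slH]

theorem isSl2Rel_map {A : Type*} [Ring A] [Algebra k A] (g : Sl2 k →ₗ⁅k⁆ A) :
    IsSl2Rel (g (slE k)) (g (slF k)) (g (slH k)) := by
  have h1 : ⁅slH k, slE k⁆ = (2 : k) • slE k := by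
    obtain ⟨a, b, c⟩ := sl2_bracket (slH k) (slE k)
    rw [sl2_eq ⁅slH k, slE k⁆, a, b, c]
    simp [slE_apply, slH_apply]
  have h2 : ⁅slH k, slF k⁆ = (-2 : k) • slF k := by
    obtain ⟨a, b, c⟩ := sl2_bracket (slH k) (slF k)
    rw [sl2_eq ⁅slH k, slF k⁆, a, b, c]
    simp [slF_apply, slH_apply]
  have h3 : ⁅slE k, slF k⁆ = slH k := by
    obtain ⟨a, b, c⟩ := sl2_bracket (slE k) (slF k)
    rw [sl2_eq ⁅slE k, slF k⁆, a, b, c]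
    simp [slE_apply, slF_apply]
  have h1' := congrArg g h1
  have h2' := congrArg g h2
  have h3' := congrArg g h3
  rw [LieHom.map_lie, LieRing.of_associative_ring_bracket, sub_eq_iff_eq_add] at h1' h2' h3'
  refine ⟨?_, ?_, ?_⟩
  · rw [h1', map_smul, two_smul, two_mul, add_comm]
  · rw [h2', map_smul, neg_smul, two_smul, two_mul]
    abel
  · rw [h3', add_comm]

end Generators

/-! ### The enveloping algebra: Casimir element and a spanning set over `k[c][h]`. -/

section Enveloping

variable (k : Type*) [Field k]

/-- The generator `e` of `U(sl₂)`. -/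
def uE : USl2 k := UniversalEnvelopingAlgebra.ι k (slE k)

/-- The generator `f` of `U(sl₂)`. -/
def uF : USl2 k := UniversalEnvelopingAlgebra.ι k (slF k)

/-- The generator `h` of `U(sl₂)`. -/
def uH : USl2 k := UniversalEnvelopingAlgebra.ι k (slH k)

theorem isSl2Rel_u : IsSl2Rel (uE k) (uF k) (uH k) := isSl2Rel_map _

/-- The Casimir element, normalized to act by the square of the highest weight plus one. -/
def casimir : USl2 k := 4 * uF k * uE k + (uH k + 1) ^ 2

variable {k}

/-- The algebra morphism from `U(sl₂)` defined by a triple satisfying the relations. -/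
def liftU {A : Type*} [Ring A] [Algebra k A] {E F H : A} (r : IsSl2Rel E F H) : USl2 k →ₐ[k] A :=
  UniversalEnvelopingAlgebra.lift k (liftSl2 r)

section

variable {A : Type*} [Ring A] [Algebra k A] {E F H : A} (r : IsSl2Rel E F H)

@[simp]
theorem liftU_uE : liftU r (uE k) = E := by
  rw [liftU, uE, UniversalEnvelopingAlgebra.lift_ι_apply]
  simp [liftSl2_apply, slE_apply]

@[simp]
theorem liftU_uF : liftU r (uF k) = F := by
  rw [liftU, uF, UniversalEnvelopingAlgebra.lift_ι_apply]
  simp [liftSl2_apply, slF_apply]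

@[simp]
theorem liftU_uH : liftU r (uH k) = H := by
  rw [liftU, uH, UniversalEnvelopingAlgebra.lift_ι_apply]
  simp [liftSl2_apply, slH_apply]

theorem liftU_casimir : liftU r (casimir k) = 4 * F * E + (H + 1) ^ 2 := by
  simp [casimir, map_ofNat]

theorem algHom_eq_liftU (g : USl2 k →ₐ[k] A) (he : g (uE k) = E) (hf : g (uF k) = F)
    (hh : g (uH k) = H) : g = liftU r := by
  apply UniversalEnvelopingAlgebra.hom_ext
  rw [lieHom_eq_liftSl2 r ((g : USl2 k →ₗ⁅k⁆ A).comp (UniversalEnvelopingAlgebra.ι k)) he hf hh,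
    lieHom_eq_liftSl2 r (((liftU r : USl2 k →ₐ[k] A) : USl2 k →ₗ⁅k⁆ A).comp
      (UniversalEnvelopingAlgebra.ι k)) (liftU_uE r) (liftU_uF r) (liftU_uH r)]

end

/-- The universal property gives a map into the generated subalgebra; followed by the inclusion it
fixes the generators, so it is the identity. -/
theorem adjoin_u_eq_top : Algebra.adjoin k {uE k, uF k, uH k} = ⊤ := by
  set S := Algebra.adjoin k {uE k, uF k, uH k}
  have mE : uE k ∈ S := Algebra.subset_adjoin (by simp)
  have mF : uF k ∈ S := Algebra.subset_adjoin (by simp)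
  have mH : uH k ∈ S := Algebra.subset_adjoin (by simp)
  have r : IsSl2Rel (⟨uE k, mE⟩ : S) ⟨uF k, mF⟩ ⟨uH k, mH⟩ :=
    ⟨Subtype.ext (isSl2Rel_u k).he, Subtype.ext (isSl2Rel_u k).hf,
      Subtype.ext (isSl2Rel_u k).ef⟩
  have h : S.val.comp (liftU r) = AlgHom.id k _ := by
    rw [algHom_eq_liftU (isSl2Rel_u k) (S.val.comp (liftU r)) (by simp) (by simp) (by simp)]
    exact (algHom_eq_liftU (isSl2Rel_u k) _ rfl rfl rfl).symm
  rw [eq_top_iff]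
  rintro u -
  have := DFunLike.congr_fun h u
  rw [AlgHom.id_apply] at this
  rw [← this]
  exact (liftU r u).2

@[elab_as_elim]
theorem u_induction {C : USl2 k → Prop} (he : C (uE k)) (hf : C (uF k)) (hh : C (uH k))
    (halg : ∀ a : k, C (algebraMap k _ a)) (hadd : ∀ u v, C u → C v → C (u + v))
    (hmul : ∀ u v, C u → C v → C (u * v)) (u : USl2 k) : C u := by
  have hu : u ∈ Algebra.adjoin k {uE k, uF k, uH k} := adjoin_u_eq_top (k := k) ▸ Algebra.mem_top
  induction hu using Algebra.adjoin_induction with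
  | mem x hx =>
    rcases hx with rfl | rfl | rfl
    exacts [he, hf, hh]
  | algebraMap r => exact halg r
  | add x y _ _ hx hy => exact hadd x y hx hy
  | mul x y _ _ hx hy => exact hmul x y hx hy

theorem commute_of_commute_generators {A : Type*} [Ring A] [Algebra k A] (g : USl2 k →ₐ[k] A)
    {a : A} (he : Commute a (g (uE k))) (hf : Commute a (g (uF k))) (hh : Commute a (g (uH k)))
    (u : USl2 k) : Commute a (g u) := by
  induction u using u_induction with
  | he => exact he
  | hf => exact hf
  | hh => exact hh
  | halg c =>
    rw [AlgHom.commutes]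
    exact (Algebra.commutes c a).symm
  | hadd u v hu hv =>
    rw [map_add]
    exact hu.add_right hv
  | hmul u v hu hv =>
    rw [map_mul]
    exact hu.mul_right hv

theorem casimir_commute (u : USl2 k) : Commute (casimir k) u :=
  commute_of_commute_generators (k := k) (AlgHom.id k (USl2 k)) (isSl2Rel_u k).casimir_mul_e
    (isSl2Rel_u k).casimir_mul_f (isSl2Rel_u k).casimir_mul_h u

theorem aeval_casimir_commute (p : k[X]) (u : USl2 k) : Commute (aeval (casimir k) p) u := by
  induction p using Polynomial.induction_on' with
  | add p q hp hq =>
    rw [map_add]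
    exact hp.add_left hq
  | monomial n a =>
    rw [aeval_monomial]
    exact Commute.mul_left (Algebra.commutes a u) ((casimir_commute u).pow_left n)

variable (k) in
/-- The evaluation of `k[c][h]` in `U(sl₂)`. -/
noncomputable def evH : k[X][X] →+* USl2 k :=
  eval₂RingHom' (aeval (casimir k) : k[X] →ₐ[k] USl2 k).toRingHom (uH k)
    fun p => aeval_casimir_commute p (uH k)

@[simp]
theorem evH_C (p : k[X]) : evH k (C p) = aeval (casimir k) p := by
  simp [evH]

@[simp]
theorem evH_X : evH k X = uH k := by
  simp [evH]

theorem evH_mul_f (P : k[X][X]) : evH k P * uF k = uF k * evH k (P.comp (X - 2)) := by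
  induction P using Polynomial.induction_on' with
  | add p q hp hq => rw [map_add, add_mul, hp, hq, add_comp, map_add, mul_add]
  | monomial n a =>
    rw [← C_mul_X_pow_eq_monomial, mul_comp, C_comp, pow_comp, X_comp, map_mul, map_mul, map_pow,
      map_pow, evH_C, map_sub, evH_X, map_ofNat]
    have h : SemiconjBy (uF k) (uH k - 2) (uH k) := by
      rw [SemiconjBy, mul_sub, (isSl2Rel_u k).hf, mul_two, two_mul]
    rw [mul_assoc, ← (h.pow_right n).eq, ← mul_assoc, (aeval_casimir_commute a _).eq, mul_assoc]

theorem evH_mul_e (P : k[X][X]) : evH k P * uE k = uE k * evH k (P.comp (X + 2)) := by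
  induction P using Polynomial.induction_on' with
  | add p q hp hq => rw [map_add, add_mul, hp, hq, add_comp, map_add, mul_add]
  | monomial n a =>
    rw [← C_mul_X_pow_eq_monomial, mul_comp, C_comp, pow_comp, X_comp, map_mul, map_mul, map_pow,
      map_pow, evH_C, map_add, evH_X, map_ofNat]
    have h : SemiconjBy (uE k) (uH k + 2) (uH k) := by
      rw [SemiconjBy, mul_add, (isSl2Rel_u k).he, mul_two, two_mul]
    rw [mul_assoc, ← (h.pow_right n).eq, ← mul_assoc, (aeval_casimir_commute a _).eq, mul_assoc]

theorem evH_mul_f_pow (n : ℕ) (P : k[X][X]) : ∃ Q, evH k P * uF k ^ n = uF k ^ n * evH k Q := by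
  induction n with
  | zero => exact ⟨P, by simp⟩
  | succ n ih =>
    obtain ⟨Q, hQ⟩ := ih
    exact ⟨_, by rw [pow_succ, ← mul_assoc, hQ, mul_assoc, evH_mul_f, mul_assoc]⟩

theorem evH_mul_e_pow (n : ℕ) (P : k[X][X]) : ∃ Q, evH k P * uE k ^ n = uE k ^ n * evH k Q := by
  induction n with
  | zero => exact ⟨P, by simp⟩
  | succ n ih =>
    obtain ⟨Q, hQ⟩ := ih
    exact ⟨_, by rw [pow_succ, ← mul_assoc, hQ, mul_assoc, evH_mul_e, mul_assoc]⟩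

variable (k) in
/-- The element `e ^ i` or `f ^ (-i)` of weight `2 i`. -/
def wt : ℤ → USl2 k
  | Int.ofNat n => uE k ^ n
  | Int.negSucc n => uF k ^ (n + 1)

theorem wt_natCast (n : ℕ) : wt k n = uE k ^ n := rfl

theorem wt_neg_natCast (n : ℕ) : wt k (-n) = uF k ^ n := by
  cases n with
  | zero => rw [Nat.cast_zero, neg_zero, pow_zero]; exact pow_zero _
  | succ n => rfl

theorem evH_mul_wt (i : ℤ) (P : k[X][X]) : ∃ Q, evH k P * wt k i = wt k i * evH k Q := by
  cases i with
  | ofNat n => exact evH_mul_e_pow n P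
  | negSucc n => exact evH_mul_f_pow (n + 1) P

variable [CharZero k]

/-- The definition of the Casimir element is solved for `fe`. Mixed products of `e` and `f` thus
reduce to `k[c][h]`, and powers of one of the two suffice. -/
theorem exists_uF_mul_uE : ∃ P, uF k * uE k = evH k P := by
  refine ⟨C (C (1 / 4)) * (C X - (X + 1) ^ 2), ?_⟩
  have h4 : algebraMap k (USl2 k) (1 / 4) * 4 = 1 := by
    rw [show (4 : USl2 k) = algebraMap k _ 4 by rw [map_ofNat], ← map_mul]
    norm_num
  rw [map_mul, map_sub, map_pow, map_add, map_one, evH_C, evH_C, evH_X, aeval_X, aeval_C, casimir,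
    add_sub_cancel_right, ← mul_assoc, ← mul_assoc, h4, one_mul]

theorem exists_uE_mul_uF : ∃ P, uE k * uF k = evH k P := by
  obtain ⟨P, hP⟩ := exists_uF_mul_uE (k := k)
  exact ⟨P + X, by rw [map_add, evH_X, ← hP, (isSl2Rel_u k).ef]⟩

variable (k) in
/-- The linear map whose bijectivity is the Poincaré–Birkhoff–Witt theorem for `U(sl₂)`. -/
noncomputable def pbw : (ℤ →₀ k[X][X]) →+ USl2 k :=
  Finsupp.liftAddHom fun i => (AddMonoidHom.mulLeft (wt k i)).comp (evH k).toAddMonoidHom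

omit [CharZero k] in
@[simp]
theorem pbw_single (i : ℤ) (P : k[X][X]) : pbw k (Finsupp.single i P) = wt k i * evH k P := by
  simp [pbw]

omit [CharZero k] in
theorem pbw_apply (s : ℤ →₀ k[X][X]) : pbw k s = s.sum fun i P => wt k i * evH k P := by
  rfl

omit [CharZero k] in
theorem mul_pbw_mem {u : USl2 k} (h : ∀ i, ∃ j P, u * wt k i = wt k j * evH k P)
    (s : ℤ →₀ k[X][X]) : ∃ s', u * pbw k s = pbw k s' := by
  induction s using Finsupp.induction_linear with
  | zero => exact ⟨0, by simp⟩
  | add a b ha hb =>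
    obtain ⟨a', ha⟩ := ha
    obtain ⟨b', hb⟩ := hb
    exact ⟨a' + b', by rw [map_add, mul_add, ha, hb, map_add]⟩
  | single i P =>
    obtain ⟨j, Q, hj⟩ := h i
    exact ⟨Finsupp.single j (Q * P), by
      rw [pbw_single, pbw_single, ← mul_assoc, hj, map_mul, mul_assoc]⟩

/-- The image contains `1` and is stable under left multiplication by the generators. -/
theorem pbw_surjective : Function.Surjective (pbw k) := by
  suffices H : ∀ u : USl2 k, ∀ s, ∃ s', u * pbw k s = pbw k s' by
    intro u
    obtain ⟨s, hs⟩ := H u (Finsupp.single 0 1)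
    refine ⟨s, ?_⟩
    rw [← hs, pbw_single, map_one, mul_one, show wt k 0 = uE k ^ 0 from rfl, pow_zero, mul_one]
  intro u
  induction u using u_induction with
  | he =>
    apply mul_pbw_mem
    rintro (n | n)
    · exact ⟨(n + 1 : ℕ), 1, by
        rw [map_one, mul_one, wt_natCast, pow_succ']; rfl⟩
    · obtain ⟨P, hP⟩ := exists_uE_mul_uF (k := k)
      obtain ⟨Q, hQ⟩ := evH_mul_f_pow n P
      exact ⟨-n, Q, by
        rw [wt_neg_natCast, ← hQ, ← hP, mul_assoc, ← pow_succ']; rfl⟩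
  | hf =>
    apply mul_pbw_mem
    rintro (n | n)
    · rcases n with _ | n
      · exact ⟨-(1 : ℕ), 1, by
          rw [map_one, mul_one, wt_neg_natCast, pow_one, show wt k (Int.ofNat 0) = uE k ^ 0 from rfl,
            pow_zero, mul_one]⟩
      · obtain ⟨P, hP⟩ := exists_uF_mul_uE (k := k)
        obtain ⟨Q, hQ⟩ := evH_mul_e_pow n P
        exact ⟨n, Q, by
          rw [wt_natCast, ← hQ, ← hP, mul_assoc, ← pow_succ']; rfl⟩
    · exact ⟨-(n + 2 : ℕ), 1, by
        rw [map_one, mul_one, wt_neg_natCast, pow_succ']; rfl⟩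
  | hh =>
    apply mul_pbw_mem
    intro i
    obtain ⟨Q, hQ⟩ := evH_mul_wt (k := k) i X
    exact ⟨i, Q, by rw [← hQ, evH_X]⟩
  | halg a =>
    apply mul_pbw_mem
    intro i
    exact ⟨i, C (C a), by rw [evH_C, aeval_C, Algebra.commutes]⟩
  | hadd u v hu hv =>
    intro s
    obtain ⟨a, ha⟩ := hu s
    obtain ⟨b, hb⟩ := hv s
    exact ⟨a + b, by rw [map_add, add_mul, ha, hb]⟩
  | hmul u v hu hv =>
    intro s
    obtain ⟨a, ha⟩ := hv s
    obtain ⟨b, hb⟩ := hu a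
    exact ⟨b, by rw [mul_assoc, ha, hb]⟩

end Enveloping

/-! ### The generic parameter `λ` and its integer translates. -/

section Scalars

variable (k : Type*) [Field k]

/-- The field of rational functions in one variable over `k`. -/
def GenField : Type _ := RatFunc k

noncomputable instance : Field (GenField k) := inferInstanceAs (Field (RatFunc k))

noncomputable instance : Algebra k (GenField k) := inferInstanceAs (Algebra k (RatFunc k))

instance [CharZero k] : CharZero (GenField k) := inferInstanceAs (CharZero (RatFunc k))

/-- The generator of `GenField k`. -/
noncomputable def genParam : GenField k := (RatFunc.X : RatFunc k)

theorem transcendental_genParam : Transcendental k (genParam k) := RatFunc.transcendental_X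

/-- The generic parameter, shifted by an integer. -/
noncomputable def lam (b : ℤ) : GenField k := genParam k + (b : GenField k)

variable {k}

theorem lam_add (b c : ℤ) : lam k (b + c) = lam k b + c := by
  rw [lam, lam, Int.cast_add, add_assoc]

theorem lam_sub (b c : ℤ) : lam k (b - c) = lam k b - c := by
  rw [lam, lam, Int.cast_sub, add_sub_assoc]

theorem aeval_lam_add (b c : ℤ) (p : k[X]) :
    aeval (lam k (b + c)) p = aeval (lam k b) (p.comp (X + C (c : k))) := by
  rw [aeval_comp]
  congr 1
  simp [lam_add]

theorem aeval_lam_injective (b : ℤ) : Function.Injective (aeval (lam k b) : k[X] →ₐ[k] GenField k) := by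
  intro p q h
  have hb : lam k (0 + b) = lam k b := by rw [zero_add]
  rw [← hb, aeval_lam_add, aeval_lam_add, lam, Int.cast_zero, add_zero] at h
  have h' := congrArg (fun r : k[X] => r.comp (X - C (b : k)))
    (transcendental_iff_injective.mp (transcendental_genParam k) h)
  simpa [comp_assoc] using h'

theorem aeval_lam_sq (b : ℤ) (p : k[X]) :
    aeval (lam k b ^ 2) p = aeval (lam k b) (expand k 2 p) := by
  rw [expand_aeval]

theorem aeval_lam_sq_injective (b : ℤ) :
    Function.Injective (aeval (lam k b ^ 2) : k[X] →ₐ[k] GenField k) := by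
  intro p q h
  rw [aeval_lam_sq, aeval_lam_sq] at h
  exact expand_injective two_pos (aeval_lam_injective b h)

theorem lam_ne_zero (b : ℤ) : lam k b ≠ 0 := by
  intro h
  have := aeval_lam_injective (k := k) b (a₁ := X) (a₂ := 0) (by rw [aeval_X, h, map_zero])
  exact X_ne_zero this

/-- This genericity keeps the structure constants of `e` nonzero: no row of the model has a highest
or lowest weight vector. -/
theorem lam_sq_sub_ne_zero (b m : ℤ) : lam k b ^ 2 - (m : GenField k) ^ 2 ≠ 0 := by
  intro h
  have := aeval_lam_injective (k := k) b (a₁ := X ^ 2 - C ((m : k) ^ 2)) (a₂ := 0) (by simp [h])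
  exact X_pow_sub_C_ne_zero two_pos _ this

end Scalars

/-! ### The generic Gelfand–Tsetlin module and PBW for `U(sl₂)`. -/

section Model

variable (k : Type*) [Field k]

/-- The space of the generic Gelfand–Tsetlin module. -/
abbrev GT : Type _ := ℤ → ℤ → (GenField k)[X]

variable {k} in
theorem GT.hom_ext {f g : Module.End (GenField k)[X] (GT k)}
    (h : ∀ φ b m, f φ b m = g φ b m) : f = g :=
  LinearMap.ext fun φ => funext fun b => funext fun m => h φ b m

/-- The structure constants of the action of `e`. -/
noncomputable def eCoeff (b m : ℤ) : GenField k := (lam k b ^ 2 - ((m + 1 : ℤ) : GenField k) ^ 2) / 4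

/-- The action of `e`. -/
noncomputable def opE : Module.End (GenField k)[X] (GT k) where
  toFun φ b m := eCoeff k b (m - 2) • φ b (m - 2)
  map_add' φ ψ := by
    funext b m
    simp
  map_smul' r φ := by
    funext b m
    simp

/-- The action of `f`. -/
noncomputable def opF : Module.End (GenField k)[X] (GT k) where
  toFun φ b m := φ b (m + 2)
  map_add' _ _ := rfl
  map_smul' _ _ := rfl

/-- The action of `h`. -/
noncomputable def opH : Module.End (GenField k)[X] (GT k) where
  toFun φ b m := (m : GenField k) • φ b m
  map_add' φ ψ := by
    funext b m
    simp
  map_smul' r φ := by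
    funext b m
    simp

variable {k}

theorem opE_apply (φ : GT k) (b m : ℤ) : opE k φ b m = eCoeff k b (m - 2) • φ b (m - 2) := rfl

theorem opF_apply (φ : GT k) (b m : ℤ) : opF k φ b m = φ b (m + 2) := rfl

theorem opH_apply (φ : GT k) (b m : ℤ) : opH k φ b m = (m : GenField k) • φ b m := rfl

variable [CharZero k]

variable (k) in
-- Since `f` is a pure shift, `fe` acts in weight `m` by `eCoeff k b m`. This is `c = 4fe + (h+1)²`
-- solved for `fe` at `c = (λ+b)²`.
theorem isSl2Rel_op : IsSl2Rel (opE k) (opF k) (opH k) := by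
  refine ⟨GT.hom_ext fun φ b m => ?_, GT.hom_ext fun φ b m => ?_, GT.hom_ext fun φ b m => ?_⟩
  · simp only [two_mul, LinearMap.add_apply, Module.End.mul_apply, Pi.add_apply, opE_apply,
      opH_apply, Int.cast_sub]
    module
  · simp only [two_mul, LinearMap.add_apply, LinearMap.sub_apply, Module.End.mul_apply,
      Pi.add_apply, Pi.sub_apply, opF_apply, opH_apply, Int.cast_add]
    module
  · simp only [LinearMap.add_apply, Module.End.mul_apply, Pi.add_apply, opE_apply,
      opF_apply, opH_apply, eCoeff, sub_add_cancel, add_sub_cancel_right]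
    rw [← add_smul]
    congr 1
    push_cast
    ring

variable (k) in
/-- The action of `U(sl₂)` on the generic Gelfand–Tsetlin module. -/
noncomputable def actU : USl2 k →ₐ[k] Module.End (GenField k)[X] (GT k) := liftU (isSl2Rel_op k)

@[simp]
theorem actU_uE : actU k (uE k) = opE k := liftU_uE _

@[simp]
theorem actU_uF : actU k (uF k) = opF k := liftU_uF _

@[simp]
theorem actU_uH : actU k (uH k) = opH k := liftU_uH _

theorem actU_casimir_apply (φ : GT k) (b m : ℤ) :
    actU k (casimir k) φ b m = lam k b ^ 2 • φ b m := by
  rw [actU, liftU_casimir]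
  rw [show (4 : Module.End (GenField k)[X] (GT k)) = 1 + 1 + 1 + 1 by norm_num, sq (opH k + 1)]
  simp only [LinearMap.add_apply, Module.End.mul_apply, Pi.add_apply, opE_apply, add_mul,
    opF_apply, opH_apply, eCoeff, Module.End.one_apply, add_sub_cancel_right]
  match_scalars
  ring

theorem actU_aeval_casimir_apply (p : k[X]) (φ : GT k) (b m : ℤ) :
    actU k (aeval (casimir k) p) φ b m = aeval (lam k b ^ 2) p • φ b m := by
  induction p using Polynomial.induction_on generalizing φ with
  | C a =>
    rw [aeval_C, aeval_C, AlgHom.commutes, Module.algebraMap_end_apply, algebraMap_smul]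
    rfl
  | add p q hp hq =>
    rw [map_add, map_add, map_add, LinearMap.add_apply, Pi.add_apply, Pi.add_apply, hp, hq,
      add_smul]
  | monomial n a ih =>
    rw [pow_succ, ← mul_assoc, map_mul, map_mul, aeval_X, Module.End.mul_apply, ih,
      actU_casimir_apply, smul_smul, map_mul _ _ X, aeval_X]

variable (k) in
/-- The basis vectors of the generic Gelfand–Tsetlin module. -/
noncomputable def gtVec (b m : ℤ) : GT k := fun b' m' => if b' = b ∧ m' = m then 1 else 0

omit [CharZero k] in
theorem gtVec_apply (b m b' m' : ℤ) :
    gtVec k b m b' m' = if b' = b ∧ m' = m then 1 else 0 := rfl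

theorem actU_evH_apply (P : k[X][X]) (φ : GT k) (b m : ℤ) :
    actU k (evH k P) φ b m = (P.map (aeval (lam k b ^ 2) : k[X] →ₐ[k] GenField k).toRingHom).eval
      (m : GenField k) • φ b m := by
  induction P using Polynomial.induction_on generalizing φ with
  | C p =>
    rw [evH_C, actU_aeval_casimir_apply, map_C, eval_C]
    rfl
  | add p q hp hq =>
    rw [map_add, map_add, LinearMap.add_apply, Pi.add_apply, Pi.add_apply, hp, hq,
      Polynomial.map_add, eval_add, add_smul]
  | monomial n a ih =>
    rw [pow_succ, ← mul_assoc, map_mul, map_mul, evH_X, Module.End.mul_apply, ih, actU_uH,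
      opH_apply, smul_smul, Polynomial.map_mul (q := X), map_X, eval_mul_X]

theorem actU_wt_apply (i b m : ℤ) :
    ∃ c : GenField k, c ≠ 0 ∧ ∀ φ : GT k, actU k (wt k i) φ b m = c • φ b (m - 2 * i) := by
  have he : ∀ n : ℕ, ∀ m, ∃ c : GenField k, c ≠ 0 ∧ ∀ φ : GT k,
      actU k (uE k ^ n) φ b m = c • φ b (m - 2 * n) := by
    intro n
    induction n with
    | zero => exact fun m => ⟨1, one_ne_zero, fun φ => by simp⟩
    | succ n ih =>
      intro m
      obtain ⟨c, hc, h⟩ := ih (m - 2)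
      refine ⟨eCoeff k b (m - 2) * c, mul_ne_zero ?_ hc, fun φ => ?_⟩
      · exact div_ne_zero (lam_sq_sub_ne_zero b _) (by norm_num)
      · rw [pow_succ', map_mul, Module.End.mul_apply, actU_uE, opE_apply, h, smul_smul]
        congr 2
        push_cast
        ring
  have hf : ∀ n : ℕ, ∀ m, ∀ φ : GT k, actU k (uF k ^ n) φ b m = φ b (m + 2 * n) := by
    intro n
    induction n with
    | zero => intro m φ; simp
    | succ n ih =>
      intro m φ
      rw [pow_succ', map_mul, Module.End.mul_apply, actU_uF, opF_apply, ih]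
      rw [add_assoc]
      congr 1
      push_cast
      ring
  cases i with
  | ofNat n => exact he n m
  | negSucc n =>
    refine ⟨1, one_ne_zero, fun φ => ?_⟩
    rw [one_smul]
    refine (hf (n + 1) m φ).trans ?_
    rw [Int.negSucc_eq]
    congr 1

/-- An element of `U(sl₂)` is determined by its action on the vectors `gtVec 0 m`. -/
theorem pbw_eq_zero (s : ℤ →₀ k[X][X])
    (h : ∀ m m' : ℤ, actU k (pbw k s) (gtVec k 0 m) 0 m' = 0) : s = 0 := by
  ext1 i
  rw [Finsupp.zero_apply]
  have h1 : ∀ m : ℤ, (((s i).map (aeval (lam k 0 ^ 2) : k[X] →ₐ[k] GenField k).toRingHom)).eval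
      (m : GenField k) = 0 := by
    intro m
    -- Only the summand of weight `2 i` carries weight `m` to weight `m + 2 i`. The entry there is,
    -- up to a nonzero factor, `s i` evaluated at `c = λ²`, `h = m`; infinitely many `m` determine
    -- it.
    have h2 := h m (m + 2 * i)
    rw [pbw_apply, Finsupp.sum, map_sum, LinearMap.sum_apply, Finset.sum_apply,
      Finset.sum_apply, Finset.sum_eq_single i] at h2
    · obtain ⟨c, hc, hw⟩ := actU_wt_apply (k := k) i 0 (m + 2 * i)
      rw [map_mul, Module.End.mul_apply, hw, actU_evH_apply, add_sub_cancel_right, gtVec_apply,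
        if_pos ⟨rfl, rfl⟩, smul_smul] at h2
      exact (mul_eq_zero.mp ((smul_eq_zero.mp h2).resolve_right one_ne_zero)).resolve_left hc
    · intro j _ hj
      obtain ⟨c, hc, hw⟩ := actU_wt_apply (k := k) j 0 (m + 2 * i)
      rw [map_mul, Module.End.mul_apply, hw, actU_evH_apply, gtVec_apply, if_neg, smul_zero,
        smul_zero]
      omega
    · intro hi
      rw [Finsupp.notMem_support_iff.mp hi]
      simp
  have h2 : (s i).map (aeval (lam k 0 ^ 2) : k[X] →ₐ[k] GenField k).toRingHom = 0 := by
    apply eq_of_infinite_eval_eq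
    refine Set.Infinite.mono (s := Set.range fun n : ℤ => (n : GenField k)) ?_ ?_
    · rintro _ ⟨n, rfl⟩
      simp only [Set.mem_ofPred_eq, h1, eval_zero]
    · exact Set.infinite_range_of_injective Int.cast_injective
  exact (Polynomial.map_eq_zero_iff (aeval_lam_sq_injective 0)).mp h2

theorem pbw_injective : Function.Injective (pbw k) := by
  rw [injective_iff_map_eq_zero]
  intro s hs
  exact pbw_eq_zero s fun m m' => by rw [hs, map_zero]; rfl

theorem eq_zero_of_actU_eq_zero {u : USl2 k}
    (h : ∀ m m' : ℤ, actU k u (gtVec k 0 m) 0 m' = 0) : u = 0 := by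
  obtain ⟨s, rfl⟩ := pbw_surjective u
  rw [pbw_eq_zero s h, map_zero]

theorem aeval_casimir_injective : Function.Injective (aeval (casimir k) : k[X] →ₐ[k] USl2 k) := by
  intro p q h
  have h' : pbw k (Finsupp.single 0 (C p)) = pbw k (Finsupp.single 0 (C q)) := by
    rw [pbw_single, pbw_single, evH_C, evH_C, h]
  exact C_injective (Finsupp.single_injective _ (pbw_injective h'))

end Model

/-! ### Lowest weight vectors in `U(sl₂)` and the center of `U(sl₂)`. -/

section LowestWeight

variable {k : Type*} [Field k] [CharZero k]

omit [CharZero k] in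
theorem uH_mul_wt (i : ℤ) : uH k * wt k i = wt k i * uH k + (2 * i) • wt k i := by
  have r := isSl2Rel_u k
  cases i with
  | ofNat n =>
    rw [wt]
    induction n with
    | zero => simp
    | succ n ih =>
      rw [pow_succ, ← mul_assoc, ih, add_mul, mul_assoc, r.he, smul_mul_assoc]
      have h : (2 * Int.ofNat (n + 1) : ℤ) = 2 * Int.ofNat n + 2 := by
        simp
        ring
      rw [h, add_smul, two_smul ℤ (uE k ^ n * uE k)]
      noncomm_ring
  | negSucc n =>
    rw [wt]
    induction n with
    | zero =>
      rw [zero_add, pow_one, r.hf]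
      simp
      noncomm_ring
    | succ n ih =>
      rw [pow_succ, ← mul_assoc, ih, add_mul, mul_assoc, r.hf, smul_mul_assoc]
      have h : (2 * Int.negSucc (n + 1) : ℤ) = 2 * Int.negSucc n - 2 := by
        rw [Int.negSucc_eq, Int.negSucc_eq]
        push_cast
        ring
      rw [h, sub_smul, two_smul ℤ (uF k ^ (n + 1) * uF k)]
      noncomm_ring

omit [CharZero k] in
theorem exists_pbw_eq_commutator (s : ℤ →₀ k[X][X]) :
    ∃ s' : ℤ →₀ k[X][X], uH k * pbw k s - pbw k s * uH k = pbw k s' ∧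
      ∀ i, s' i = (2 * i) • s i := by
  induction s using Finsupp.induction_linear with
  | zero => exact ⟨0, by simp, by simp⟩
  | add a b ha hb =>
    obtain ⟨a', ha, ha'⟩ := ha
    obtain ⟨b', hb, hb'⟩ := hb
    refine ⟨a' + b', ?_, fun i => ?_⟩
    · rw [map_add, map_add, ← ha, ← hb]
      noncomm_ring
    · rw [Finsupp.add_apply, Finsupp.add_apply, ha', hb', smul_add]
  | single i P =>
    refine ⟨Finsupp.single i ((2 * i) • P), ?_, fun j => ?_⟩
    · have h : evH k P * uH k = uH k * evH k P := by
        rw [← evH_X, ← map_mul, ← map_mul, mul_comm]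
      rw [pbw_single, pbw_single, ← mul_assoc, uH_mul_wt, mul_assoc, h, map_zsmul, add_mul,
        mul_assoc, add_sub_cancel_left, smul_mul_assoc, mul_smul_comm]
    · by_cases h : i = j
      · subst h
        simp
      · simp [Finsupp.single_eq_of_ne (Ne.symm h)]

/-- The lowest weight vectors of the adjoint representation of `sl₂` on `U(sl₂)`. -/
theorem eq_of_lowest_weight {u : USl2 k} {n : ℕ}
    (hh : uH k * u - u * uH k = -(n : ℤ) • u) (hf : uF k * u = u * uF k) (hu : u ≠ 0) :
    ∃ (m : ℕ) (q : k[X]), n = 2 * m ∧ u = uF k ^ m * aeval (casimir k) q := by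
  obtain ⟨s, rfl⟩ := pbw_surjective u
  obtain ⟨s', h1, h2⟩ := exists_pbw_eq_commutator s
  rw [hh, ← map_zsmul] at h1
  -- The weight condition leaves only the component with `2 i = -n`.
  have h3 : ∀ i : ℤ, (2 * i + n) • s i = 0 := by
    intro i
    have := DFunLike.congr_fun (pbw_injective h1) i
    rw [h2, Finsupp.smul_apply] at this
    rw [add_smul, ← this, neg_smul, neg_add_cancel]
  have h4 : ∀ i : ℤ, 2 * i + n ≠ 0 → s i = 0 := fun i hi => (smul_eq_zero.mp (h3 i)).resolve_left hi
  obtain ⟨m, rfl⟩ : ∃ m, n = 2 * m := by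
    by_contra! hn
    refine hu ?_
    rw [show s = 0 from ?_, map_zero]
    ext1 i
    apply h4
    intro hi
    have := hn (-i).toNat
    omega
  have hs : s = Finsupp.single (-(m : ℤ)) (s (-m)) := by
    ext1 i
    by_cases h : i = -(m : ℤ)
    · rw [h, Finsupp.single_eq_same]
    · rw [Finsupp.single_eq_of_ne h]
      apply h4
      push_cast
      omega
  rw [hs, pbw_single, wt_neg_natCast] at hf ⊢
  set P := s (-m)
  rw [← mul_assoc, ← pow_succ', mul_assoc _ _ (uF k), evH_mul_f, ← mul_assoc, ← pow_succ,
    ← wt_neg_natCast, ← pbw_single, ← pbw_single] at hf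
  have hP := Finsupp.single_injective _ (pbw_injective hf)
  -- Commuting with `f` makes `P` invariant under `h ↦ h - 2`, so `P` does not involve `h`.
  have hP' : P.comp (X + C (-2)) = P := by
    conv_rhs => rw [hP]
    rw [C_neg, ← sub_eq_add_neg]
    rfl
  have hP'' := eq_C_of_comp_X_add_C_eq (by norm_num) hP'
  refine ⟨m, P.eval 0, rfl, ?_⟩
  conv_lhs => rw [hP'']
  rw [evH_C]

/-- A central element is a lowest weight vector of weight zero, so no power of `f` occurs. -/
theorem exists_eq_aeval_casimir {u : USl2 k} (hu : u ∈ Subalgebra.center k (USl2 k)) :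
    ∃ q : k[X], u = aeval (casimir k) q := by
  by_cases h0 : u = 0
  · exact ⟨0, by simp [h0]⟩
  rw [Subalgebra.mem_center_iff] at hu
  obtain ⟨m, q, hm, hq⟩ := eq_of_lowest_weight (n := 0) (by simp [hu]) (hu _) h0
  obtain rfl : m = 0 := by omega
  exact ⟨q, by rw [hq, pow_zero, one_mul]⟩

end LowestWeight

/-- The relations between a triple of elements of an associative ring and a pair spanning the
standard representation. -/
structure IsVRel {A : Type*} [Ring A] (E F H X Y : A) : Prop where
  ex : E * X = X * E
  ey : E * Y = Y * E + X
  fx : F * X = X * F + Y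
  fy : F * Y = Y * F
  hx : H * X = X * H + X
  hy : H * Y = Y * H - Y

/-! ### Generators, relations and the universal property of `H_z`. -/

section Presentation

variable {k : Type*} [Field k]

/-- The linear map from `V` with given values on the standard basis. -/
def liftV {A : Type*} [Ring A] [Algebra k A] (X Y : A) : V k →ₗ[k] A where
  toFun v := v 0 • X + v 1 • Y
  map_add' v w := by
    simp only [Pi.add_apply]
    module
  map_smul' t v := by
    simp only [Pi.smul_apply, smul_eq_mul, RingHom.id_apply]
    module

theorem liftV_apply {A : Type*} [Ring A] [Algebra k A] (X Y : A) (v : V k) :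
    liftV X Y v = v 0 • X + v 1 • Y := rfl

section

variable {A : Type*} [Ring A] [Algebra k A] {E F T X Y : A}

theorem liftSl2_mul_liftV (r : IsSl2Rel E F T) (rv : IsVRel E F T X Y) (a : Sl2 k) (v : V k) :
    liftSl2 r a * liftV X Y v = liftV X Y v * liftSl2 r a + liftV X Y (Matrix.mulVec a.1 v) := by
  have h : a.1 1 1 = - a.1 0 0 := by
    have := a.2
    change Matrix.trace a.1 = 0 at this
    rw [Matrix.trace_fin_two] at this
    linear_combination this
  simp only [liftSl2_apply, liftV_apply, Matrix.mulVec, dotProduct, Fin.sum_univ_two, h, mul_add,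
    add_mul, smul_mul_smul_comm, rv.ex, rv.ey, rv.fx, rv.fy, rv.hx, rv.hy]
  module

/-- The algebra morphism from `TV ⋊ U(sl₂)` defined by elements satisfying the relations. -/
noncomputable def liftSmash (r : IsSl2Rel E F T) (rv : IsVRel E F T X Y) : Smash k →ₐ[k] A :=
  RingQuot.liftAlgHom k ⟨TensorAlgebra.lift k ((liftSl2 (k := k) r).toLinearMap.coprod (liftV X Y)), by
    rintro _ _ (⟨a, b⟩ | ⟨a, v⟩)
    · have h := LieHom.map_lie (liftSl2 (k := k) r) a b
      rw [LieRing.of_associative_ring_bracket, eq_sub_iff_add_eq] at h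
      simp [← h, add_comm]
    · have h := liftSl2_mul_liftV r rv a v
      simpa using h⟩

theorem liftSmash_mk (r : IsSl2Rel E F T) (rv : IsVRel E F T X Y) (s : TensorAlgebra k (Sl2 k × V k)) :
    liftSmash r rv (Smash.mk k s) =
      TensorAlgebra.lift k ((liftSl2 (k := k) r).toLinearMap.coprod (liftV X Y)) s :=
  RingQuot.liftAlgHom_mkAlgHom_apply k _ _ s

theorem liftSmash_ofV (r : IsSl2Rel E F T) (rv : IsVRel E F T X Y) (v : V k) :
    liftSmash r rv (Smash.ofV k v) = liftV X Y v := by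
  refine (liftSmash_mk r rv _).trans ?_
  simp

theorem liftSmash_ofSl2 (r : IsSl2Rel E F T) (rv : IsVRel E F T X Y) (a : Sl2 k) :
    liftSmash r rv (Smash.ofSl2 k a) = liftSl2 r a := by
  refine (liftSmash_mk r rv _).trans ?_
  simp

theorem ofU_ι (a : Sl2 k) : Smash.ofU k (UniversalEnvelopingAlgebra.ι k a) = Smash.ofSl2 k a :=
  UniversalEnvelopingAlgebra.lift_ι_apply k _ a

theorem liftSmash_ofU (r : IsSl2Rel E F T) (rv : IsVRel E F T X Y) (u : USl2 k) :
    liftSmash r rv (Smash.ofU k u) = liftU r u := by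
  have h : (liftSmash r rv).comp (Smash.ofU k) = liftU r := by
    apply algHom_eq_liftU
    · rw [AlgHom.comp_apply, uE, ofU_ι, liftSmash_ofSl2]
      simp [liftSl2_apply, slE_apply]
    · rw [AlgHom.comp_apply, uF, ofU_ι, liftSmash_ofSl2]
      simp [liftSl2_apply, slF_apply]
    · rw [AlgHom.comp_apply, uH, ofU_ι, liftSmash_ofSl2]
      simp [liftSl2_apply, slH_apply]
  exact DFunLike.congr_fun h u

/-- The algebra morphism from `H_z` defined by elements satisfying the relations. -/
noncomputable def liftH {z : USl2 k} (r : IsSl2Rel E F T) (rv : IsVRel E F T X Y)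
    (hz : X * Y - Y * X = liftU r z) : H z →ₐ[k] A :=
  RingQuot.liftAlgHom k ⟨liftSmash r rv, by
    rintro _ _ ⟨⟩
    rw [map_sub, map_mul, map_mul, liftSmash_ofV, liftSmash_ofV, liftSmash_ofU, ← hz]
    simp [liftV_apply]⟩

variable {z : USl2 k} (r : IsSl2Rel E F T) (rv : IsVRel E F T X Y) (hz : X * Y - Y * X = liftU r z)

theorem liftH_mk (s : Smash k) : liftH r rv hz (H.mk z s) = liftSmash r rv s :=
  RingQuot.liftAlgHom_mkAlgHom_apply k _ _ s

theorem liftH_ofV (v : V k) : liftH r rv hz (H.ofV z v) = liftV X Y v :=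
  (liftH_mk r rv hz _).trans (liftSmash_ofV r rv v)

theorem liftH_ofU (u : USl2 k) : liftH r rv hz (H.ofU z u) = liftU r u :=
  (liftH_mk r rv hz _).trans (liftSmash_ofU r rv u)

end

section

variable (z : USl2 k)

/-- The element `x` of `H_z`. -/
noncomputable def hX : H z := H.ofV z (Pi.single 0 1)

/-- The element `y` of `H_z`. -/
noncomputable def hY : H z := H.ofV z (Pi.single 1 1)

theorem ofV_eq (v : V k) : H.ofV z v = v 0 • hX z + v 1 • hY z := by
  have hv : v = v 0 • Pi.single 0 1 + v 1 • Pi.single 1 1 := by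
    ext i
    fin_cases i <;> simp
  conv_lhs => rw [hv]
  rw [map_add, map_smul, map_smul, hX, hY]

theorem ofU_ι_mul_ofV (a : Sl2 k) (v : V k) :
    H.ofU z (UniversalEnvelopingAlgebra.ι k a) * H.ofV z v =
      H.ofV z v * H.ofU z (UniversalEnvelopingAlgebra.ι k a) + H.ofV z (Matrix.mulVec a.1 v) := by
  have h : Smash.mk k _ = Smash.mk k _ := RingQuot.mkAlgHom_rel k (SmashRel.act a v)
  rw [map_add, map_mul, map_mul] at h
  have h1 : ∀ a, H.ofU z (UniversalEnvelopingAlgebra.ι k a) =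
      H.mk z (Smash.mk k (TensorAlgebra.ι k (a, 0))) := fun a => by
    rw [H.ofU, AlgHom.comp_apply, ofU_ι]
    rfl
  have h2 : ∀ v, H.ofV z v = H.mk z (Smash.mk k (TensorAlgebra.ι k (0, v))) := fun v => rfl
  rw [h1, h2, h2, ← map_mul (H.mk z), ← map_mul (H.mk z), h, map_add]

theorem isSl2Rel_ofU : IsSl2Rel (H.ofU z (uE k)) (H.ofU z (uF k)) (H.ofU z (uH k)) := by
  have r := isSl2Rel_u k
  refine ⟨?_, ?_, ?_⟩
  · rw [← map_mul, r.he, map_add, map_mul, map_mul, map_ofNat]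
  · rw [← map_mul, r.hf, map_sub, map_mul, map_mul, map_ofNat]
  · rw [← map_mul, r.ef, map_add, map_mul]

theorem isVRel_h :
    IsVRel (H.ofU z (uE k)) (H.ofU z (uF k)) (H.ofU z (uH k)) (hX z) (hY z) := by
  have hx : ∀ a, H.ofU z (UniversalEnvelopingAlgebra.ι k a) * hX z =
      hX z * H.ofU z (UniversalEnvelopingAlgebra.ι k a) + (a.1 0 0 • hX z + a.1 1 0 • hY z) := by
    intro a
    have h := ofU_ι_mul_ofV z a (Pi.single 0 1)
    rw [ofV_eq z (Matrix.mulVec _ _), Matrix.mulVec_single_one] at h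
    exact h
  have hy : ∀ a, H.ofU z (UniversalEnvelopingAlgebra.ι k a) * hY z =
      hY z * H.ofU z (UniversalEnvelopingAlgebra.ι k a) + (a.1 0 1 • hX z + a.1 1 1 • hY z) := by
    intro a
    have h := ofU_ι_mul_ofV z a (Pi.single 1 1)
    rw [ofV_eq z (Matrix.mulVec _ _), Matrix.mulVec_single_one] at h
    exact h
  refine ⟨(hx _).trans ?_, (hy _).trans ?_, (hx _).trans ?_, (hy _).trans ?_, (hx _).trans ?_,
    (hy _).trans ?_⟩ <;>
  simp [slE_apply, slF_apply, slH_apply, uE, uF, uH, ← sub_eq_add_neg]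

theorem hX_mul_hY : hX z * hY z = hY z * hX z + H.ofU z z := by
  have h : H.mk z _ = H.mk z _ := RingQuot.mkAlgHom_rel k (HRel.comm (z := z))
  rw [map_sub, map_mul, map_mul, sub_eq_iff_eq_add, add_comm] at h
  exact h

theorem adjoin_h_eq_top :
    Algebra.adjoin k {H.ofU z (uE k), H.ofU z (uF k), H.ofU z (uH k), hX z, hY z} = ⊤ := by
  set S := Algebra.adjoin k {H.ofU z (uE k), H.ofU z (uF k), H.ofU z (uH k), hX z, hY z}
  have h1 : ∀ s, H.mk z (Smash.mk k s) ∈ S := by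
    intro s
    induction s using TensorAlgebra.induction with
    | algebraMap c =>
      rw [AlgHom.commutes, AlgHom.commutes]
      exact S.algebraMap_mem c
    | ι av =>
      obtain ⟨a, v⟩ := av
      have h2 : H.mk z (Smash.mk k (TensorAlgebra.ι k (a, v))) =
          H.ofU z (UniversalEnvelopingAlgebra.ι k a) + H.ofV z v := by
        rw [H.ofU, AlgHom.comp_apply, ofU_ι, show ((a, v) : Sl2 k × V k) = (a, 0) + (0, v) by simp,
          map_add, map_add, map_add]
        rfl
      rw [h2, sl2_eq a, ofV_eq]
      simp only [map_add, map_smul]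
      refine S.add_mem (S.add_mem (S.add_mem ?_ ?_) ?_) (S.add_mem ?_ ?_) <;>
      · apply S.smul_mem
        exact Algebra.subset_adjoin (by simp [uE, uF, uH])
    | mul a b ha hb =>
      rw [map_mul, map_mul]
      exact S.mul_mem ha hb
    | add a b ha hb =>
      rw [map_add, map_add]
      exact S.add_mem ha hb
  rw [eq_top_iff]
  rintro p -
  obtain ⟨s, rfl⟩ := RingQuot.mkAlgHom_surjective k (HRel z) p
  obtain ⟨s, rfl⟩ := RingQuot.mkAlgHom_surjective k (SmashRel k) s
  exact h1 s

end

end Presentation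

/-! ### Up-and-down shift operators and their symbols. -/

section Potential

theorem lam_add_one {k : Type*} [Field k] (b : ℤ) : lam k (b + 1) = lam k b + 1 := by
  rw [lam_add, Int.cast_one]

theorem lam_sub_one {k : Type*} [Field k] (b : ℤ) : lam k (b - 1) = lam k b - 1 := by
  rw [lam_sub, Int.cast_one]

variable {k : Type*} [Field k] (g : k[X])

/-- The value at `lam b` of the polynomial `t + g`. -/
noncomputable def pot (b : ℤ) : (GenField k)[X] := X + C (aeval (lam k b) g)

variable (k) in
/-- The action of `x` or `y` in one weight: `α` and `β` are the coefficients of the two components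
shifting the parameter up and down. -/
noncomputable def shiftBoth (α β : ℤ → GenField k) (χ : ℤ → (GenField k)[X]) (b : ℤ) :
    (GenField k)[X] :=
  α (b - 1) • χ (b - 1) + β (b + 1) • (pot g (b + 1) * χ (b + 1))

/-- The filtration of the generic module, in one weight. -/
def InFil (n : ℕ) (χ : ℤ → (GenField k)[X]) : Prop :=
  ∀ (b : ℤ) (j : ℕ), (n < b + 2 * j ∨ b < -n) → (χ b).coeff j = 0

/-- The alternating sum of the components of the symbol of degree `n`. -/
noncomputable def symb (n : ℕ) (χ : ℤ → (GenField k)[X]) : GenField k :=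
  ∑ j ∈ Finset.range (n + 1), (-1) ^ j * (χ (n - 2 * j)).coeff j

theorem InFil.mono {n n' : ℕ} (h : n ≤ n') {χ : ℤ → (GenField k)[X]} (hχ : InFil n χ) :
    InFil n' χ := by
  intro b j hb
  apply hχ
  omega

theorem symb_eq_zero {n : ℕ} {χ : ℤ → (GenField k)[X]} (hχ : InFil n χ) : symb (n + 1) χ = 0 := by
  apply Finset.sum_eq_zero
  intro j _
  rw [hχ _ _ (by left; push_cast; omega), mul_zero]

theorem coeff_zero_pot_mul (b : ℤ) (q : (GenField k)[X]) :
    (pot g b * q).coeff 0 = aeval (lam k b) g * q.coeff 0 := by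
  simp [pot, mul_coeff_zero]

theorem coeff_succ_pot_mul (b : ℤ) (q : (GenField k)[X]) (j : ℕ) :
    (pot g b * q).coeff (j + 1) = q.coeff j + aeval (lam k b) g * q.coeff (j + 1) := by
  rw [pot, add_mul, coeff_add, coeff_X_mul, coeff_C_mul]

/-- The variable `t` counts with degree two and a shift by `b` with degree `b`. The downward shift
costs one but brings in `t + g`, so both components raise the degree by one. -/
theorem InFil.shiftBoth (α β : ℤ → GenField k) {n : ℕ} {χ : ℤ → (GenField k)[X]}
    (hχ : InFil n χ) : InFil (n + 1) (shiftBoth k g α β χ) := by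
  intro b j hb
  rw [InfHecke.shiftBoth, coeff_add, coeff_smul, coeff_smul, hχ (b - 1) j (by push_cast at hb; omega),
    smul_zero, zero_add]
  rcases j with _ | j
  · rw [coeff_zero_pot_mul, hχ (b + 1) 0 (by push_cast at hb ⊢; omega), mul_zero, smul_zero]
  · rw [coeff_succ_pot_mul, hχ (b + 1) j (by push_cast at hb ⊢; omega),
      hχ (b + 1) (j + 1) (by push_cast at hb ⊢; omega), mul_zero, zero_add, smul_zero]

/-- Writing `s` for the upward shift, the alternating sum evaluates the top-degree part at `t =
-s²`. There the downward component `t s⁻¹` becomes `-s`, so only `α - β` survives. This difference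
is `0` for `y` and `1` for `x`. -/
theorem symb_shiftBoth (α β : ℤ → GenField k) {n : ℕ} {χ : ℤ → (GenField k)[X]}
    (hχ : InFil n χ) : symb (n + 1) (shiftBoth k g α β χ) =
      ∑ j ∈ Finset.range (n + 1),
        (-1) ^ j * ((α (n - 2 * j) - β (n - 2 * j)) * (χ (n - 2 * j)).coeff j) := by
  have h0 : ∀ b m : ℤ, b = m → (χ b) = χ m := fun b m h => by rw [h]
  have hsum : ∀ j : ℕ, (-1 : GenField k) ^ j *
      (shiftBoth k g α β χ (((n + 1 : ℕ) : ℤ) - 2 * j)).coeff j =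
      (-1) ^ j * (α (n - 2 * j) * (χ (n - 2 * j)).coeff j) +
      (-1) ^ j * (β (n + 2 - 2 * j) * (pot g (n + 2 - 2 * j) * χ (n + 2 - 2 * j)).coeff j) := by
    intro j
    rw [shiftBoth, coeff_add, coeff_smul, coeff_smul, mul_add, smul_eq_mul, smul_eq_mul,
      show ((n + 1 : ℕ) : ℤ) - 2 * j - 1 = n - 2 * j by push_cast; ring,
      show ((n + 1 : ℕ) : ℤ) - 2 * j + 1 = n + 2 - 2 * j by push_cast; ring]
  rw [symb, Finset.sum_congr rfl fun j _ => hsum j, Finset.sum_add_distrib,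
    Finset.sum_range_succ, hχ _ (n + 1) (by right; push_cast; omega),
    Finset.sum_range_succ' (fun j : ℕ => (-1 : GenField k) ^ j *
      (β (n + 2 - 2 * j) * (pot g (n + 2 - 2 * j) * χ (n + 2 - 2 * j)).coeff j)),
    coeff_zero_pot_mul, hχ _ 0 (by left; push_cast; omega), mul_zero, mul_zero, mul_zero,
    mul_zero, mul_zero, add_zero, add_zero, ← Finset.sum_add_distrib]
  refine Finset.sum_congr rfl fun j _ => ?_
  rw [coeff_succ_pot_mul, hχ _ (j + 1) (by left; push_cast; omega), mul_zero, add_zero,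
    show (n : ℤ) + 2 - 2 * ((j + 1 : ℕ) : ℤ) = n - 2 * j by push_cast; ring, pow_succ]
  ring

end Potential

/-! ### The action of `x` and `y` on the generic module. -/

section ModelH

variable {k : Type*} [Field k] (g : k[X])

/-- The action of `x` on the generic module. -/
noncomputable def opX : Module.End (GenField k)[X] (GT k) where
  toFun φ b m := shiftBoth k g (fun b => (lam k b + m) / (2 * lam k b))
    (fun b => (m - lam k b) / (2 * lam k b)) (fun b => φ b (m - 1)) b
  map_add' φ ψ := by
    funext b m
    simp only [shiftBoth, Pi.add_apply, mul_add, smul_add]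
    abel
  map_smul' r φ := by
    funext b m
    simp only [shiftBoth, Pi.smul_apply, smul_eq_mul, RingHom.id_apply, mul_left_comm _ r,
      ← mul_smul_comm]
    ring

/-- The action of `y` on the generic module. -/
noncomputable def opY : Module.End (GenField k)[X] (GT k) where
  toFun φ b m := shiftBoth k g (fun b => (lam k b)⁻¹) (fun b => (lam k b)⁻¹)
    (fun b => φ b (m + 1)) b
  map_add' φ ψ := by
    funext b m
    simp only [shiftBoth, Pi.add_apply, mul_add, smul_add]
    abel
  map_smul' r φ := by
    funext b m
    simp only [shiftBoth, Pi.smul_apply, smul_eq_mul, RingHom.id_apply, mul_left_comm _ r,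
      ← mul_smul_comm]
    ring

theorem opX_apply' (φ : GT k) (m : ℤ) : (fun b => opX g φ b m) =
    shiftBoth k g (fun b => (lam k b + m) / (2 * lam k b))
      (fun b => (m - lam k b) / (2 * lam k b)) (fun b => φ b (m - 1)) := rfl

theorem opY_apply' (φ : GT k) (m : ℤ) : (fun b => opY g φ b m) =
    shiftBoth k g (fun b => (lam k b)⁻¹) (fun b => (lam k b)⁻¹) (fun b => φ b (m + 1)) := rfl

theorem opX_apply (φ : GT k) (b m : ℤ) : opX g φ b m =
    ((lam k b - 1 + m) / (2 * (lam k b - 1))) • φ (b - 1) (m - 1) +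
    ((m - (lam k b + 1)) / (2 * (lam k b + 1))) • (pot g (b + 1) * φ (b + 1) (m - 1)) := by
  rw [← lam_sub_one, ← lam_add_one]
  rfl

theorem opY_apply (φ : GT k) (b m : ℤ) : opY g φ b m =
    (lam k b - 1)⁻¹ • φ (b - 1) (m + 1) +
    (lam k b + 1)⁻¹ • (pot g (b + 1) * φ (b + 1) (m + 1)) := by
  rw [← lam_sub_one, ← lam_add_one]
  rfl

variable [CharZero k]

theorem isVRel_op : IsVRel (opE k) (opF k) (opH k) (opX g) (opY g) := by
  have h1 : ∀ b, lam k b - 1 ≠ 0 := fun b => by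
    rw [← Int.cast_one, ← lam_sub]
    exact lam_ne_zero _
  have h2 : ∀ b, lam k b + 1 ≠ 0 := fun b => by
    rw [← Int.cast_one, ← lam_add]
    exact lam_ne_zero _
  have i1 : ∀ m : ℤ, m - 2 - 1 = m - 3 := fun m => by ring
  have i2 : ∀ m : ℤ, m - 1 - 2 = m - 3 := fun m => by ring
  have i3 : ∀ m : ℤ, m - 2 + 1 = m - 1 := fun m => by ring
  have i4 : ∀ m : ℤ, m + 1 - 2 = m - 1 := fun m => by ring
  have i5 : ∀ m : ℤ, m + 2 - 1 = m + 1 := fun m => by ring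
  have i6 : ∀ m : ℤ, m - 1 + 2 = m + 1 := fun m => by ring
  have i7 : ∀ m : ℤ, m + 2 + 1 = m + 3 := fun m => by ring
  have i8 : ∀ m : ℤ, m + 1 + 2 = m + 3 := fun m => by ring
  refine ⟨?_, ?_, ?_, ?_, ?_, ?_⟩ <;> refine GT.hom_ext fun φ b m => ?_ <;>
  simp only [LinearMap.add_apply, LinearMap.sub_apply, Module.End.mul_apply, Pi.add_apply,
    Pi.sub_apply, opE_apply, opF_apply, opH_apply, opX_apply, opY_apply, eCoeff, lam_add, lam_sub,
    i1 m, i2 m, i3 m, i4 m, i5 m, i6 m, i7 m, i8 m,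
    mul_smul_comm, smul_add, smul_smul] <;>
  have h1b := h1 b <;> have h2b := h2 b <;>
  match_scalars <;> field_simp <;> ring

/-- The components shifting `b` by `±2` cancel. The diagonal one is the difference of `pot g b` and
`pot g (b + 1)` divided by `λ + b`, which is `p((λ+b)²)` by the difference equation. -/
theorem opX_mul_opY {p : k[X]} (hg : g - g.comp (X + 1) = X * expand k 2 p) :
    opX g * opY g - opY g * opX g = actU k (aeval (casimir k) p) := by
  refine GT.hom_ext fun φ b m => ?_
  have h0 := lam_ne_zero (k := k) b
  have h1 : lam k b - 1 ≠ 0 := by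
    rw [← Int.cast_one, ← lam_sub]
    exact lam_ne_zero _
  have h2 : lam k b + 1 ≠ 0 := by
    rw [← Int.cast_one, ← lam_add]
    exact lam_ne_zero _
  have h3 : lam k b - 1 - 1 ≠ 0 := by
    rw [← Int.cast_one, ← lam_sub, ← lam_sub]
    exact lam_ne_zero _
  have h4 : lam k b + 1 + 1 ≠ 0 := by
    rw [← Int.cast_one, ← lam_add, ← lam_add]
    exact lam_ne_zero _
  have hpot : pot g b = pot g (b + 1) + C (lam k b * aeval (lam k b ^ 2) p) := by
    have h := congrArg (aeval (lam k b)) hg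
    rw [map_sub, map_mul, aeval_X, ← aeval_lam_sq, ← C_1, ← Int.cast_one, ← aeval_lam_add] at h
    rw [pot, pot, add_assoc, ← C_add, ← h, add_sub_cancel]
  simp only [LinearMap.sub_apply, Module.End.mul_apply, Pi.sub_apply, opX_apply, opY_apply,
    actU_aeval_casimir_apply, lam_add, lam_sub, sub_add_cancel, add_sub_cancel_right, hpot,
    mul_add, add_mul, mul_smul_comm, smul_add, smul_smul, ← smul_eq_C_mul, Int.cast_one, Int.cast_add]
  match_scalars <;> field_simp <;> ring

/-- The action of `H_z` on the generic module. -/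
noncomputable def actH {g : k[X]} {z : USl2 k}
    (hz : opX g * opY g - opY g * opX g = actU k z) :
    H z →ₐ[k] Module.End (GenField k)[X] (GT k) :=
  liftH (isSl2Rel_op k) (isVRel_op g) hz

variable {g} {z : USl2 k} (hz : opX g * opY g - opY g * opX g = actU k z)

theorem actH_ofU (u : USl2 k) : actH hz (H.ofU z u) = actU k u := liftH_ofU _ _ _ u

theorem actH_hX : actH hz (hX z) = opX g := by
  exact (liftH_ofV _ _ _ _).trans (by simp [liftV_apply])

theorem actH_hY : actH hz (hY z) = opY g := by
  exact (liftH_ofV _ _ _ _).trans (by simp [liftV_apply])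

end ModelH

/-! ### Ordered monomials `yⁱ xʲ u` and the effect of `ad e`, `ad f`, `ad h` on them. -/

section Filtration

variable {k : Type*} [Field k] (z : USl2 k)

/-- The filtration of `H_z` by degree in `V`, defined recursively through ordered monomials. -/
noncomputable def fil : ℕ → Submodule k (H z)
  | 0 => LinearMap.range (H.ofU z).toLinearMap
  | n + 1 => (fil n).map (LinearMap.mulLeft k (hY z)) ⊔ fil n ⊔
      (LinearMap.range (H.ofU z).toLinearMap).map (LinearMap.mulLeft k (hX z ^ (n + 1)))

/-- The refinement of the filtration `fil` in which the monomials of top degree are divisible by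
`y ^ i`. -/
noncomputable def wfil : ℕ → ℕ → Submodule k (H z)
  | n, 0 => fil z n
  | 0, _ + 1 => ⊥
  | n + 1, i + 1 => (wfil n i).map (LinearMap.mulLeft k (hY z)) ⊔ fil z n

variable {z}

theorem wfil_zero_right (n : ℕ) : wfil z n 0 = fil z n := by
  cases n <;> rfl

theorem ofU_mem_fil_zero (u : USl2 k) : H.ofU z u ∈ fil z 0 := ⟨u, rfl⟩

theorem mem_wfil_succ {n i : ℕ} {p : H z} :
    p ∈ wfil z (n + 1) (i + 1) ↔ ∃ m ∈ wfil z n i, ∃ r ∈ fil z n, hY z * m + r = p := by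
  rw [wfil, Submodule.mem_sup]
  constructor
  · rintro ⟨_, ⟨m, hm, rfl⟩, r, hr, rfl⟩
    exact ⟨m, hm, r, hr, rfl⟩
  · rintro ⟨m, hm, r, hr, rfl⟩
    exact ⟨_, ⟨m, hm, rfl⟩, r, hr, rfl⟩

theorem mem_fil_succ {n : ℕ} {p : H z} : p ∈ fil z (n + 1) ↔
    ∃ q ∈ wfil z (n + 1) 1, ∃ u, q + hX z ^ (n + 1) * H.ofU z u = p := by
  rw [fil, Submodule.mem_sup, wfil, wfil_zero_right]
  constructor
  · rintro ⟨q, hq, _, ⟨_, ⟨u, rfl⟩, rfl⟩, rfl⟩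
    exact ⟨q, hq, u, rfl⟩
  · rintro ⟨q, hq, u, rfl⟩
    exact ⟨q, hq, _, ⟨_, ⟨u, rfl⟩, rfl⟩, rfl⟩

theorem fil_le_wfil (n i : ℕ) : fil z n ≤ wfil z (n + 1) i := by
  cases i with
  | zero =>
    rw [wfil, fil]
    exact le_sup_of_le_left le_sup_right
  | succ i =>
    rw [wfil]
    exact le_sup_right

theorem fil_le_succ (n : ℕ) : fil z n ≤ fil z (n + 1) := fil_le_wfil n 0

theorem fil_mono {m n : ℕ} (h : m ≤ n) : fil z m ≤ fil z n := monotone_nat_of_le_succ fil_le_succ h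

theorem wfil_one_le (n : ℕ) : wfil z n 1 ≤ fil z n := by
  cases n with
  | zero => exact bot_le
  | succ n => exact fun p hp => mem_fil_succ.mpr ⟨p, hp, 0, by simp⟩

theorem wfil_succ_le (n i : ℕ) : wfil z n (i + 1) ≤ wfil z n i := by
  induction i generalizing n with
  | zero =>
    rw [wfil_zero_right]
    exact wfil_one_le n
  | succ i ih =>
    cases n with
    | zero => exact bot_le
    | succ n =>
      rw [wfil, wfil]
      exact sup_le_sup_right (Submodule.map_mono (ih n)) _

theorem wfil_le_fil (n i : ℕ) : wfil z n i ≤ fil z n := by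
  induction i with
  | zero => rw [wfil_zero_right]
  | succ i ih => exact (wfil_succ_le n i).trans ih

theorem hY_mul_mem_wfil {n i : ℕ} {p : H z} (hp : p ∈ wfil z n i) :
    hY z * p ∈ wfil z (n + 1) (i + 1) :=
  mem_wfil_succ.mpr ⟨p, hp, 0, zero_mem _, add_zero _⟩

theorem hY_mul_mem_fil {n : ℕ} {p : H z} (hp : p ∈ fil z n) : hY z * p ∈ fil z (n + 1) :=
  wfil_le_fil _ _ (hY_mul_mem_wfil (i := 0) (by rwa [wfil_zero_right]))

theorem hX_pow_mul_mem_fil (n : ℕ) (u : USl2 k) : hX z ^ n * H.ofU z u ∈ fil z n := by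
  cases n with
  | zero =>
    rw [pow_zero, one_mul]
    exact ofU_mem_fil_zero u
  | succ n => exact mem_fil_succ.mpr ⟨0, zero_mem _, u, zero_add _⟩

theorem exists_sub_mem_wfil {n : ℕ} {p : H z} (hp : p ∈ fil z n) :
    ∃ u, p - hX z ^ n * H.ofU z u ∈ wfil z n 1 := by
  cases n with
  | zero =>
    obtain ⟨u, rfl⟩ := hp
    exact ⟨u, by simp⟩
  | succ n =>
    obtain ⟨q, hq, u, rfl⟩ := mem_fil_succ.mp hp
    exact ⟨u, by rwa [add_sub_cancel_right]⟩

/-- Induction principle for the filtration `fil`. -/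
theorem fil_succ_induction {n : ℕ} {C : H z → Prop}
    (hy : ∀ p ∈ fil z n, C (hY z * p)) (hr : ∀ p ∈ fil z n, C p)
    (hx : ∀ u, C (hX z ^ (n + 1) * H.ofU z u)) (hadd : ∀ p q, C p → C q → C (p + q))
    {p : H z} (hp : p ∈ fil z (n + 1)) : C p := by
  obtain ⟨q, hq, u, rfl⟩ := mem_fil_succ.mp hp
  obtain ⟨m, hm, r, hr', rfl⟩ := mem_wfil_succ.mp hq
  rw [wfil_zero_right] at hm
  exact hadd _ _ (hadd _ _ (hy m hm) (hr r hr')) (hx u)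

/-- The two claims need a joint induction: moving `e` past `y` creates `x`, and moving `x` past `y`
creates `z` in `U(sl₂)`. -/
theorem ofU_mul_mem_and_hX_mul_mem (n : ℕ) :
    (∀ u, ∀ p ∈ fil z n, H.ofU z u * p ∈ fil z n) ∧ (∀ p ∈ fil z n, hX z * p ∈ fil z (n + 1)) := by
  have rv := isVRel_h z
  induction n with
  | zero =>
    constructor
    · rintro u _ ⟨v, rfl⟩
      exact ⟨u * v, map_mul (H.ofU z) u v⟩
    · rintro _ ⟨v, rfl⟩
      simpa using hX_pow_mul_mem_fil (z := z) 1 v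
  | succ n ih =>
    obtain ⟨ihu, ihx⟩ := ih
    constructor
    · intro u
      have hxp : ∀ u, hX z ^ (n + 1) * H.ofU z u = hX z * (hX z ^ n * H.ofU z u) := fun u => by
        rw [pow_succ', mul_assoc]
      induction u using u_induction with
      | he =>
        intro p hp
        refine fil_succ_induction (fun m hm => ?_) (fun r hr => fil_le_succ n (ihu _ r hr))
          (fun u => ?_) (fun p q hp hq => by rw [mul_add]; exact add_mem hp hq) hp
        · rw [← mul_assoc, rv.ey, add_mul, mul_assoc]
          exact add_mem (hY_mul_mem_fil (ihu _ m hm)) (ihx m hm)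
        · rw [hxp, ← mul_assoc, rv.ex, mul_assoc]
          exact ihx _ (ihu _ _ (hX_pow_mul_mem_fil n u))
      | hf =>
        intro p hp
        refine fil_succ_induction (fun m hm => ?_) (fun r hr => fil_le_succ n (ihu _ r hr))
          (fun u => ?_) (fun p q hp hq => by rw [mul_add]; exact add_mem hp hq) hp
        · rw [← mul_assoc, rv.fy, mul_assoc]
          exact hY_mul_mem_fil (ihu _ m hm)
        · rw [hxp, ← mul_assoc, rv.fx, add_mul, mul_assoc]
          exact add_mem (ihx _ (ihu _ _ (hX_pow_mul_mem_fil n u)))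
            (hY_mul_mem_fil (hX_pow_mul_mem_fil n u))
      | hh =>
        intro p hp
        refine fil_succ_induction (fun m hm => ?_) (fun r hr => fil_le_succ n (ihu _ r hr))
          (fun u => ?_) (fun p q hp hq => by rw [mul_add]; exact add_mem hp hq) hp
        · rw [← mul_assoc, rv.hy, sub_mul, mul_assoc]
          exact sub_mem (hY_mul_mem_fil (ihu _ m hm)) (hY_mul_mem_fil hm)
        · rw [hxp, ← mul_assoc, rv.hx, add_mul, mul_assoc]
          exact add_mem (ihx _ (ihu _ _ (hX_pow_mul_mem_fil n u)))
            (ihx _ (hX_pow_mul_mem_fil n u))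
      | halg c =>
        intro p hp
        rw [AlgHom.commutes, ← Algebra.smul_def]
        exact Submodule.smul_mem _ _ hp
      | hadd u v hu hv =>
        intro p hp
        rw [map_add, add_mul]
        exact add_mem (hu p hp) (hv p hp)
      | hmul u v hu hv =>
        intro p hp
        rw [map_mul, mul_assoc]
        exact hu _ (hv p hp)
    · intro p hp
      refine fil_succ_induction (fun m hm => ?_) (fun r hr => fil_le_succ _ (ihx r hr))
        (fun u => ?_) (fun p q hp hq => by rw [mul_add]; exact add_mem hp hq) hp
      · rw [← mul_assoc, hX_mul_hY, add_mul, mul_assoc]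
        exact add_mem (hY_mul_mem_fil (ihx m hm))
          (fil_mono (n.le_add_right 2) (ihu _ m hm))
      · rw [← mul_assoc, ← pow_succ']
        exact hX_pow_mul_mem_fil _ u

theorem ofU_mul_mem_fil {n : ℕ} (u : USl2 k) {p : H z} (hp : p ∈ fil z n) :
    H.ofU z u * p ∈ fil z n := (ofU_mul_mem_and_hX_mul_mem n).1 u p hp

theorem hX_mul_mem_fil {n : ℕ} {p : H z} (hp : p ∈ fil z n) : hX z * p ∈ fil z (n + 1) :=
  (ofU_mul_mem_and_hX_mul_mem n).2 p hp

theorem hX_mul_mem_wfil {n i : ℕ} {p : H z} (hp : p ∈ wfil z n i) :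
    hX z * p ∈ wfil z (n + 1) i := by
  induction i generalizing n p with
  | zero =>
    rw [wfil_zero_right] at hp ⊢
    exact hX_mul_mem_fil hp
  | succ i ih =>
    cases n with
    | zero =>
      obtain rfl : p = 0 := hp
      simp
    | succ n =>
      obtain ⟨m, hm, r, hr, rfl⟩ := mem_wfil_succ.mp hp
      rw [mul_add, ← mul_assoc, hX_mul_hY, add_mul, add_assoc, mul_assoc]
      exact mem_wfil_succ.mpr ⟨_, ih hm, _, add_mem (ofU_mul_mem_fil _
        (fil_le_succ _ (wfil_le_fil _ _ hm))) (hX_mul_mem_fil hr),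
          (add_assoc _ _ _).symm⟩

theorem mul_ofU_mem_fil {n : ℕ} (u : USl2 k) {p : H z} (hp : p ∈ fil z n) :
    p * H.ofU z u ∈ fil z n := by
  induction n generalizing p with
  | zero =>
    obtain ⟨v, rfl⟩ := hp
    exact ⟨v * u, map_mul (H.ofU z) v u⟩
  | succ n ih =>
    refine fil_succ_induction (fun m hm => ?_) (fun r hr => fil_le_succ n (ih hr))
      (fun v => ?_) (fun p q hp hq => by rw [add_mul]; exact add_mem hp hq) hp
    · rw [mul_assoc]
      exact hY_mul_mem_fil (ih hm)
    · rw [mul_assoc, ← map_mul]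
      exact hX_pow_mul_mem_fil _ _

theorem mul_ofU_mem_wfil {n i : ℕ} (u : USl2 k) {p : H z} (hp : p ∈ wfil z n i) :
    p * H.ofU z u ∈ wfil z n i := by
  induction i generalizing n p with
  | zero =>
    rw [wfil_zero_right] at hp ⊢
    exact mul_ofU_mem_fil u hp
  | succ i ih =>
    cases n with
    | zero =>
      obtain rfl : p = 0 := hp
      simp
    | succ n =>
      obtain ⟨m, hm, r, hr, rfl⟩ := mem_wfil_succ.mp hp
      rw [add_mul, mul_assoc]
      exact mem_wfil_succ.mpr ⟨_, ih hm, _, mul_ofU_mem_fil u hr, rfl⟩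

theorem adj_ofU_mem_fil {n : ℕ} (u : USl2 k) {p : H z} (hp : p ∈ fil z n) :
    adj k (H.ofU z u) p ∈ fil z n :=
  sub_mem (ofU_mul_mem_fil u hp) (mul_ofU_mem_fil u hp)

theorem adj_uE_hY : adj k (H.ofU z (uE k)) (hY z) = hX z := by
  rw [adj_apply, (isVRel_h z).ey, add_sub_cancel_left]

theorem adj_uF_hX : adj k (H.ofU z (uF k)) (hX z) = hY z := by
  rw [adj_apply, (isVRel_h z).fx, add_sub_cancel_left]

/-- `ad e` turns one factor `y` into `x` and kills `x`, so divisibility by `y` drops by at most one.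
-/
theorem adj_uE_mem_wfil {n i : ℕ} {p : H z} (hp : p ∈ wfil z n (i + 1)) :
    adj k (H.ofU z (uE k)) p ∈ wfil z n i := by
  induction i generalizing n p with
  | zero =>
    rw [wfil_zero_right]
    exact adj_ofU_mem_fil _ (wfil_le_fil _ _ hp)
  | succ i ih =>
    cases n with
    | zero =>
      obtain rfl : p = 0 := hp
      simp
    | succ n =>
      obtain ⟨m, hm, r, hr, rfl⟩ := mem_wfil_succ.mp hp
      rw [map_add, adj_mul, adj_uE_hY]
      exact add_mem (add_mem (hX_mul_mem_wfil hm) (hY_mul_mem_wfil (ih hm)))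
        (fil_le_wfil _ _ (adj_ofU_mem_fil _ hr))

theorem adj_uE_pow_mem_wfil {n i j : ℕ} {p : H z} (hp : p ∈ wfil z n (i + j)) :
    (adj k (H.ofU z (uE k)) ^ j) p ∈ wfil z n i := by
  induction j generalizing p with
  | zero => exact hp
  | succ j ih =>
    rw [pow_succ, Module.End.mul_apply]
    exact ih (adj_uE_mem_wfil hp)

theorem adj_uF_mem_wfil {n i : ℕ} {p : H z} (hp : p ∈ wfil z n i) :
    adj k (H.ofU z (uF k)) p ∈ wfil z n i := by
  induction i generalizing n p with
  | zero =>
    rw [wfil_zero_right] at hp ⊢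
    exact adj_ofU_mem_fil _ hp
  | succ i ih =>
    cases n with
    | zero =>
      obtain rfl : p = 0 := hp
      simp
    | succ n =>
      obtain ⟨m, hm, r, hr, rfl⟩ := mem_wfil_succ.mp hp
      have h0 : adj k (H.ofU z (uF k)) (hY z) = 0 := by
        rw [adj_apply, (isVRel_h z).fy, sub_self]
      rw [map_add, adj_mul, h0, zero_mul, zero_add]
      exact add_mem (hY_mul_mem_wfil (ih hm)) (fil_le_wfil _ _ (adj_ofU_mem_fil _ hr))

theorem adj_uH_mem_wfil {n i : ℕ} {p : H z} (hp : p ∈ wfil z n i) :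
    adj k (H.ofU z (uH k)) p ∈ wfil z n i := by
  induction i generalizing n p with
  | zero =>
    rw [wfil_zero_right] at hp ⊢
    exact adj_ofU_mem_fil _ hp
  | succ i ih =>
    cases n with
    | zero =>
      obtain rfl : p = 0 := hp
      simp
    | succ n =>
      obtain ⟨m, hm, r, hr, rfl⟩ := mem_wfil_succ.mp hp
      have h0 : adj k (H.ofU z (uH k)) (hY z) = - hY z := by
        rw [adj_apply, (isVRel_h z).hy]
        abel
      rw [map_add, adj_mul, h0, neg_mul]
      exact add_mem (add_mem (neg_mem (hY_mul_mem_wfil hm)) (hY_mul_mem_wfil (ih hm)))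
        (fil_le_wfil _ _ (adj_ofU_mem_fil _ hr))

theorem mul_mem_fil {m n : ℕ} {p q : H z} (hp : p ∈ fil z m) (hq : q ∈ fil z n) :
    p * q ∈ fil z (m + n) := by
  induction m generalizing p with
  | zero =>
    obtain ⟨u, rfl⟩ := hp
    rw [zero_add]
    exact ofU_mul_mem_fil u hq
  | succ m ih =>
    rw [add_right_comm]
    refine fil_succ_induction (fun m hm => ?_) (fun r hr => fil_le_succ _ (ih hr))
      (fun v => ?_) (fun p q hp hq => by rw [add_mul]; exact add_mem hp hq) hp
    · rw [mul_assoc]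
      exact hY_mul_mem_fil (ih hm)
    · rw [pow_succ', mul_assoc, mul_assoc, ← mul_assoc (hX z ^ m)]
      exact hX_mul_mem_fil (ih (hX_pow_mul_mem_fil m v))

theorem exists_mem_fil (p : H z) : ∃ n, p ∈ fil z n := by
  have hp : p ∈ Algebra.adjoin k
      {H.ofU z (uE k), H.ofU z (uF k), H.ofU z (uH k), hX z, hY z} :=
    adjoin_h_eq_top z ▸ Algebra.mem_top
  induction hp using Algebra.adjoin_induction with
  | mem x hx =>
    rcases hx with rfl | rfl | rfl | rfl | rfl
    · exact ⟨0, ofU_mem_fil_zero _⟩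
    · exact ⟨0, ofU_mem_fil_zero _⟩
    · exact ⟨0, ofU_mem_fil_zero _⟩
    · exact ⟨1, by simpa using hX_pow_mul_mem_fil (z := z) 1 1⟩
    · exact ⟨1, by simpa using hY_mul_mem_fil (ofU_mem_fil_zero (z := z) 1)⟩
  | algebraMap r => exact ⟨0, algebraMap k _ r, (H.ofU z).commutes r⟩
  | add x y _ _ hx hy =>
    obtain ⟨m, hm⟩ := hx
    obtain ⟨n, hn⟩ := hy
    exact ⟨m + n, add_mem (fil_mono (Nat.le_add_right _ _) hm) (fil_mono (Nat.le_add_left _ _) hn)⟩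
  | mul x y _ _ hx hy =>
    obtain ⟨m, hm⟩ := hx
    obtain ⟨n, hn⟩ := hy
    exact ⟨m + n, mul_mem_fil hm hn⟩

/-- A monomial of degree `n + 1` has no room for `n + 2` factors `y`, so no top-degree part remains.
-/
theorem wfil_top_le (n : ℕ) : wfil z (n + 1) (n + 2) ≤ fil z n := by
  induction n with
  | zero =>
    intro p hp
    obtain ⟨m, hm, r, hr, rfl⟩ := mem_wfil_succ.mp hp
    obtain rfl : m = 0 := hm
    rwa [mul_zero, zero_add]
  | succ n ih =>
    intro p hp
    obtain ⟨m, hm, r, hr, rfl⟩ := mem_wfil_succ.mp hp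
    exact add_mem (hY_mul_mem_fil (ih hm)) hr

/-- Among the top-degree monomials divisible by `yⁱ`, only those of the form `yⁱ xᵇ u` are not
divisible by `y^(i+1)`. -/
theorem exists_sub_mem_wfil_succ {b i : ℕ} {p : H z} (hp : p ∈ wfil z (b + i) i) :
    ∃ u, p - hY z ^ i * (hX z ^ b * H.ofU z u) ∈ wfil z (b + i) (i + 1) := by
  induction i generalizing p with
  | zero =>
    rw [wfil_zero_right] at hp
    simpa using exists_sub_mem_wfil hp
  | succ i ih =>
    obtain ⟨m, hm, r, hr, rfl⟩ := mem_wfil_succ.mp hp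
    obtain ⟨u, hu⟩ := ih hm
    refine ⟨u, mem_wfil_succ.mpr ⟨_, hu, r, hr, ?_⟩⟩
    rw [pow_succ']
    noncomm_ring

theorem hY_pow_mul_mem_fil {b : ℕ} (i : ℕ) {m : H z} (hm : m ∈ fil z b) :
    hY z ^ i * m ∈ fil z (b + i) := by
  induction i with
  | zero => simpa
  | succ i ih =>
    rw [pow_succ', mul_assoc]
    exact hY_mul_mem_fil ih

theorem hX_mul_hY_pow_sub_mem {b : ℕ} (i : ℕ) {m : H z} (hm : m ∈ fil z b) :
    hX z * (hY z ^ i * m) - hY z ^ i * (hX z * m) ∈ wfil z (b + i + 1) (i + 1) := by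
  induction i with
  | zero => simp
  | succ i ih =>
    have h : hX z * (hY z ^ (i + 1) * m) - hY z ^ (i + 1) * (hX z * m) =
        hY z * (hX z * (hY z ^ i * m) - hY z ^ i * (hX z * m)) +
          H.ofU z z * (hY z ^ i * m) := by
      rw [pow_succ', mul_assoc, ← mul_assoc (hX z), hX_mul_hY]
      noncomm_ring
    rw [h]
    exact add_mem (hY_mul_mem_wfil ih) (fil_le_wfil _ _
      (fil_le_succ _ (ofU_mul_mem_fil _ (hY_pow_mul_mem_fil i hm))))

theorem adj_uE_hY_pow_mul {b : ℕ} (i : ℕ) {m : H z} (hm : m ∈ fil z b) :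
    adj k (H.ofU z (uE k)) (hY z ^ (i + 1) * m) - (i + 1) • (hY z ^ i * (hX z * m)) ∈
      wfil z (b + i + 1) (i + 1) := by
  induction i with
  | zero =>
    rw [zero_add, pow_one, one_smul, pow_zero, one_mul, adj_mul, adj_uE_hY, add_sub_cancel_left]
    exact hY_mul_mem_wfil (by rw [wfil_zero_right]; exact adj_ofU_mem_fil _ hm)
  | succ i ih =>
    have h : adj k (H.ofU z (uE k)) (hY z ^ (i + 1 + 1) * m) -
        (i + 1 + 1) • (hY z ^ (i + 1) * (hX z * m)) =
        (hX z * (hY z ^ (i + 1) * m) - hY z ^ (i + 1) * (hX z * m)) +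
        hY z * (adj k (H.ofU z (uE k)) (hY z ^ (i + 1) * m) -
          (i + 1) • (hY z ^ i * (hX z * m))) := by
      rw [pow_succ' _ (i + 1), mul_assoc, adj_mul, adj_uE_hY, succ_nsmul, mul_sub, mul_smul_comm,
        ← mul_assoc (hY z) (hY z ^ i), ← pow_succ']
      abel
    rw [h]
    exact add_mem (hX_mul_hY_pow_sub_mem (i + 1) hm) (hY_mul_mem_wfil ih)

/-- Each application of `ad e` replaces one of the remaining `y` by `x`; the choices multiply to
`i!`. Reordering produces only lower-degree terms, and terms where `ad e` hits `m` keep a factor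
`y`. -/
theorem adj_uE_pow_hY_pow_mul {b : ℕ} (i : ℕ) {m : H z} (hm : m ∈ fil z b) :
    (adj k (H.ofU z (uE k)) ^ i) (hY z ^ i * m) - i.factorial • (hX z ^ i * m) ∈
      wfil z (b + i) 1 := by
  induction i generalizing b m with
  | zero => simp
  | succ i ih =>
    have h1 := ih (hX_mul_mem_fil hm)
    have h2 := adj_uE_pow_mem_wfil (i := 1) (j := i) (by
      rw [add_comm 1 i]
      exact adj_uE_hY_pow_mul i hm)
    rw [add_right_comm, add_assoc] at h1
    have h : (adj k (H.ofU z (uE k)) ^ (i + 1)) (hY z ^ (i + 1) * m) -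
        (i + 1).factorial • (hX z ^ (i + 1) * m) =
        (adj k (H.ofU z (uE k)) ^ i) (adj k (H.ofU z (uE k)) (hY z ^ (i + 1) * m) -
          (i + 1) • (hY z ^ i * (hX z * m))) +
        (i + 1) • ((adj k (H.ofU z (uE k)) ^ i) (hY z ^ i * (hX z * m)) -
          i.factorial • (hX z ^ i * (hX z * m))) := by
      rw [map_sub, ← Module.End.mul_apply, ← pow_succ, map_nsmul, smul_sub, smul_smul,
        ← Nat.factorial_succ, ← mul_assoc (hX z ^ i), ← pow_succ]
      abel
    rw [h]
    exact add_mem h2 (Submodule.smul_of_tower_mem _ _ h1)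

end Filtration

/-! ### Leading coefficients and faithfulness of the generic module. -/

section Faithful

variable {k : Type*} [Field k] [CharZero k] {z : USl2 k} {g : k[X]}
  (hz : opX g * opY g - opY g * opX g = actU k z)

omit [CharZero k] in
theorem InFil.add {n : ℕ} {χ χ' : ℤ → (GenField k)[X]} (h : InFil n χ) (h' : InFil n χ') :
    InFil n (χ + χ') := by
  intro b j hb
  rw [Pi.add_apply, coeff_add, h b j hb, h' b j hb, add_zero]

omit [CharZero k] in
theorem InFil.smul {n : ℕ} {χ : ℤ → (GenField k)[X]} (h : InFil n χ) (c : ℤ → GenField k) :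
    InFil n (fun b => c b • χ b) := by
  intro b j hb
  rw [coeff_smul, h b j hb, smul_zero]

theorem inFil_actU {n : ℕ} (u : USl2 k) : ∀ {φ : GT k}, (∀ m, InFil n (fun b => φ b m)) →
    ∀ m, InFil n (fun b => actU k u φ b m) := by
  induction u using u_induction with
  | he =>
    intro φ h m
    rw [actU_uE]
    exact (h (m - 2)).smul _
  | hf =>
    intro φ h m
    rw [actU_uF]
    exact h (m + 2)
  | hh =>
    intro φ h m
    rw [actU_uH]
    exact (h m).smul _
  | halg c =>
    intro φ h m
    rw [AlgHom.commutes]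
    intro b j hb
    rw [Module.algebraMap_end_apply]
    change (c • φ b m).coeff j = 0
    rw [coeff_smul, h m b j hb, smul_zero]
  | hadd u v hu hv =>
    intro φ h m
    rw [map_add]
    exact (hu h m).add (hv h m)
  | hmul u v hu hv =>
    intro φ h m
    rw [map_mul]
    exact hu (hv h) m

omit [CharZero k] in
theorem inFil_gtVec (m m' : ℤ) : InFil 0 (fun b => gtVec k 0 m b m') := by
  intro b j hb
  change (gtVec k 0 m b m').coeff j = 0
  rw [gtVec_apply]
  split_ifs with h
  · rw [coeff_one, if_neg]
    omega
  · simp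

theorem inFil_hX_pow (n : ℕ) (u : USl2 k) (m m' : ℤ) :
    InFil n (fun b => actH hz (hX z ^ n * H.ofU z u) (gtVec k 0 m) b m') := by
  induction n generalizing m' with
  | zero =>
    rw [pow_zero, one_mul, actH_ofU]
    exact inFil_actU u (inFil_gtVec m) m'
  | succ n ih =>
    simp only [pow_succ', mul_assoc, map_mul, actH_hX, Module.End.mul_apply] at ih ⊢
    rw [opX_apply']
    exact (ih (m' - 1)).shiftBoth g _ _

theorem inFil_fil {n : ℕ} {p : H z} (hp : p ∈ fil z n) (m m' : ℤ) :
    InFil n (fun b => actH hz p (gtVec k 0 m) b m') := by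
  induction n generalizing p m' with
  | zero =>
    obtain ⟨u, rfl⟩ := hp
    simpa using inFil_hX_pow hz 0 u m m'
  | succ n ih =>
    refine fil_succ_induction (C := fun p => ∀ m', InFil (n + 1)
      (fun b => actH hz p (gtVec k 0 m) b m')) (fun q hq m' => ?_) (fun r hr m' => (ih hr m').mono (Nat.le_succ n))
      (fun u m' => inFil_hX_pow hz _ u m m') (fun p q hp hq m' => ?_) hp m'
    · simp only [map_mul, actH_hY, Module.End.mul_apply]
      rw [opY_apply']
      exact (ih hq (m' + 1)).shiftBoth g _ _
    · rw [map_add]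
      exact (hp m').add (hq m')

/-- The two coefficients of `y` are equal, so the symbol of a left multiple of `y` cancels, and
terms of lower degree have no symbol. -/
theorem symb_wfil_one {n : ℕ} {p : H z} (hp : p ∈ wfil z n 1) (m m' : ℤ) :
    symb n (fun b => actH hz p (gtVec k 0 m) b m') = 0 := by
  cases n with
  | zero =>
    obtain rfl : p = 0 := hp
    simp [symb]
  | succ n =>
    obtain ⟨q, hq, r, hr, rfl⟩ := mem_wfil_succ.mp hp
    rw [wfil_zero_right] at hq
    have h1 := symb_shiftBoth g (fun b => (lam k b)⁻¹) (fun b => (lam k b)⁻¹)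
      (inFil_fil hz hq m (m' + 1))
    have h2 := symb_eq_zero (inFil_fil hz hr m m')
    simp only [sub_self, zero_mul, mul_zero, Finset.sum_const_zero] at h1
    rw [map_add, map_mul, actH_hY]
    have h3 : symb (n + 1) (fun b => (opY g * actH hz q + actH hz r) (gtVec k 0 m) b m') =
        symb (n + 1) (shiftBoth k g (fun b => (lam k b)⁻¹) (fun b => (lam k b)⁻¹)
          (fun b => actH hz q (gtVec k 0 m) b (m' + 1))) +
        symb (n + 1) (fun b => actH hz r (gtVec k 0 m) b m') := by
      rw [symb, symb, symb, ← Finset.sum_add_distrib]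
      refine Finset.sum_congr rfl fun j _ => ?_
      rw [← mul_add, ← coeff_add]
      rfl
    rw [h3, h1, h2, add_zero]

/-- The two coefficients of `x` differ by one, so each `x` preserves the symbol. -/
theorem symb_hX_pow (n : ℕ) (u : USl2 k) (m m' : ℤ) :
    symb n (fun b => actH hz (hX z ^ n * H.ofU z u) (gtVec k 0 m) b (m' + n)) =
      (actU k u (gtVec k 0 m) 0 m').coeff 0 := by
  induction n with
  | zero => simp [symb, actH_ofU]
  | succ n ih =>
    rw [pow_succ', mul_assoc, map_mul, actH_hX]
    refine (symb_shiftBoth g (fun b => (lam k b + (m' + (n + 1 : ℕ) : ℤ)) / (2 * lam k b))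
      (fun b => ((m' + (n + 1 : ℕ) : ℤ) - lam k b) / (2 * lam k b))
      (inFil_hX_pow hz n u m _)).trans ?_
    rw [← ih, symb]
    refine Finset.sum_congr rfl fun j _ => ?_
    have h0 := lam_ne_zero (k := k) (n - 2 * j)
    have h1 : (lam k (n - 2 * j) + (m' + (n + 1 : ℕ) : ℤ)) / (2 * lam k (n - 2 * j)) -
        ((m' + (n + 1 : ℕ) : ℤ) - lam k (n - 2 * j)) / (2 * lam k (n - 2 * j)) = 1 := by
      field_simp
      ring
    rw [h1, one_mul, show m' + ((n + 1 : ℕ) : ℤ) - 1 = m' + n by push_cast; ring]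

theorem lead_eq_zero {n : ℕ} {u : USl2 k} {p : H z}
    (hp : p - hX z ^ n * H.ofU z u ∈ wfil z n 1) (h0 : actH hz p = 0) : u = 0 := by
  apply eq_zero_of_actU_eq_zero
  intro m m'
  have h1 : (actU k u (gtVec k 0 m) 0 m').coeff 0 = 0 := by
    rw [← symb_hX_pow hz n]
    have h2 := symb_wfil_one hz hp m (m' + n)
    rw [map_sub, h0, zero_sub] at h2
    rw [symb, ← neg_eq_zero, ← Finset.sum_neg_distrib, ← h2, symb]
    refine Finset.sum_congr rfl fun j _ => ?_
    rw [← mul_neg, ← coeff_neg]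
    rfl
  have h3 := inFil_actU u (inFil_gtVec m) m'
  ext1 j
  rcases j with _ | j
  · exact h1
  · exact h3 0 (j + 1) (by push_cast; omega)

/-- Successive powers of `y` are split off the top-degree part of `p`. At each stage the remaining
coefficient becomes, up to a factorial, the leading coefficient of a power of `ad e` applied to `p`,
which acts by zero. -/
theorem mem_fil_of_adj_uE {n : ℕ} {p : H z} (hp : p ∈ wfil z (n + 1) 1)
    (h0 : actH hz (adj k (H.ofU z (uE k)) p) = 0) : p ∈ fil z n := by
  have hker : ∀ i, actH hz ((adj k (H.ofU z (uE k)) ^ (i + 1)) p) = 0 := by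
    intro i
    induction i with
    | zero => simpa using h0
    | succ i ih =>
      rw [pow_succ', Module.End.mul_apply, adj_apply, map_sub, map_mul, map_mul, ih]
      simp
  have hmem : ∀ i ≤ n + 1, p ∈ wfil z (n + 1) (i + 1) := by
    intro i
    induction i with
    | zero => exact fun _ => hp
    | succ i ih =>
      intro hi
      obtain ⟨b, hb⟩ := Nat.exists_eq_add_of_le hi
      have hpi := ih (by omega)
      rw [hb, add_comm (i + 1) b] at hpi ⊢
      obtain ⟨u, hu⟩ := exists_sub_mem_wfil_succ hpi
      have h1 := adj_uE_pow_mem_wfil (i := 1) (j := i + 1) (by rwa [add_comm 1])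
      have h2 := adj_uE_pow_hY_pow_mul (i + 1) (hX_pow_mul_mem_fil (z := z) b u)
      have h3 := add_mem h1 h2
      rw [map_sub, sub_add_sub_cancel, ← mul_assoc, ← pow_add, ← mul_smul_comm, ← map_nsmul,
        add_comm (i + 1) b] at h3
      have h4 := lead_eq_zero hz h3 (hker i)
      rw [← Nat.cast_smul_eq_nsmul k] at h4
      have h5 : u = 0 :=
        (smul_eq_zero.mp h4).resolve_left (Nat.cast_ne_zero.mpr (Nat.factorial_ne_zero _))
      rwa [h5, map_zero, mul_zero, mul_zero, sub_zero] at hu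
  exact wfil_top_le n (hmem (n + 1) le_rfl)

/-- The Poincaré–Birkhoff–Witt theorem for `H_z`, as faithfulness of the generic module. -/
theorem actH_injective : Function.Injective (actH hz) := by
  rw [injective_iff_map_eq_zero]
  intro p h0
  obtain ⟨n, hn⟩ := exists_mem_fil p
  induction n with
  | zero =>
    obtain ⟨u, rfl⟩ := hn
    have h1 : u = 0 := lead_eq_zero (n := 0) hz (by simp) h0
    simp [h1]
  | succ n ih =>
    obtain ⟨u, hu⟩ := exists_sub_mem_wfil hn
    -- The leading coefficient vanishes. As the kernel is an ideal, `ad e` of `p` also acts by zero,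
    -- and the rest of the top-degree part disappears.
    have h1 := lead_eq_zero hz hu h0
    rw [h1, map_zero, mul_zero, sub_zero] at hu
    apply ih
    apply mem_fil_of_adj_uE hz hu
    rw [adj_apply, map_sub, map_mul, map_mul, h0, mul_zero, zero_mul, sub_zero]

end Faithful

/-! ### Operators that are diagonal in `b` and their commutation with `x` and `y`. -/

section Multiplication

variable {k : Type*} [Field k]

variable (k) in
/-- The operators acting on each component of the generic module through a polynomial. -/
noncomputable def mulOp : (ℤ → (GenField k)[X]) →+* Module.End (GenField k)[X] (GT k) where
  toFun a :=
    { toFun := fun φ b m => a b * φ b m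
      map_add' := fun φ ψ => by
        funext b m
        exact mul_add _ _ _
      map_smul' := fun r φ => by
        funext b m
        exact mul_left_comm _ _ _ }
  map_one' := GT.hom_ext fun φ b m => one_mul _
  map_mul' a a' := GT.hom_ext fun φ b m => mul_assoc _ _ _
  map_zero' := GT.hom_ext fun φ b m => zero_mul _
  map_add' a a' := GT.hom_ext fun φ b m => add_mul _ _ _

theorem mulOp_apply (a : ℤ → (GenField k)[X]) (φ : GT k) (b m : ℤ) :
    mulOp k a φ b m = a b * φ b m := rfl

theorem mulOp_injective : Function.Injective (mulOp k) := by
  intro a a' h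
  funext b
  have h1 := congrFun (congrFun (LinearMap.congr_fun h (gtVec k b 0)) b) 0
  rw [mulOp_apply, mulOp_apply, gtVec_apply, if_pos ⟨rfl, rfl⟩, mul_one, mul_one] at h1
  exact h1

theorem mulOp_const (r : (GenField k)[X]) : mulOp k (fun _ => r) = r • 1 := rfl

/-- Since `x` has only the components `b ↦ b ± 1`, an identity between diagonal operators and `x`
reduces to one scalar equation for each. It is applied with `d` the Casimir eigenvalues, so that the
commutator is `[c,x]`. -/
theorem mulOp_mul_opX {g : k[X]} {a a' d q : ℤ → (GenField k)[X]}
    (h1 : ∀ b, a (b + 1) = a' b + (d (b + 1) - d b) * q b)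
    (h2 : ∀ b, a (b - 1) = a' b + (d (b - 1) - d b) * q b) :
    mulOp k a * opX g = opX g * mulOp k a' +
      (mulOp k d * opX g - opX g * mulOp k d) * mulOp k q := by
  refine GT.hom_ext fun φ b m => ?_
  have h1 := h1 (b - 1)
  have h2 := h2 (b + 1)
  rw [sub_add_cancel] at h1
  rw [add_sub_cancel_right] at h2
  simp only [LinearMap.sub_apply, LinearMap.add_apply, Module.End.mul_apply, Pi.sub_apply,
    Pi.add_apply, opX_apply, mulOp_apply, smul_eq_C_mul]
  linear_combination (C ((lam k b - 1 + m) / (2 * (lam k b - 1))) * φ (b - 1) (m - 1)) * h1 +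
    (C ((m - (lam k b + 1)) / (2 * (lam k b + 1))) * (pot g (b + 1) * φ (b + 1) (m - 1))) * h2

theorem mulOp_mul_opY {g : k[X]} {a a' d q : ℤ → (GenField k)[X]}
    (h1 : ∀ b, a (b + 1) = a' b + (d (b + 1) - d b) * q b)
    (h2 : ∀ b, a (b - 1) = a' b + (d (b - 1) - d b) * q b) :
    mulOp k a * opY g = opY g * mulOp k a' +
      (mulOp k d * opY g - opY g * mulOp k d) * mulOp k q := by
  refine GT.hom_ext fun φ b m => ?_
  have h1 := h1 (b - 1)
  have h2 := h2 (b + 1)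
  rw [sub_add_cancel] at h1
  rw [add_sub_cancel_right] at h2
  simp only [LinearMap.sub_apply, LinearMap.add_apply, Module.End.mul_apply, Pi.sub_apply,
    Pi.add_apply, opY_apply, mulOp_apply, smul_eq_C_mul]
  linear_combination (C (lam k b - 1)⁻¹ * φ (b - 1) (m + 1)) * h1 +
    (C (lam k b + 1)⁻¹ * (pot g (b + 1) * φ (b + 1) (m + 1))) * h2

theorem pot_ne_zero (g : k[X]) (b : ℤ) : pot g b ≠ 0 := (monic_X_add_C _).ne_zero

variable [CharZero k]

theorem actU_aeval_casimir (p : k[X]) :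
    actU k (aeval (casimir k) p) = mulOp k (fun b => C (aeval (lam k b ^ 2) p)) :=
  GT.hom_ext fun φ b m => by
    rw [actU_aeval_casimir_apply, mulOp_apply, smul_eq_C_mul]

/-- The components moving `b` by `±2` cancel, as in the commutator of `x` and `y`. One formula
covers the commutator itself, the central element and the condition on derivations. -/
theorem opX_mulOp_opY (g : k[X]) (a : ℤ → (GenField k)[X]) :
    opX g * mulOp k a * opY g - opY g * mulOp k a * opX g = mulOp k (fun b => C (lam k b)⁻¹ *
      (a (b - 1) * pot g b - a (b + 1) * pot g (b + 1))) := by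
  refine GT.hom_ext fun φ b m => ?_
  have h0 := lam_ne_zero (k := k) b
  have h1 : lam k b - 1 ≠ 0 := by
    rw [← Int.cast_one, ← lam_sub]
    exact lam_ne_zero _
  have h2 : lam k b + 1 ≠ 0 := by
    rw [← Int.cast_one, ← lam_add]
    exact lam_ne_zero _
  have h3 : lam k b - 1 - 1 ≠ 0 := by
    rw [← Int.cast_one, ← lam_sub, ← lam_sub]
    exact lam_ne_zero _
  have h4 : lam k b + 1 + 1 ≠ 0 := by
    rw [← Int.cast_one, ← lam_add, ← lam_add]
    exact lam_ne_zero _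
  simp only [LinearMap.sub_apply, Module.End.mul_apply, Pi.sub_apply, opX_apply, opY_apply,
    mulOp_apply, lam_add, lam_sub, sub_add_cancel, add_sub_cancel_right, ← smul_eq_C_mul,
    mul_add, mul_sub, sub_mul, mul_smul_comm, smul_mul_assoc, smul_add, smul_smul,
    Int.cast_one, Int.cast_add]
  simp only [mul_assoc, mul_left_comm (a _) (pot g _)]
  match_scalars <;> field_simp <;> ring

omit [CharZero k] in
theorem eq_of_mulOp_mul_opY {g : k[X]} {a a' : ℤ → (GenField k)[X]}
    (h : mulOp k a * opY g = opY g * mulOp k a') (b : ℤ) : a (b + 1) = a' b ∧ a (b - 1) = a' b := by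
  have h0 : C (lam k b)⁻¹ ≠ 0 := C_ne_zero.mpr (inv_ne_zero (lam_ne_zero b))
  have key := fun c => congrFun (congrFun (LinearMap.congr_fun h (gtVec k b 1)) c) 0
  simp only [Module.End.mul_apply, mulOp_apply, opY_apply, gtVec_apply] at key
  have k1 := key (b + 1)
  have k2 := key (b - 1)
  rw [if_pos (by simp), if_neg (by omega)] at k1
  rw [if_neg (by omega), if_pos (by simp)] at k2
  simp only [smul_eq_C_mul, ← lam_sub_one, ← lam_add_one, add_sub_cancel_right, sub_add_cancel,
    mul_zero, mul_one, add_zero, zero_add, mul_comm (a _)] at k1 k2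
  rw [mul_assoc] at k2
  exact ⟨mul_left_cancel₀ h0 k1, mul_left_cancel₀ (pot_ne_zero g b) (mul_left_cancel₀ h0 k2)⟩

end Multiplication

/-! ### The central element `t` and the subalgebra generated by `t` and the Casimir element. -/

section Potential

variable {k : Type*} [Field k]

/-- The polynomials describing the action of a central element `z` of `U(sl₂)` on the
generic module. -/
structure Potential (z : USl2 k) where
  /-- The polynomial of the Casimir element which is equal to `z`. -/
  p : k[X]
  /-- The polynomial whose difference is `X * p (X ^ 2)`. -/
  g : k[X]
  /-- The correction term of the central element of degree two. -/
  r : k[X]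
  aeval_p : aeval (casimir k) p = z
  sub_comp : g - g.comp (X + 1) = X * expand k 2 p
  expand_r : expand k 2 r = (X + 1) ^ 2 * expand k 2 p - 4 * g
  g_eq_zero : p = 0 → g = 0

theorem nonempty_potential [CharZero k] {z : USl2 k} (hz : z ∈ Subalgebra.center k (USl2 k)) :
    Nonempty (Potential z) := by
  obtain ⟨p, rfl⟩ := exists_eq_aeval_casimir hz
  obtain ⟨g, r, hg, hr, h0⟩ := exists_shift_potential p
  exact ⟨⟨p, g, r, rfl, hg, hr, h0⟩⟩

namespace Potential

variable {z : USl2 k} (d : Potential z)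

/-- The element of `H_z` which generates the center. -/
noncomputable def t : H z :=
  (-(4 : k)⁻¹) • (hX z * H.ofU z (casimir k) * hY z - hY z * H.ofU z (casimir k) * hX z -
    H.ofU z (aeval (casimir k) d.r))

variable [CharZero k]

theorem opX_mul_opY_sub : opX d.g * opY d.g - opY d.g * opX d.g = actU k z :=
  (opX_mul_opY d.g d.sub_comp).trans (congrArg _ d.aeval_p)

/-- The action of `H_z` on the generic module. -/
noncomputable def act : H z →ₐ[k] Module.End (GenField k)[X] (GT k) := actH d.opX_mul_opY_sub

theorem act_injective : Function.Injective d.act := actH_injective _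

theorem act_ofU (u : USl2 k) : d.act (H.ofU z u) = actU k u := actH_ofU _ u

theorem act_hX : d.act (hX z) = opX d.g := actH_hX _

theorem act_hY : d.act (hY z) = opY d.g := actH_hY _

theorem act_casimir : d.act (H.ofU z (casimir k)) = mulOp k fun b => C (lam k b ^ 2) := by
  rw [act_ofU]
  simpa using actU_aeval_casimir (X : k[X])

omit [CharZero k] in
theorem pot_eq (b : ℤ) :
    pot d.g b = pot d.g (b + 1) + C (lam k b * aeval (lam k b ^ 2) d.p) := by
  have h := congrArg (aeval (lam k b)) d.sub_comp
  rw [map_sub, map_mul, aeval_X, ← aeval_lam_sq, ← C_1, ← Int.cast_one, ← aeval_lam_add] at h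
  rw [pot, pot, add_assoc, ← C_add, ← h, add_sub_cancel]

/-- On row `b`, with `ℓ = λ+b`, the difference equation turns `((ℓ-1)² pot b - (ℓ+1)² pot (b+1))/ℓ`
into `(ℓ+1)² p(ℓ²) - 4 pot b`. Subtracting `r(ℓ²)` leaves `-4t`. -/
theorem act_t : d.act d.t = (X : (GenField k)[X]) • 1 := by
  rw [t, map_smul, map_sub, map_sub, map_mul, map_mul, map_mul, map_mul, act_hX, act_hY,
    act_casimir, opX_mulOp_opY, act_ofU, actU_aeval_casimir, ← map_sub, ← mulOp_const]
  refine GT.hom_ext fun φ b m => ?_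
  have h1 := d.pot_eq b
  have h2 : C (lam k b)⁻¹ * C (lam k b) = (1 : (GenField k)[X]) := by
    rw [← C_mul, inv_mul_cancel₀ (lam_ne_zero b), C_1]
  have h3 := congrArg C (congrArg (aeval (lam k b)) d.expand_r)
  rw [← aeval_lam_sq, map_sub, map_mul, ← aeval_lam_sq] at h3
  simp only [map_mul, map_pow, map_add, map_sub, aeval_X, map_one, map_ofNat] at h3
  change (-(4 : k)⁻¹) • ((C (lam k b)⁻¹ * (C (lam k (b - 1) ^ 2) * pot d.g b -
    C (lam k (b + 1) ^ 2) * pot d.g (b + 1)) - C (aeval (lam k b ^ 2) d.r)) * φ b m) = X * φ b m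
  rw [← smul_mul_assoc]
  congr 1
  have h4 : (4 : k) • (-X : (GenField k)[X]) = 4 * -X := by rw [Algebra.smul_def, map_ofNat]
  have h5 : pot d.g b = X + C (aeval (lam k b) d.g) := rfl
  rw [neg_smul, neg_eq_iff_eq_neg, inv_smul_eq_iff₀ (by norm_num), h3, h4, lam_add_one, lam_sub_one]
  rw [C_mul] at h1
  simp only [map_pow, map_add, map_sub, map_one]
  linear_combination C (lam k b)⁻¹ * (C (lam k b) + 1) ^ 2 * h1 +
    ((C (lam k b) + 1) ^ 2 * C (aeval (lam k b ^ 2) d.p) - 4 * pot d.g b) * h2 - 4 * h5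

/-- Multiplication by the variable commutes with all `K[t]`-linear operators, and the module is
faithful. -/
theorem t_commute (p : H z) : Commute d.t p := by
  apply d.act_injective
  rw [map_mul, map_mul, act_t, smul_mul_assoc, mul_smul_comm, one_mul, mul_one]

theorem ofU_aeval_commute_t (p : k[X]) : Commute
    (((H.ofU z).comp (aeval (casimir k)) : k[X] →ₐ[k] H z).toRingHom p) d.t :=
  (d.t_commute _).symm

/-- The evaluation of polynomials in the central element and the Casimir element. -/
noncomputable def evC : k[X][X] →+* H z :=
  eval₂RingHom' ((H.ofU z).comp (aeval (casimir k)) : k[X] →ₐ[k] H z).toRingHom d.t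
    d.ofU_aeval_commute_t

theorem evC_C (q : k[X]) : d.evC (C q) = H.ofU z (aeval (casimir k) q) :=
  eval₂_C _ _

theorem evC_X : d.evC X = d.t := eval₂_X _ _

theorem act_evC (Q : k[X][X]) : d.act (d.evC Q) =
    mulOp k fun b => Q.map (aeval (lam k b ^ 2) : k[X] →ₐ[k] GenField k).toRingHom := by
  induction Q using Polynomial.induction_on' with
  | add p q hp hq =>
    rw [map_add, map_add, hp, hq, ← map_add]
    congr 1
    funext b
    exact (Polynomial.map_add _).symm
  | monomial n q =>
    rw [← C_mul_X_pow_eq_monomial, map_mul, map_pow, map_mul, map_pow, evC_C, evC_X, act_ofU,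
      actU_aeval_casimir, act_t, ← mulOp_const, ← map_pow, ← map_mul]
    congr 1
    funext b
    simp

end Potential

end Potential

/-! ### New copies of the standard representation from old ones. -/

namespace IsVRel

variable {A : Type*} [Ring A] {E F H X Y : A} (r : IsVRel E F H X Y)

include r

theorem casimir_mul_x : (4 * F * E + (H + 1) ^ 2) * X - X * (4 * F * E + (H + 1) ^ 2) =
    4 * Y * E + X * (2 * H + 3) := by
  have h1 : F * E * X = X * F * E + Y * E := by
    rw [mul_assoc, r.ex, ← mul_assoc, r.fx, add_mul]
  have h2 : H * H * X = X * H * H + 2 * X * H + X := by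
    rw [mul_assoc, r.hx, mul_add, ← mul_assoc, r.hx]
    noncomm_ring
  have h3 : (4 * F * E + (H + 1) ^ 2) * X = 4 * (F * E * X) + H * H * X + 2 * (H * X) + X := by
    noncomm_ring
  rw [h3, h1, h2, r.hx]
  noncomm_ring

theorem casimir_mul_y : (4 * F * E + (H + 1) ^ 2) * Y - Y * (4 * F * E + (H + 1) ^ 2) =
    4 * X * F + Y * (3 - 2 * H) := by
  have h1 : F * E * Y = Y * F * E + X * F + Y := by
    rw [mul_assoc, r.ey, mul_add, ← mul_assoc, r.fy, r.fx, add_assoc]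
  have h2 : H * H * Y = Y * H * H - 2 * Y * H + Y := by
    rw [mul_assoc, r.hy, mul_sub, ← mul_assoc, r.hy]
    noncomm_ring
  have h3 : (4 * F * E + (H + 1) ^ 2) * Y = 4 * (F * E * Y) + H * H * Y + 2 * (H * Y) + Y := by
    noncomm_ring
  rw [h3, h1, h2, r.hy]
  noncomm_ring

/-- The commutators with an element commuting with `sl₂` satisfy the same relations. -/
theorem commutator {c : A} (he : Commute c E) (hf : Commute c F) (hh : Commute c H) :
    IsVRel E F H (c * X - X * c) (c * Y - Y * c) := by
  have key : ∀ {g a b : A}, Commute c g → g * a - a * g = b →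
      g * (c * a - a * c) - (c * a - a * c) * g = c * b - b * c := by
    intro g a b hg hb
    have h1 : g * (c * a) = c * (g * a) := by rw [← mul_assoc, ← hg.eq, mul_assoc]
    have h2 : a * c * g = a * g * c := by rw [mul_assoc, hg.eq, mul_assoc]
    rw [← hb, mul_sub, sub_mul, h1, h2]
    noncomm_ring
  refine ⟨?_, ?_, ?_, ?_, ?_, ?_⟩
  · simpa [sub_eq_zero] using key he (sub_eq_zero.mpr r.ex)
  · exact sub_eq_iff_eq_add'.mp (key he (sub_eq_iff_eq_add'.mpr r.ey))
  · exact sub_eq_iff_eq_add'.mp (key hf (sub_eq_iff_eq_add'.mpr r.fx))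
  · simpa [sub_eq_zero] using key hf (sub_eq_zero.mpr r.fy)
  · exact sub_eq_iff_eq_add'.mp (key hh (sub_eq_iff_eq_add'.mpr r.hx))
  · rw [sub_eq_add_neg _ (c * Y - Y * c), neg_sub]
    refine sub_eq_iff_eq_add'.mp ((key hh (b := -Y) ?_).trans ?_)
    · rw [r.hy]
      abel
    · noncomm_ring

theorem mul_right {c : A} (he : Commute c E) (hf : Commute c F) (hh : Commute c H) :
    IsVRel E F H (X * c) (Y * c) := by
  refine ⟨?_, ?_, ?_, ?_, ?_, ?_⟩
  · rw [← mul_assoc, r.ex, mul_assoc, mul_assoc, he.eq]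
  · rw [← mul_assoc, r.ey, add_mul, mul_assoc, mul_assoc, he.eq]
  · rw [← mul_assoc, r.fx, add_mul, mul_assoc, mul_assoc, hf.eq]
  · rw [← mul_assoc, r.fy, mul_assoc, mul_assoc, hf.eq]
  · rw [← mul_assoc, r.hx, add_mul, mul_assoc, mul_assoc, hh.eq]
  · rw [← mul_assoc, r.hy, sub_mul, mul_assoc, mul_assoc, hh.eq]

theorem sub {X' Y' : A} (r' : IsVRel E F H X' Y') : IsVRel E F H (X - X') (Y - Y') := by
  refine ⟨?_, ?_, ?_, ?_, ?_, ?_⟩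
  · rw [mul_sub, r.ex, r'.ex, sub_mul]
  · rw [mul_sub, r.ey, r'.ey]
    noncomm_ring
  · rw [mul_sub, r.fx, r'.fx]
    noncomm_ring
  · rw [mul_sub, r.fy, r'.fy, sub_mul]
  · rw [mul_sub, r.hx, r'.hx]
    noncomm_ring
  · rw [mul_sub, r.hy, r'.hy]
    noncomm_ring

end IsVRel

/-! ### The adjoint action of `f` and `h` on leading coefficients. -/

section Lead

variable {k : Type*} [Field k] {z : USl2 k}

theorem hX_pow_mul_mem_wfil (j : ℕ) {n i : ℕ} {p : H z} (hp : p ∈ wfil z n i) :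
    hX z ^ j * p ∈ wfil z (n + j) i := by
  induction j with
  | zero => simpa
  | succ j ih =>
    rw [pow_succ', mul_assoc, ← add_assoc]
    exact hX_mul_mem_wfil ih

theorem adj_uF_hX_pow_mem (n : ℕ) : adj k (H.ofU z (uF k)) (hX z ^ n) ∈ wfil z n 1 := by
  induction n with
  | zero =>
    rw [pow_zero, adj_apply, mul_one, one_mul, sub_self]
    exact zero_mem _
  | succ n ih =>
    rw [pow_succ', adj_mul, adj_uF_hX]
    refine add_mem (hY_mul_mem_wfil ?_) (hX_mul_mem_wfil ih)
    rw [wfil_zero_right]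
    simpa using hX_pow_mul_mem_fil (z := z) n 1

theorem adj_uH_hX_pow (n : ℕ) : adj k (H.ofU z (uH k)) (hX z ^ n) = n • hX z ^ n := by
  induction n with
  | zero => simp [adj_apply]
  | succ n ih =>
    rw [pow_succ', adj_mul, ih, adj_apply, (isVRel_h z).hx, add_sub_cancel_left, succ_nsmul,
      mul_smul_comm, add_comm]

/-- `ad f` turns `x` into `y`, so modulo multiples of `y` it acts on the coefficient only. -/
theorem adj_uF_sub_mem {n : ℕ} {p : H z} {u : USl2 k} (hp : p - hX z ^ n * H.ofU z u ∈ wfil z n 1) :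
    adj k (H.ofU z (uF k)) p - hX z ^ n * H.ofU z (uF k * u - u * uF k) ∈ wfil z n 1 := by
  have h1 := adj_uF_mem_wfil hp
  rw [map_sub, adj_mul] at h1
  have h2 := add_mem h1 (mul_ofU_mem_wfil u (adj_uF_hX_pow_mem (z := z) n))
  convert h2 using 1
  rw [adj_apply _ (H.ofU z u), map_sub, map_mul, map_mul]
  abel

theorem adj_uH_sub_mem {n : ℕ} {p : H z} {u : USl2 k} (hp : p - hX z ^ n * H.ofU z u ∈ wfil z n 1) :
    adj k (H.ofU z (uH k)) p - hX z ^ n * H.ofU z (n • u + (uH k * u - u * uH k)) ∈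
      wfil z n 1 := by
  have h1 := adj_uH_mem_wfil hp
  rw [map_sub, adj_mul, adj_uH_hX_pow] at h1
  convert h1 using 1
  rw [adj_apply _ (H.ofU z u), map_add, map_nsmul, map_sub, map_mul, map_mul, mul_add,
    mul_smul_comm, smul_mul_assoc]

end Lead

/-! ### The leading coefficient of the central element. -/

namespace Potential

variable {k : Type*} [Field k] [CharZero k] {z : USl2 k} (d : Potential z)

include d in
-- The symbol functional recovers the leading coefficient, so it is well defined.
theorem lead_unique {n : ℕ} {u u' : USl2 k} {p : H z} (hp : p - hX z ^ n * H.ofU z u ∈ wfil z n 1)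
    (hp' : p - hX z ^ n * H.ofU z u' ∈ wfil z n 1) : u = u' := by
  have h := sub_mem hp' hp
  rw [sub_sub_sub_cancel_left, ← mul_sub, ← map_sub, ← neg_sub u' u, map_neg, mul_neg,
    ← zero_sub] at h
  exact (sub_eq_zero.mp (lead_eq_zero d.opX_mul_opY_sub h (map_zero _))).symm

include d in
theorem eq_zero_of_mem_wfil {n : ℕ} {u : USl2 k} {p : H z}
    (hp : p - hX z ^ n * H.ofU z u ∈ wfil z n 1) (h : p ∈ wfil z n 1) : u = 0 :=
  d.lead_unique hp (by simpa)

include d in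
theorem mem_fil_of_commute {n : ℕ} {p : H z} (hp : p ∈ wfil z (n + 1) 1)
    (h : H.ofU z (uE k) * p = p * H.ofU z (uE k)) : p ∈ fil z n :=
  mem_fil_of_adj_uE d.opX_mul_opY_sub hp (by rw [adj_apply, h, sub_self, map_zero])

omit [CharZero k] in
theorem ofU_casimir_eq : H.ofU z (casimir k) =
    4 * H.ofU z (uF k) * H.ofU z (uE k) + (H.ofU z (uH k) + 1) ^ 2 := by
  simp only [casimir, map_add, map_mul, map_pow, map_ofNat, map_one]

variable (z) in
/-- The commutator of the Casimir element with `x`. -/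
noncomputable def wX : H z := H.ofU z (casimir k) * hX z - hX z * H.ofU z (casimir k)

variable (z) in
/-- The commutator of the Casimir element with `y`. -/
noncomputable def wY : H z := H.ofU z (casimir k) * hY z - hY z * H.ofU z (casimir k)

omit [CharZero k] in
theorem wX_eq : wX z = 4 * hY z * H.ofU z (uE k) + hX z * (2 * H.ofU z (uH k) + 3) := by
  rw [wX, ofU_casimir_eq]
  exact (isVRel_h z).casimir_mul_x

omit [CharZero k] in
theorem wY_eq : wY z = 4 * hX z * H.ofU z (uF k) + hY z * (3 - 2 * H.ofU z (uH k)) := by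
  rw [wY, ofU_casimir_eq]
  exact (isVRel_h z).casimir_mul_y

omit [CharZero k] in
theorem isVRel_w (z : USl2 k) :
    IsVRel (H.ofU z (uE k)) (H.ofU z (uF k)) (H.ofU z (uH k)) (wX z) (wY z) :=
  (isVRel_h z).commutator ((casimir_commute _).map _) ((casimir_commute _).map _)
    ((casimir_commute _).map _)

/-- Moving the Casimir element to the right costs `x [c,y] - y [c,x]`, whose expansion contains `4
x² f`; all contributions of `[x,y]` lie in `U(sl₂)`. -/
theorem exists_t_eq : ∃ s : USl2 k, d.t = -(hX z ^ 2 * H.ofU z (uF k)) +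
    hY z * (hX z * H.ofU z (uH k) + hY z * H.ofU z (uE k)) + H.ofU z s := by
  refine ⟨(-(4 : k)⁻¹) • (z * (3 - 2 * uH k) + z * casimir k - aeval (casimir k) d.r), ?_⟩
  have h1 : hX z * H.ofU z (casimir k) * hY z - hY z * H.ofU z (casimir k) * hX z =
      hX z * wY z - hY z * wX z + (hX z * hY z - hY z * hX z) * H.ofU z (casimir k) := by
    rw [wX, wY]
    noncomm_ring
  have h2 : hX z * hY z - hY z * hX z = H.ofU z z := sub_eq_iff_eq_add'.mpr (hX_mul_hY z)
  have h3 : hX z * wY z - hY z * wX z = (-(4 : k)) • (-(hX z ^ 2 * H.ofU z (uF k)) +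
      hY z * (hX z * H.ofU z (uH k) + hY z * H.ofU z (uE k))) +
      (hX z * hY z - hY z * hX z) * (3 - 2 * H.ofU z (uH k)) := by
    rw [wX_eq, wY_eq, neg_smul, Algebra.smul_def, map_ofNat]
    noncomm_ring
  rw [t, h1, h3, h2, map_smul, map_sub, map_add, map_mul, map_mul, map_sub, map_mul, map_ofNat,
    map_ofNat, smul_sub, smul_add, smul_add, smul_smul, neg_mul_neg,
    inv_mul_cancel₀ (by norm_num), one_smul, smul_sub, smul_add]
  abel

theorem t_mul_mem_fil {n : ℕ} {p : H z} (hp : p ∈ fil z n) : d.t * p ∈ fil z (n + 2) := by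
  obtain ⟨s, hs⟩ := d.exists_t_eq
  rw [add_comm n]
  refine mul_mem_fil ?_ hp
  rw [hs]
  exact add_mem (add_mem (neg_mem (hX_pow_mul_mem_fil _ _)) (hY_mul_mem_fil
    (add_mem (by simpa using hX_pow_mul_mem_fil (z := z) 1 (uH k))
      (hY_mul_mem_fil (ofU_mem_fil_zero _))))) (fil_mono (Nat.zero_le _) (ofU_mem_fil_zero s))

theorem t_mul_mem_wfil {n : ℕ} {p : H z} (hp : p ∈ wfil z n 1) :
    d.t * p ∈ wfil z (n + 2) 1 := by
  cases n with
  | zero =>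
    obtain rfl : p = 0 := hp
    simp
  | succ n =>
    obtain ⟨m, hm, r, hr, rfl⟩ := mem_wfil_succ.mp hp
    rw [wfil_zero_right] at hm
    rw [mul_add, ← mul_assoc, (d.t_commute _).eq, mul_assoc]
    refine mem_wfil_succ.mpr ⟨_, ?_, _, d.t_mul_mem_fil hr, rfl⟩
    rw [wfil_zero_right]
    exact d.t_mul_mem_fil hm

/-- Since `t` is `-x² f` modulo lower terms and multiples of `y`, and commutes with powers of `x`,
it multiplies leading coefficients by `-f`. -/
theorem t_mul_sub_mem {n : ℕ} {p : H z} {u : USl2 k} (hp : p - hX z ^ n * H.ofU z u ∈ wfil z n 1) :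
    d.t * p - hX z ^ (n + 2) * H.ofU z (-(uF k * u)) ∈ wfil z (n + 2) 1 := by
  obtain ⟨s, hs⟩ := d.exists_t_eq
  have h1 : hX z ^ n * ((hY z * (hX z * H.ofU z (uH k) + hY z * H.ofU z (uE k)) + H.ofU z s) *
      H.ofU z u) ∈ wfil z (n + 2) 1 := by
    have h0 : hY z * (hX z * H.ofU z (uH k) + hY z * H.ofU z (uE k)) + H.ofU z s ∈
        wfil z 2 1 := by
      refine mem_wfil_succ.mpr ⟨_, ?_, _, fil_mono (Nat.zero_le _) (ofU_mem_fil_zero s), rfl⟩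
      rw [wfil_zero_right]
      exact add_mem (by simpa using hX_pow_mul_mem_fil (z := z) 1 (uH k))
        (hY_mul_mem_fil (ofU_mem_fil_zero _))
    have h2 := hX_pow_mul_mem_wfil n (mul_ofU_mem_wfil u h0)
    rwa [add_comm 2 n] at h2
  have h3 : d.t * (p - hX z ^ n * H.ofU z u) =
      d.t * p - hX z ^ n * (d.t * H.ofU z u) := by
    rw [mul_sub, ← mul_assoc d.t, (d.t_commute (hX z ^ n)).eq, mul_assoc]
  convert add_mem (d.t_mul_mem_wfil hp) h1 using 1
  rw [h3, hs, map_neg, map_mul, pow_add]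
  noncomm_ring

theorem t_pow_mul_sub_mem {n : ℕ} {p : H z} {u : USl2 k} (m : ℕ)
    (hp : p - hX z ^ n * H.ofU z u ∈ wfil z n 1) :
    d.t ^ m * p - hX z ^ (n + 2 * m) * H.ofU z ((-1) ^ m * uF k ^ m * u) ∈
      wfil z (n + 2 * m) 1 := by
  induction m with
  | zero => simpa
  | succ m ih =>
    have h : (-1) ^ (m + 1) * uF k ^ (m + 1) * u = -(uF k * ((-1) ^ m * uF k ^ m * u)) := by
      rw [pow_succ', pow_succ' (uF k), neg_one_mul, neg_mul, neg_mul, ← mul_assoc, ← mul_assoc,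
        ← mul_assoc, ((Commute.neg_one_left (uF k)).pow_left m).eq]
    rw [h, pow_succ', mul_assoc, mul_add, mul_one, ← add_assoc]
    exact d.t_mul_sub_mem ih

end Potential

/-! ### Invariants and copies of `V` in `H_z`; the filtration degree of `t`. -/

namespace Potential

variable {k : Type*} [Field k] [CharZero k] {z : USl2 k} (d : Potential z)

theorem t_pow_mul_ofU_sub_mem {n : ℕ} {p : H z} {u : USl2 k} (m : ℕ)
    (hp : p - hX z ^ n * H.ofU z u ∈ wfil z n 1) (q : k[X]) :
    d.t ^ m * (p * H.ofU z (aeval (casimir k) ((-1) ^ m * q))) -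
      hX z ^ (n + 2 * m) * H.ofU z (uF k ^ m * u * aeval (casimir k) q) ∈
        wfil z (n + 2 * m) 1 := by
  have h := d.t_pow_mul_sub_mem m (n := n) (p := p * H.ofU z (aeval (casimir k) ((-1) ^ m * q)))
    (u := u * aeval (casimir k) ((-1) ^ m * q))
    (by
      rw [map_mul (H.ofU z) u, ← mul_assoc, ← sub_mul]
      exact mul_ofU_mem_wfil _ hp)
  convert h using 4
  rw [map_mul, map_pow, map_neg, map_one]
  rcases neg_one_pow_eq_or (USl2 k) m with h1 | h1 <;> rw [h1] <;> noncomm_ring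

/-- A lowest weight vector `f^m q(c)` is the leading coefficient of `t^m q(c)`, up to the sign
`(-1)^m`. -/
theorem exists_evC_sub_mem {n : ℕ} {u : USl2 k} (hf : uF k * u - u * uF k = 0)
    (hh : n • u + (uH k * u - u * uH k) = 0) :
    ∃ Q, d.evC Q - hX z ^ n * H.ofU z u ∈ wfil z n 1 := by
  by_cases hu : u = 0
  · exact ⟨0, by simp [hu]⟩
  rw [add_comm, ← natCast_zsmul, add_eq_zero_iff_eq_neg, ← neg_smul] at hh
  obtain ⟨m, q, rfl, rfl⟩ := eq_of_lowest_weight hh (sub_eq_zero.mp hf) hu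
  refine ⟨X ^ m * C ((-1) ^ m * q), ?_⟩
  rw [map_mul, map_pow, evC_X, evC_C]
  simpa using d.t_pow_mul_ofU_sub_mem (n := 0) (p := 1) (u := 1) m (by simp) q

/-- `[c,y]` has leading term `4 x f`, so it supplies the lowest weight vectors whose degree is one
less than their power of `f` requires. -/
theorem exists_wY_mul_evC_sub_mem {n : ℕ} {u : USl2 k} (hf : uF k * u - u * uF k = 0)
    (hh : (n + 1) • u + (uH k * u - u * uH k) = 0) :
    ∃ Q, wY z * d.evC Q - hX z ^ n * H.ofU z u ∈ wfil z n 1 := by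
  by_cases hu : u = 0
  · exact ⟨0, by simp [hu]⟩
  rw [add_comm, ← natCast_zsmul, add_eq_zero_iff_eq_neg, ← neg_smul] at hh
  obtain ⟨m, q, hm, rfl⟩ := eq_of_lowest_weight hh (sub_eq_zero.mp hf) hu
  -- From `n + 1 = 2m` follows `m ≥ 1`: one factor `f` comes from `[c,y]`, the remaining ones from
  -- `t`.
  obtain ⟨m, rfl⟩ : ∃ m', m = m' + 1 := ⟨m - 1, by omega⟩
  obtain rfl : n = 1 + 2 * m := by omega
  have h1 : wY z - hX z ^ 1 * H.ofU z (4 * uF k) ∈ wfil z 1 1 := by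
    have h2 : wY z - hX z ^ 1 * H.ofU z (4 * uF k) =
        hY z * H.ofU z (3 - 2 * uH k) := by
      rw [wY_eq, map_mul, map_sub, map_mul, map_ofNat, map_ofNat, map_ofNat]
      noncomm_ring
    rw [h2]
    refine hY_mul_mem_wfil ?_
    rw [wfil_zero_right]
    exact ofU_mem_fil_zero _
  have h3 := d.t_pow_mul_ofU_sub_mem m h1 ((4 : k)⁻¹ • q)
  refine ⟨X ^ m * C ((-1) ^ m * ((4 : k)⁻¹ • q)), ?_⟩
  rw [map_mul, map_pow, evC_X, evC_C, ← mul_assoc, ← ((d.t_commute _).pow_left m).eq, mul_assoc]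
  convert h3 using 4
  have h4 : (4 : USl2 k) = algebraMap k _ 4 := (map_ofNat _ _).symm
  rw [map_smul, mul_smul_comm, pow_succ, ← mul_assoc, h4, ← Algebra.commutes, ← Algebra.smul_def,
    smul_mul_assoc, smul_mul_assoc, smul_smul]
  norm_num

theorem commute_evC_ofU (Q : k[X][X]) (u : USl2 k) : Commute (d.evC Q) (H.ofU z u) := by
  induction Q using Polynomial.induction_on' with
  | add p q hp hq =>
    rw [map_add]
    exact hp.add_left hq
  | monomial n q =>
    rw [← C_mul_X_pow_eq_monomial, map_mul, map_pow, evC_C, evC_X]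
    exact ((aeval_casimir_commute q u).map _).mul_left ((d.t_commute _).pow_left n)

/-- The centralizer of `sl₂` in `H_z` is generated by `t` and the Casimir element. -/
theorem exists_evC_eq {p : H z} (he : Commute (H.ofU z (uE k)) p) (hf : Commute (H.ofU z (uF k)) p)
    (hh : Commute (H.ofU z (uH k)) p) : ∃ Q, d.evC Q = p := by
  obtain ⟨n, hn⟩ := exists_mem_fil p
  induction n using Nat.strong_induction_on generalizing p with
  | _ n ih =>
    obtain ⟨u, hu⟩ := exists_sub_mem_wfil hn
    have hfu := adj_uF_sub_mem hu
    have hhu := adj_uH_sub_mem hu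
    rw [adj_apply, hf.eq, sub_self] at hfu
    rw [adj_apply, hh.eq, sub_self] at hhu
    -- The leading coefficient of an invariant commutes with `f` and has weight `-n`, so a
    -- polynomial in `t` and `c` matches it. Commuting with `e` then forces the difference into
    -- lower degree.
    obtain ⟨Q, hQ⟩ := d.exists_evC_sub_mem (d.eq_zero_of_mem_wfil hfu (zero_mem _))
      (d.eq_zero_of_mem_wfil hhu (zero_mem _))
    have h1 := sub_mem hu hQ
    rw [sub_sub_sub_cancel_right] at h1
    cases n with
    | zero => exact ⟨Q, (sub_eq_zero.mp h1).symm⟩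
    | succ n =>
      have he' := he.sub_right (d.commute_evC_ofU Q (uE k)).symm
      obtain ⟨Q', hQ'⟩ := ih n n.lt_succ_self he' (hf.sub_right (d.commute_evC_ofU Q _).symm)
        (hh.sub_right (d.commute_evC_ofU Q _).symm) (d.mem_fil_of_commute h1 he'.eq)
      exact ⟨Q' + Q, by rw [map_add, hQ', sub_add_cancel]⟩

theorem isVRel_mul_evC {a b : H z} (r : IsVRel (H.ofU z (uE k)) (H.ofU z (uF k)) (H.ofU z (uH k)) a b)
    (Q : k[X][X]) : IsVRel (H.ofU z (uE k)) (H.ofU z (uF k)) (H.ofU z (uH k))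
      (a * d.evC Q) (b * d.evC Q) :=
  r.mul_right (d.commute_evC_ofU Q _) (d.commute_evC_ofU Q _) (d.commute_evC_ofU Q _)

/-- The copies of `V` in `H_z` are spanned over the centralizer of `sl₂` by two of them. -/
theorem exists_isVRel_eq {a b : H z}
    (r : IsVRel (H.ofU z (uE k)) (H.ofU z (uF k)) (H.ofU z (uH k)) a b) :
    ∃ P Q, a = hX z * d.evC P + wX z * d.evC Q ∧ b = hY z * d.evC P + wY z * d.evC Q := by
  obtain ⟨n, hn⟩ := exists_mem_fil a
  induction n generalizing a b with
  | zero =>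
    have hb : adj k (H.ofU z (uF k)) a = b := by rw [adj_apply, r.fx, add_sub_cancel_left]
    have hbn : b ∈ fil z 0 := hb ▸ adj_ofU_mem_fil _ hn
    obtain ⟨v, hv⟩ := exists_sub_mem_wfil hbn
    have hfv := adj_uF_sub_mem hv
    have hhv := adj_uH_sub_mem hv
    rw [adj_apply, r.fy, sub_self] at hfv
    rw [adj_apply, r.hy, sub_sub_cancel_left] at hhv
    have h1 := d.eq_zero_of_mem_wfil hfv (zero_mem _)
    have h2 := d.eq_zero_of_mem_wfil (u := v + (0 • v + (uH k * v - v * uH k))) (n := 0) (p := 0)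
      (by
        convert add_mem hv hhv using 1
        rw [map_add, mul_add]
        abel) (zero_mem _)
    -- A lowest weight vector of `U(sl₂)` has even weight, whereas `v` would have weight `-1`.
    have h3 : v = 0 := by
      by_contra hv0
      rw [zero_smul, zero_add, add_comm, add_eq_zero_iff_eq_neg] at h2
      obtain ⟨m, q, hm, -⟩ := eq_of_lowest_weight (n := 1) (by simpa using h2)
        (sub_eq_zero.mp h1) hv0
      omega
    have h4 : b = 0 := by
      rw [h3, map_zero, mul_zero, sub_zero] at hv
      exact hv
    have h5 : a = 0 := by
      have h := r.ey
      rwa [h4, mul_zero, zero_mul, zero_add, eq_comm] at h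
    exact ⟨0, 0, by simp [h5], by simp [h4]⟩
  | succ n ih =>
    have hb : adj k (H.ofU z (uF k)) a = b := by rw [adj_apply, r.fx, add_sub_cancel_left]
    have hbn : b ∈ fil z (n + 1) := hb ▸ adj_ofU_mem_fil _ hn
    obtain ⟨v, hv⟩ := exists_sub_mem_wfil hbn
    have hfv := adj_uF_sub_mem hv
    have hhv := adj_uH_sub_mem hv
    rw [adj_apply, r.fy, sub_self] at hfv
    rw [adj_apply, r.hy, sub_sub_cancel_left] at hhv
    -- The lowest vector `b` is treated first: its leading coefficient commutes with `f` and has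
    -- weight `-(n + 2)`, and a multiple of `[c,y]` matches it.
    obtain ⟨Q, hQ⟩ := d.exists_wY_mul_evC_sub_mem (d.eq_zero_of_mem_wfil hfv (zero_mem _))
      (d.eq_zero_of_mem_wfil (u := (n + 1 + 1) • v + (uH k * v - v * uH k)) (p := 0)
      (by
        convert add_mem hv hhv using 1
        rw [succ_nsmul, map_add, map_add, map_add, mul_add, mul_add, mul_add]
        abel) (zero_mem _))
    have hb1 := sub_mem hv hQ
    rw [sub_sub_sub_cancel_right] at hb1
    have r1 := r.sub (d.isVRel_mul_evC (isVRel_w z) Q)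
    have ha1 : a - wX z * d.evC Q ∈ fil z (n + 1) := by
      have h : adj k (H.ofU z (uE k)) (b - wY z * d.evC Q) = a - wX z * d.evC Q := by
        rw [adj_apply, r1.ey, add_sub_cancel_left]
      rw [← h]
      exact adj_ofU_mem_fil _ (wfil_le_fil _ _ hb1)
    obtain ⟨u, hu⟩ := exists_sub_mem_wfil ha1
    have hfu := adj_uF_sub_mem hu
    have hhu := adj_uH_sub_mem hu
    rw [adj_apply, r1.fx, add_sub_cancel_left] at hfu
    rw [adj_apply, r1.hx, add_sub_cancel_left] at hhu
    -- The corrected `b` has no leading coefficient, so that of the corrected `a` now commutes with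
    -- `f`. Its weight is `-n`, one degree below `n + 1`, which leaves exactly one factor `x`.
    obtain ⟨P, hP⟩ := d.exists_evC_sub_mem (n := n) (d.eq_zero_of_mem_wfil hfu hb1)
      (d.eq_zero_of_mem_wfil (u := n • u + (uH k * u - u * uH k)) (p := 0)
      (by
        convert sub_mem hhu hu using 1
        rw [succ_nsmul, map_add, map_add, map_add, mul_add, mul_add, mul_add]
        abel) (zero_mem _))
    have r2 := r1.sub (d.isVRel_mul_evC (isVRel_h z) P)
    have ha2 : a - wX z * d.evC Q - hX z * d.evC P ∈ wfil z (n + 1) 1 := by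
      have h := hX_mul_mem_wfil hP
      rw [mul_sub, ← mul_assoc, ← pow_succ'] at h
      have h' := sub_mem hu h
      rwa [sub_sub_sub_cancel_right] at h'
    obtain ⟨P', Q', h1, h2⟩ := ih r2 (d.mem_fil_of_commute ha2 r2.ex)
    refine ⟨P' + P, Q' + Q, ?_, ?_⟩
    · rw [map_add, map_add, mul_add, mul_add, add_add_add_comm, ← h1]
      abel
    · rw [map_add, map_add, mul_add, mul_add, add_add_add_comm, ← h2]
      abel

omit [CharZero k] in
theorem t_mem_filtration : d.t ∈ H.filtration z 2 := by
  have h1 : (1 : H z) ∈ (1 ⊔ LinearMap.range (H.ofV z) : Submodule k (H z)) :=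
    Submodule.mem_sup_left (Submodule.one_le.mp le_rfl)
  have hx : hX z ∈ (1 ⊔ LinearMap.range (H.ofV z) : Submodule k (H z)) :=
    Submodule.mem_sup_right ⟨_, rfl⟩
  have hy : hY z ∈ (1 ⊔ LinearMap.range (H.ofV z) : Submodule k (H z)) :=
    Submodule.mem_sup_right ⟨_, rfl⟩
  have hU : ∀ u, H.ofU z u ∈ LinearMap.range (H.ofU z).toLinearMap := fun u => ⟨u, rfl⟩
  have h2 : ∀ {a b : H z}, a ∈ (1 ⊔ LinearMap.range (H.ofV z) : Submodule k (H z)) →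
      b ∈ (1 ⊔ LinearMap.range (H.ofV z) : Submodule k (H z)) → ∀ u v,
      H.ofU z u * ((a * H.ofU z v) * (b * H.ofU z 1)) ∈ H.filtration z 2 := by
    intro a b ha hb u v
    rw [H.filtration, pow_two]
    exact Submodule.mul_mem_mul (hU u) (Submodule.mul_mem_mul (Submodule.mul_mem_mul ha (hU v))
      (Submodule.mul_mem_mul hb (hU 1)))
  rw [t]
  refine Submodule.smul_mem _ _ (sub_mem (sub_mem ?_ ?_) ?_)
  · simpa using h2 hx hy 1 (casimir k)
  · simpa using h2 hy hx 1 (casimir k)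
  · simpa using h2 h1 h1 1 (aeval (casimir k) d.r)

omit [CharZero k] in
theorem filtration_one_le (z : USl2 k) : H.filtration z 1 ≤ fil z 1 := by
  rw [H.filtration, pow_one]
  refine Submodule.mul_le.mpr ?_
  rintro _ ⟨u, rfl⟩ m hm
  refine ofU_mul_mem_fil u ?_
  revert m
  refine Submodule.mul_le.mpr ?_
  rintro v hv _ ⟨u, rfl⟩
  refine mul_ofU_mem_fil u ?_
  obtain ⟨a, ha, _, ⟨b, rfl⟩, rfl⟩ := Submodule.mem_sup.mp hv
  obtain ⟨c, rfl⟩ := Submodule.mem_one.mp ha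
  rw [ofV_eq]
  refine add_mem ?_ (add_mem (Submodule.smul_mem _ _ ?_) (Submodule.smul_mem _ _ ?_))
  · exact fil_mono (Nat.zero_le _) ⟨algebraMap k _ c, (H.ofU z).commutes c⟩
  · simpa using hX_pow_mul_mem_fil (z := z) 1 1
  · simpa using hY_mul_mem_fil (ofU_mem_fil_zero (z := z) 1)

/-- In degree two `t` has leading coefficient `-f`, and `f` is nonzero because it acts as a shift.
-/
theorem t_notMem_filtration : d.t ∉ H.filtration z 1 := by
  intro h
  have h1 := fil_le_wfil 1 1 (filtration_one_le z h)
  have h2 := d.t_mul_sub_mem (n := 0) (p := 1) (u := 1) (by simp)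
  rw [mul_one, mul_one] at h2
  have h3 := d.eq_zero_of_mem_wfil h2 h1
  rw [neg_eq_zero] at h3
  have h4 := congrFun (congrFun (LinearMap.congr_fun (congrArg (actU k) h3) (gtVec k 0 2)) 0) 0
  rw [actU_uF, opF_apply, gtVec_apply, if_pos (by simp), map_zero] at h4
  exact one_ne_zero h4

end Potential

/-! ### Functional equations in the Casimir parameter. -/

section Shift

variable {k : Type*} [Field k] [CharZero k]

/-- Subtracting the equation from its translate shows that `p` has period two. -/
theorem exists_eq_C_of_add_comp_eq_C {p : k[X]} {c : k} (h : p + p.comp (X - 1) = C c) :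
    ∃ c', p = C c' := by
  have h1 := congrArg (fun q => q.comp (X - 1)) h
  simp only [add_comp, C_comp, comp_assoc, sub_comp, X_comp, one_comp] at h1
  have h2 : p.comp (X + C (-2)) = p := by
    have h3 : (X - 1 - 1 : k[X]) = X + C (-2) := by
      rw [C_neg, C_ofNat]
      ring
    rw [← h3]
    linear_combination h1 - h
  exact ⟨_, eq_C_of_comp_X_add_C_eq (by norm_num) h2⟩

/-- The value of a polynomial with coefficients in `k[X]` at the Casimir parameter `b`. -/
noncomputable def evLam (b : ℤ) : k[X][X] →+* (GenField k)[X] :=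
  mapRingHom (aeval (lam k b ^ 2) : k[X] →ₐ[k] GenField k).toRingHom

omit [CharZero k] in
theorem coeff_evLam (b : ℤ) (Q : k[X][X]) (m : ℕ) :
    (evLam b Q).coeff m = aeval (lam k b) (expand k 2 (Q.coeff m)) := by
  rw [← aeval_lam_sq]
  exact coeff_map _ _

omit [CharZero k] in
theorem coeff_evLam_add_one (b : ℤ) (Q : k[X][X]) (m : ℕ) :
    (evLam (b + 1) Q).coeff m = aeval (lam k b) ((expand k 2 (Q.coeff m)).comp (X + 1)) := by
  rw [coeff_evLam, aeval_lam_add, Int.cast_one, C_1]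

omit [CharZero k] in
theorem coeff_evLam_sub_one (b : ℤ) (Q : k[X][X]) (m : ℕ) :
    (evLam (b - 1) Q).coeff m = aeval (lam k b) ((expand k 2 (Q.coeff m)).comp (X - 1)) := by
  rw [coeff_evLam, sub_eq_add_neg, aeval_lam_add, Int.cast_neg, Int.cast_one, C_neg, C_1,
    ← sub_eq_add_neg]

omit [CharZero k] in
theorem evLam_injective (b : ℤ) : Function.Injective (evLam (k := k) b) :=
  map_injective _ (aeval_lam_sq_injective b)

omit [CharZero k] in
theorem evLam_map_C (b : ℤ) (q : k[X]) : evLam b (q.map C) = q.map (algebraMap k (GenField k)) := by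
  ext m
  rw [coeff_evLam, coeff_map, expand_C, aeval_C, coeff_map]

omit [CharZero k] in
theorem exists_eq_map_C {Q : k[X][X]} (h : ∀ m, ∃ c, expand k 2 (Q.coeff m) = C c) :
    ∃ q : k[X], Q = q.map C := by
  refine ⟨Q.map (evalRingHom 0), ?_⟩
  ext1 m
  obtain ⟨c, hc⟩ := h m
  rw [coeff_map, coeff_map, (expand_eq_C two_pos).mp hc, coe_evalRingHom, eval_C]

theorem exists_eq_map_C_of_evLam {Q : k[X][X]} (h : evLam 1 Q = evLam 0 Q) :
    ∃ q : k[X], Q = q.map C := by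
  refine exists_eq_map_C fun m => ⟨_, eq_C_of_comp_X_add_C_eq one_ne_zero ?_⟩
  have h1 : (evLam 1 Q).coeff m = (evLam 0 Q).coeff m := by rw [h]
  rw [← zero_add (1 : ℤ), coeff_evLam_add_one, coeff_evLam] at h1
  exact aeval_lam_injective 0 h1

/-- On the components `b ± 1` this states that the commutator of `P` with `v` is `[c,v] Q` modulo
`v` times the centralizer. Eliminating `P'` leaves `P_(b+1) - P_(b-1) = 4(λ+b) Q_b`. -/
theorem exists_evLam_shift (Q : k[X][X]) : ∃ P P' : k[X][X], ∀ b,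
    evLam (b + 1) P = evLam b P' + (C (lam k (b + 1) ^ 2) - C (lam k b ^ 2)) * evLam b Q ∧
    evLam (b - 1) P = evLam b P' + (C (lam k (b - 1) ^ 2) - C (lam k b ^ 2)) * evLam b Q := by
  induction Q using Polynomial.induction_on' with
  | add Q₁ Q₂ h₁ h₂ =>
    obtain ⟨P₁, P₁', h₁⟩ := h₁
    obtain ⟨P₂, P₂', h₂⟩ := h₂
    refine ⟨P₁ + P₂, P₁' + P₂', fun b => ⟨?_, ?_⟩⟩
    · rw [map_add, map_add, map_add, (h₁ b).1, (h₂ b).1]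
      ring
    · rw [map_add, map_add, map_add, (h₁ b).2, (h₂ b).2]
      ring
  | monomial n q =>
    obtain ⟨p, hp⟩ := exists_expand_two_comp_sub_comp_eq (4 * q)
    have hev : ∀ q : k[X], (expand k 2 q).comp (-X) = expand k 2 q := fun q => by
      rw [expand_eq_comp_X_pow, comp_assoc, pow_comp, X_comp, neg_sq]
    -- `P'` must be a polynomial in the Casimir element. The equation for `p` shows that this
    -- expression is unchanged under `X ↦ -X`.
    obtain ⟨p', hp'⟩ := exists_expand_two_eq
      (p := (expand k 2 p).comp (X + 1) - (2 * X + 1) * expand k 2 q) (by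
        have h1 : ((expand k 2 p).comp (X + 1)).comp (-X) = (expand k 2 p).comp (X - 1) := by
          conv_rhs => rw [← hev p]
          rw [comp_assoc, comp_assoc]
          congr 1
          simp
          ring
        rw [sub_comp, mul_comp, hev, h1]
        simp only [map_mul, map_ofNat] at hp
        simp only [add_comp, mul_comp, X_comp, ofNat_comp, one_comp]
        linear_combination -hp)
    have hmon : ∀ (b : ℤ) (q : k[X]), evLam b (monomial n q) = monomial n (aeval (lam k b ^ 2) q) :=
      fun b q => map_monomial _
    have hC : ∀ (c : GenField k) (c' : GenField k), C c * monomial n c' = monomial n (c * c') :=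
      fun c c' => C_mul_monomial
    have h1 : ∀ (b : ℤ), aeval (lam k (b + 1)) (expand k 2 p) =
        aeval (lam k b) ((expand k 2 p).comp (X + 1)) := fun b => by
      rw [aeval_lam_add, Int.cast_one, C_1]
    have h2 : ∀ (b : ℤ), aeval (lam k (b - 1)) (expand k 2 p) =
        aeval (lam k b) ((expand k 2 p).comp (X - 1)) := fun b => by
      rw [sub_eq_add_neg, aeval_lam_add, Int.cast_neg, Int.cast_one, C_neg, C_1, ← sub_eq_add_neg]
    refine ⟨monomial n p, monomial n p', fun b => ⟨?_, ?_⟩⟩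
    · rw [hmon, hmon, hmon, ← C_sub, hC, ← map_add]
      congr 1
      rw [aeval_lam_sq, aeval_lam_sq, aeval_lam_sq, h1, ← hp', lam_add_one]
      simp only [map_sub, map_mul, map_add, aeval_X, map_ofNat, map_one]
      ring
    · rw [hmon, hmon, hmon, ← C_sub, hC, ← map_add]
      congr 1
      rw [aeval_lam_sq, aeval_lam_sq, aeval_lam_sq, h2, ← hp', lam_sub_one]
      have h3 := congrArg (aeval (lam k b)) hp
      simp only [map_sub, map_mul, map_add, aeval_X, map_ofNat, map_one] at h3 ⊢
      linear_combination -h3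

/-- As `λ` is transcendental, one row gives an identity in `k[X][t]`: the product of `S = R(t,X²) +
R(t,(X-1)²)` and `t + g(X)` is invariant under `X ↦ X + 1`, hence free of `X`. -/
theorem exists_of_evLam_mul_pot {g : k[X]} {R : k[X][X]} {b : ℤ}
    (h : (evLam b R + evLam (b - 1) R) * pot g b =
      (evLam (b + 1) R + evLam b R) * pot g (b + 1)) :
    ((∀ c, g ≠ C c) → R = 0) ∧ (g = 0 → ∃ q : k[X], R = q.map C) := by
  let ι : k[X] →+* GenField k := (aeval (lam k b) : k[X] →ₐ[k] GenField k).toRingHom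
  let ε : k[X] →+* k[X] := (expand k 2).toRingHom
  let σ : k[X] →+* k[X] := compRingHom (X + 1)
  let τ : k[X] →+* k[X] := compRingHom (X - 1)
  have hστ : ∀ q : k[X], (q.comp (X - 1)).comp (X + 1) = q := fun q => by
    rw [comp_assoc, sub_comp, X_comp, one_comp, add_sub_cancel_right, comp_X]
  obtain ⟨S, hS⟩ : ∃ S, S = R.map ε + (R.map ε).map τ := ⟨_, rfl⟩
  have hcoeff : ∀ m, S.coeff m = expand k 2 (R.coeff m) + (expand k 2 (R.coeff m)).comp (X - 1) := by
    intro m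
    rw [hS, coeff_add, coeff_map, coeff_map, coeff_map]
    rfl
  have h1 : evLam b R + evLam (b - 1) R = S.map ι := by
    ext1 m
    rw [coeff_add, coeff_evLam, coeff_evLam_sub_one, coeff_map, hcoeff, map_add]
    rfl
  have h2 : evLam (b + 1) R + evLam b R = (S.map σ).map ι := by
    ext1 m
    rw [coeff_add, coeff_evLam_add_one, coeff_evLam, coeff_map, coeff_map, hcoeff, map_add,
      coe_compRingHom_apply, coe_compRingHom_apply, hστ, map_add]
    rfl
  have h3 : pot g b = (X + C g).map ι := by
    rw [Polynomial.map_add, map_X, map_C]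
    rfl
  have h4 : pot g (b + 1) = ((X + C g).map σ).map ι := by
    rw [pot, aeval_lam_add, Int.cast_one, C_1, Polynomial.map_add, Polynomial.map_add, map_X, map_X,
      map_C, map_C, coe_compRingHom_apply]
    rfl
  rw [h1, h2, h3, h4, ← Polynomial.map_mul, ← Polynomial.map_mul, ← Polynomial.map_mul] at h
  have h5 := map_injective ι (aeval_lam_injective b) h
  have h6 : ∀ m, ∃ c, (S * (X + C g)).coeff m = C c := by
    intro m
    refine ⟨_, eq_C_of_comp_X_add_C_eq one_ne_zero ?_⟩
    have h7 := congrArg (fun p => coeff p m) h5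
    simp only [coeff_map, σ, coe_compRingHom_apply] at h7
    exact h7.symm
  constructor
  · intro hg
    choose c hc using h6
    obtain ⟨F, hF⟩ : ∃ F : k[X], S * (X + C g) = F.map C := by
      refine ⟨(S * (X + C g)).map (evalRingHom 0), ?_⟩
      ext1 m
      rw [coeff_map, coeff_map, hc, coe_evalRingHom, eval_C]
    -- Setting `t = -g` kills the left side, so `F(-g) = 0`; for nonconstant `g` this gives `F = 0`.
    have h8 := congrArg (eval (-g)) hF
    rw [eval_mul, eval_add, eval_X, eval_C, neg_add_cancel, mul_zero, eval_map] at h8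
    have hF0 : F = 0 := (comp_eq_zero_iff.mp h8.symm).resolve_right fun h9 =>
      hg (-(-g).coeff 0) (by rw [C_neg, ← h9.2, neg_neg])
    have hS0 : S = 0 := by
      rw [hF0, Polynomial.map_zero] at hF
      exact (mul_eq_zero.mp hF).resolve_right (monic_X_add_C g).ne_zero
    ext1 m
    have h9 := hcoeff m
    rw [hS0, coeff_zero] at h9
    obtain ⟨c', hc'⟩ := exists_eq_C_of_add_comp_eq_C (p := expand k 2 (R.coeff m))
      (c := 0) (by rw [C_0]; exact h9.symm)
    rw [hc', C_comp, ← C_add, eq_comm, C_eq_zero, add_self_eq_zero] at h9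
    rw [h9, C_0] at hc'
    rw [coeff_zero]
    exact (expand_eq_zero two_pos).mp hc'
  · rintro rfl
    refine exists_eq_map_C fun m => ?_
    -- With `g = 0` the factor is `t` itself, and the coefficients of `S` appear shifted by one.
    obtain ⟨c, hc⟩ := h6 (m + 1)
    rw [C_0, add_zero, coeff_mul_X, hcoeff] at hc
    exact exists_eq_C_of_add_comp_eq_C hc

end Shift

/-! ### The center of `H_z` and the action of its centralizer elements on `V`. -/

namespace Potential

variable {k : Type*} [Field k] [CharZero k] {z : USl2 k} (d : Potential z)

theorem act_evC_eq (Q : k[X][X]) : d.act (d.evC Q) = mulOp k fun b => evLam b Q := d.act_evC Q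

theorem evC_injective : Function.Injective d.evC := by
  intro P Q h
  have h1 := congrArg d.act h
  rw [act_evC_eq, act_evC_eq] at h1
  exact evLam_injective 0 (congrFun (mulOp_injective h1) 0)

theorem evC_map_C (q : k[X]) : d.evC (q.map C) = aeval d.t q := by
  induction q using Polynomial.induction_on' with
  | add p q hp hq => rw [Polynomial.map_add, map_add, map_add, hp, hq]
  | monomial n c =>
    rw [map_monomial, ← C_mul_X_pow_eq_monomial, map_mul, map_pow, evC_C, evC_X, aeval_monomial,
      aeval_C, AlgHom.commutes]

theorem evLam_eq_of_evC_mul_hY {P Q : k[X][X]} (h : d.evC P * hY z = hY z * d.evC Q) (b : ℤ) :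
    evLam (b + 1) P = evLam b Q ∧ evLam (b - 1) P = evLam b Q := by
  have h1 := congrArg d.act h
  rw [map_mul, map_mul, act_evC_eq, act_evC_eq, act_hY] at h1
  exact eq_of_mulOp_mul_opY h1 b

/-- A central element is some `Q(t,c)`. Commuting with `y` makes its values on neighbouring rows
agree, so the Casimir element does not occur. -/
theorem exists_aeval_t_eq {c : H z} (hc : ∀ a, a * c = c * a) : ∃ q : k[X], aeval d.t q = c := by
  obtain ⟨Q, rfl⟩ := d.exists_evC_eq (hc _) (hc _) (hc _)
  obtain ⟨q, rfl⟩ := exists_eq_map_C_of_evLam (d.evLam_eq_of_evC_mul_hY (hc _).symm 0).1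
  exact ⟨q, (d.evC_map_C q).symm⟩

/-- The generator of the center of `H_z`. -/
noncomputable def tCenter : Subalgebra.center k (H z) :=
  ⟨d.t, Subalgebra.mem_center_iff.mpr fun b => (d.t_commute b).eq.symm⟩

theorem aeval_tCenter_bijective :
    Function.Bijective (aeval d.tCenter : k[X] →ₐ[k] Subalgebra.center k (H z)) := by
  have hcoe : ∀ q : k[X], ((aeval d.tCenter q : Subalgebra.center k (H z)) : H z) = aeval d.t q :=
    fun q => aeval_subalgebra_coe q _ _
  constructor
  · intro p q h
    have h1 := congrArg (Subtype.val) h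
    rw [hcoe, hcoe, ← evC_map_C, ← evC_map_C] at h1
    exact map_injective _ C_injective (d.evC_injective h1)
  · intro c
    obtain ⟨q, hq⟩ := d.exists_aeval_t_eq (Subalgebra.mem_center_iff.mp c.2)
    exact ⟨q, Subtype.ext ((hcoe q).trans hq)⟩

/-- This makes the `[c,v]` part of a derivation inner, by an element that commutes with `sl₂`. -/
theorem exists_commutator_evC (Q : k[X][X]) : ∃ P P' : k[X][X],
    d.evC P * hX z - hX z * d.evC P = hX z * d.evC P' + wX z * d.evC Q ∧
    d.evC P * hY z - hY z * d.evC P = hY z * d.evC P' + wY z * d.evC Q := by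
  obtain ⟨P, P', h⟩ := exists_evLam_shift Q
  refine ⟨P, P' - P, ?_, ?_⟩
  · have h1 : d.evC P * hX z = hX z * d.evC P' + wX z * d.evC Q := by
      apply d.act_injective
      rw [map_mul, map_add, map_mul, map_mul, wX, map_sub, map_mul, map_mul, act_evC_eq,
        act_evC_eq, act_evC_eq, act_hX, act_casimir]
      exact mulOp_mul_opX (fun b => (h b).1) (fun b => (h b).2)
    rw [h1, map_sub, mul_sub, sub_add_eq_add_sub]
  · have h1 : d.evC P * hY z = hY z * d.evC P' + wY z * d.evC Q := by
      apply d.act_injective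
      rw [map_mul, map_add, map_mul, map_mul, wY, map_sub, map_mul, map_mul, act_evC_eq,
        act_evC_eq, act_evC_eq, act_hY, act_casimir]
      exact mulOp_mul_opY (fun b => (h b).1) (fun b => (h b).2)
    rw [h1, map_sub, mul_sub, sub_add_eq_add_sub]

/-- The hypothesis says that `v ↦ v R`, extended by zero on `U(sl₂)`, respects `[x,y] = z`. All its
terms are diagonal in the model. -/
theorem evLam_mul_pot {R : k[X][X]} (h : hX z * d.evC R * hY z - hY z * d.evC R * hX z +
    (hX z * hY z - hY z * hX z) * d.evC R = 0) (b : ℤ) :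
    (evLam b R + evLam (b - 1) R) * pot d.g b =
      (evLam (b + 1) R + evLam b R) * pot d.g (b + 1) := by
  have h1 := congrArg d.act h
  have h2 := opX_mulOp_opY d.g 1
  rw [map_one, mul_one, mul_one] at h2
  rw [map_add, map_mul, map_sub, map_sub, map_mul, map_mul, map_mul, map_mul, map_mul, map_mul,
    act_evC_eq, act_hX, act_hY, opX_mulOp_opY, h2, ← map_mul, ← map_add, map_zero,
    ← map_zero (mulOp k)] at h1
  have h3 := congrFun (mulOp_injective h1) b
  have h4 : C (lam k b)⁻¹ * ((evLam b R + evLam (b - 1) R) * pot d.g b -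
      (evLam (b + 1) R + evLam b R) * pot d.g (b + 1)) = 0 := by
    refine Eq.trans ?_ h3
    simp only [Pi.add_apply, Pi.mul_apply, Pi.one_apply]
    ring
  exact sub_eq_zero.mp ((mul_eq_zero.mp h4).resolve_left
    (C_ne_zero.mpr (inv_ne_zero (lam_ne_zero b))))

omit [CharZero k] in
-- A constant `g` has zero difference, which forces `p = 0` and thus `z = 0`.
theorem g_ne_C (hz : z ≠ 0) (c : k) : d.g ≠ C c := by
  intro hg
  have h1 := d.sub_comp
  rw [hg, C_comp, sub_self, eq_comm] at h1
  have h2 := (expand_eq_zero two_pos).mp ((mul_eq_zero.mp h1).resolve_left X_ne_zero)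
  exact hz (by rw [← d.aeval_p, h2, map_zero])

theorem g_eq_zero_of_eq_zero (hz : z = 0) : d.g = 0 :=
  d.g_eq_zero (aeval_casimir_injective (by rw [d.aeval_p, hz, map_zero]))

end Potential

/-! ### Generalities on derivations. -/

section Derivation

variable {k A : Type*} [Field k] [Ring A] [Algebra k A]

theorem adj_adj_sub (a b c : A) :
    adj k a (adj k b c) - adj k b (adj k a c) = adj k (a * b - b * a) c := by
  simp only [adj_apply]
  noncomm_ring

variable {D : A →ₗ[k] A} (hD : ∀ a b : A, D (a * b) = a * D b + D a * b)

include hD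

theorem derivation_one : D 1 = 0 := by
  have h := hD 1 1
  rwa [mul_one, one_mul, mul_one, left_eq_add] at h

theorem derivation_algebraMap (c : k) : D (algebraMap k A c) = 0 := by
  rw [Algebra.algebraMap_eq_smul_one, map_smul, derivation_one hD, smul_zero]

theorem derivation_eq_zero {s : Set A} (hs : Algebra.adjoin k s = ⊤) (h : ∀ a ∈ s, D a = 0) (a : A) :
    D a = 0 := by
  have ha : a ∈ Algebra.adjoin k s := hs ▸ Algebra.mem_top
  induction ha using Algebra.adjoin_induction with
  | mem x hx => exact h x hx
  | algebraMap r => exact derivation_algebraMap hD r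
  | add x y _ _ hx hy => rw [map_add, hx, hy, add_zero]
  | mul x y _ _ hx hy => rw [hD, hx, hy, mul_zero, zero_mul, add_zero]

theorem derivation_sub_adj (c a b : A) : (D - adj k c) (a * b) =
    a * (D - adj k c) b + (D - adj k c) a * b := by
  simp only [LinearMap.sub_apply, hD, adj_mul]
  noncomm_ring

end Derivation

/-! ### Normal form of a derivation of `H_z` modulo inner ones. -/

section

variable {k : Type*} [Field k] [CharZero k] {z : USl2 k} {D : H z →ₗ[k] H z}
  (hD : ∀ a b : H z, D (a * b) = a * D b + D a * b)

include hD

/-- A derivation of `H_z` is inner on `U(sl₂)`. -/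
theorem exists_adj_eq_on_ofU : ∃ c, ∀ u, D (H.ofU z u) = adj k c (H.ofU z u) := by
  have r := isSl2Rel_ofU z
  have rv := isVRel_h z
  obtain ⟨e, he⟩ : ∃ e, e = H.ofU z (uE k) := ⟨_, rfl⟩
  obtain ⟨f, hf⟩ : ∃ f, f = H.ofU z (uF k) := ⟨_, rfl⟩
  obtain ⟨h, hh⟩ : ∃ h, h = H.ofU z (uH k) := ⟨_, rfl⟩
  have hgen := adjoin_h_eq_top z
  rw [← he, ← hf, ← hh] at r rv hgen
  have two : ∀ a : H z, (2 : k) • a = 2 * a := fun a => by rw [Algebra.smul_def, map_ofNat]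
  have ee : adj k e e = 0 := sub_self _
  have ef : adj k e f = h := sub_eq_iff_eq_add'.mpr r.ef
  have eh : adj k e h = (-2 : k) • e := by
    rw [adj_apply, r.he, neg_smul, two]
    abel
  have ex : adj k e (hX z) = 0 := sub_eq_zero.mpr rv.ex
  have ey : adj k e (hY z) = hX z := sub_eq_iff_eq_add'.mpr rv.ey
  have fe : adj k f e = -h := by
    rw [adj_apply, r.ef]
    abel
  have ff : adj k f f = 0 := sub_self _
  have fh : adj k f h = (2 : k) • f := by
    rw [adj_apply, r.hf, two]
    abel
  have fx : adj k f (hX z) = hY z := sub_eq_iff_eq_add'.mpr rv.fx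
  have fy : adj k f (hY z) = 0 := sub_eq_zero.mpr rv.fy
  have he' : h * e - e * h = (2 : k) • e := by
    rw [r.he, two]
    abel
  have hf' : h * f - f * h = (-2 : k) • f := by
    rw [r.hf, neg_smul, two]
    abel
  have hsmul : ∀ (c : k) (a v : H z), adj k (c • a) v = c • adj k a v := fun c a v => by
    simp [adj_apply, smul_sub]
  -- Whitehead's lemma is applied to `H_z` with the adjoint action; the cocycle identities come from
  -- applying `D` to the `sl₂` relations.
  obtain ⟨m, hm1, hm2, hm3⟩ := exists_of_cocycle (E := adj k e) (F := adj k f) (H := adj k h)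
    (a := D e) (b := D f) (d := D h)
    (fun v => by rw [adj_adj_sub, he', hsmul])
    (fun v => by rw [adj_adj_sub, hf', hsmul])
    (fun v => by rw [adj_adj_sub, ← adj_apply (k := k), ef])
    (iSup_eigenspace_adj_eq_top hgen h (by
      rintro _ (rfl | rfl | rfl | rfl | rfl)
      · exact ⟨2, he'⟩
      · exact ⟨-2, hf'⟩
      · exact ⟨0, by rw [sub_self, zero_smul]⟩
      · exact ⟨1, by rw [rv.hx, one_smul, add_sub_cancel_left]⟩
      · exact ⟨-1, by rw [rv.hy, neg_one_smul, sub_sub_cancel_left]⟩))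
    (exists_adj_pow_eq_zero hgen e (by
      rintro _ (rfl | rfl | rfl | rfl | rfl) <;>
      exact ⟨3, by simp [pow_succ', ee, ef, eh, ex, ey]⟩))
    (exists_adj_pow_eq_zero hgen f (by
      rintro _ (rfl | rfl | rfl | rfl | rfl) <;>
      exact ⟨3, by simp [pow_succ', fe, ff, fh, fx, fy]⟩))
    (by
      have h1 := congrArg D he'
      rw [map_sub, hD, hD, map_smul] at h1
      rw [← h1, adj_apply, adj_apply]
      abel)
    (by
      have h1 := congrArg D hf'
      rw [map_sub, hD, hD, map_smul] at h1
      rw [← h1, adj_apply, adj_apply]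
      abel)
    (by
      have h1 := congrArg D ef
      rw [adj_apply, map_sub, hD, hD] at h1
      rw [← h1, adj_apply, adj_apply]
      abel)
  refine ⟨-m, fun u => ?_⟩
  have key : ∀ a : H z, adj k a m = D a → D a = adj k (-m) a := fun a ha => by
    rw [← ha, adj_apply, adj_apply]
    noncomm_ring
  induction u using u_induction with
  | he => exact he ▸ key _ hm1
  | hf => exact hf ▸ key _ hm2
  | hh => exact hh ▸ key _ hm3
  | halg c =>
    rw [AlgHom.commutes, derivation_algebraMap hD, adj_apply, Algebra.commutes, sub_self]
  | hadd u v hu hv => rw [map_add, map_add, map_add, hu, hv]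
  | hmul u v hu hv => rw [map_mul, hD, adj_mul, hu, hv, add_comm]

variable (d : Potential z)

/-- Up to inner derivations, a derivation of `H_z` vanishes on `U(sl₂)` and multiplies `V` by an
element of the centralizer of `sl₂`. -/
theorem exists_adj_evC : ∃ (c : H z) (R : k[X][X]), (∀ u, D (H.ofU z u) = adj k c (H.ofU z u)) ∧
    D (hX z) = adj k c (hX z) + hX z * d.evC R ∧ D (hY z) = adj k c (hY z) + hY z * d.evC R := by
  obtain ⟨c, hc⟩ := exists_adj_eq_on_ofU hD
  obtain ⟨D', hD'⟩ : ∃ D', D' = D - adj k c := ⟨_, rfl⟩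
  have hmul : ∀ a b, D' (a * b) = a * D' b + D' a * b := hD' ▸ derivation_sub_adj hD c
  have hU : ∀ u, D' (H.ofU z u) = 0 := fun u => by rw [hD', LinearMap.sub_apply, hc, sub_self]
  have rv := isVRel_h z
  -- A derivation vanishing on `sl₂` is `sl₂`-equivariant, so it maps `(x,y)` to a pair satisfying
  -- the same relations.
  have r' : IsVRel (H.ofU z (uE k)) (H.ofU z (uF k)) (H.ofU z (uH k)) (D' (hX z)) (D' (hY z)) := by
    refine ⟨?_, ?_, ?_, ?_, ?_, ?_⟩
    · simpa [hmul, hU] using congrArg D' rv.ex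
    · simpa [hmul, hU] using congrArg D' rv.ey
    · simpa [hmul, hU] using congrArg D' rv.fx
    · simpa [hmul, hU] using congrArg D' rv.fy
    · simpa [hmul, hU] using congrArg D' rv.hx
    · simpa [hmul, hU] using congrArg D' rv.hy
  obtain ⟨P, Q, hPx, hPy⟩ := d.exists_isVRel_eq r'
  obtain ⟨S, S', hSx, hSy⟩ := d.exists_commutator_evC Q
  rw [hD', LinearMap.sub_apply, sub_eq_iff_eq_add] at hPx hPy
  refine ⟨c + d.evC S, P - S', fun u => ?_, ?_, ?_⟩
  · have h := (d.commute_evC_ofU S u).eq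
    rw [hc, adj_apply, adj_apply, add_mul, mul_add, h, add_sub_add_right_eq_sub]
  · have h : adj k (c + d.evC S) (hX z) = adj k c (hX z) +
        (d.evC S * hX z - hX z * d.evC S) := by
      rw [adj_apply, adj_apply]
      noncomm_ring
    rw [h, hSx, hPx, map_sub]
    noncomm_ring
  · have h : adj k (c + d.evC S) (hY z) = adj k c (hY z) +
        (d.evC S * hY z - hY z * d.evC S) := by
      rw [adj_apply, adj_apply]
      noncomm_ring
    rw [h, hSy, hPy, map_sub]
    noncomm_ring

/-- Apply both `D` and its inner part to `xy = yx + z`. They agree on `z`, so the difference is the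
condition on `R` alone, and any single row of the model decides it. -/
theorem exists_adj_evC_pot : ∃ (c : H z) (R : k[X][X]),
    (∀ u, D (H.ofU z u) = adj k c (H.ofU z u)) ∧
    D (hX z) = adj k c (hX z) + hX z * d.evC R ∧ D (hY z) = adj k c (hY z) + hY z * d.evC R ∧
    ((∀ c, d.g ≠ C c) → R = 0) ∧ (d.g = 0 → ∃ q : k[X], R = q.map C) := by
  obtain ⟨c, R, hU, hx, hy⟩ := exists_adj_evC hD d
  refine ⟨c, R, hU, hx, hy, ?_⟩
  have h1 := congrArg D (hX_mul_hY z)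
  have h2 := congrArg (adj k c) (hX_mul_hY z)
  rw [map_add, hD, hD, hU, hx, hy] at h1
  rw [map_add, adj_mul, adj_mul] at h2
  refine exists_of_evLam_mul_pot (d.evLam_mul_pot ?_ 0)
  rw [← sub_eq_zero] at h1 h2
  have h3 := h1.trans h2.symm
  rw [← sub_eq_zero] at h3
  rw [← h3]
  noncomm_ring

omit [CharZero k] in
-- Both sides are derivations, the right one because `r` is central, and they agree on generators.
theorem eq_adj_add_mul (c r : H z) (eu : H z →ₗ[k] H z)
    (heu : ∀ a b : H z, eu (a * b) = a * eu b + eu a * b) (hr : ∀ a, a * r = r * a)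
    (heU : ∀ u, eu (H.ofU z u) = 0) (hU : ∀ u, D (H.ofU z u) = adj k c (H.ofU z u))
    (hx : D (hX z) = adj k c (hX z) + r * eu (hX z))
    (hy : D (hY z) = adj k c (hY z) + r * eu (hY z)) (a : H z) :
    D a = adj k c a + r * eu a := by
  have key : ∀ a, (D - adj k c - LinearMap.mulLeft k r ∘ₗ eu) a = 0 := by
    refine derivation_eq_zero (fun a b => ?_) (adjoin_h_eq_top z) ?_
    · have h := derivation_sub_adj hD c a b
      rw [LinearMap.sub_apply, h, LinearMap.sub_apply (D - adj k c), LinearMap.sub_apply (D - adj k c),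
        LinearMap.comp_apply, LinearMap.comp_apply, LinearMap.comp_apply, LinearMap.mulLeft_apply,
        LinearMap.mulLeft_apply, LinearMap.mulLeft_apply, heu, mul_add, mul_sub, sub_mul,
        ← mul_assoc r a, ← hr a]
      noncomm_ring
    · rintro _ (rfl | rfl | rfl | rfl | rfl) <;> simp [hU, heU, hx, hy]
  have h := key a
  rwa [LinearMap.sub_apply, LinearMap.sub_apply, sub_sub, sub_eq_zero] at h

end

/-! ### The Euler derivation of `H_0` and the first Hochschild cohomology. -/

section Euler

variable (k : Type*) [Field k]

open TrivSqZeroExt in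
theorem isSl2Rel_inl : IsSl2Rel (A := TrivSqZeroExt (H (0 : USl2 k)) (H (0 : USl2 k)))
    (inl (H.ofU 0 (uE k))) (inl (H.ofU 0 (uF k))) (inl (H.ofU 0 (uH k))) := by
  have r := isSl2Rel_ofU (0 : USl2 k)
  refine ⟨?_, ?_, ?_⟩
  · rw [← inl_mul, r.he, inl_add, inl_mul, two_mul, two_mul, inl_add]
  · rw [← inl_mul, r.hf, inl_sub, inl_mul, two_mul, two_mul, inl_add]
  · rw [← inl_mul, r.ef, inl_add, inl_mul]

open TrivSqZeroExt in
theorem isVRel_inl_add_inr : IsVRel (A := TrivSqZeroExt (H (0 : USl2 k)) (H (0 : USl2 k)))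
    (inl (H.ofU 0 (uE k))) (inl (H.ofU 0 (uF k))) (inl (H.ofU 0 (uH k)))
    (inl (hX 0) + inr (hX 0)) (inl (hY 0) + inr (hY 0)) := by
  have r := isVRel_h (0 : USl2 k)
  refine ⟨?_, ?_, ?_, ?_, ?_, ?_⟩ <;> ext <;>
    simp [r.ex, r.ey, r.fx, r.fy, r.hx, r.hy]

open TrivSqZeroExt in
-- The Euler derivation is the infinitesimal rescaling `v ↦ v + εv`. It respects `[x,y] = z` at `z =
-- 0` because the relation is then homogeneous in `V`.
theorem inl_add_inr_commutator : ((inl (hX 0) + inr (hX 0)) * (inl (hY 0) + inr (hY 0)) -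
    (inl (hY 0) + inr (hY 0)) * (inl (hX 0) + inr (hX 0)) :
      TrivSqZeroExt (H (0 : USl2 k)) (H (0 : USl2 k))) =
    (liftU (isSl2Rel_inl k) :
      USl2 k →ₐ[k] TrivSqZeroExt (H (0 : USl2 k)) (H (0 : USl2 k))) 0 := by
  have h := hX_mul_hY (0 : USl2 k)
  rw [map_zero, add_zero] at h
  rw [map_zero]
  ext <;> simp [h]

/-- The algebra morphism describing the Euler derivation of `H_0`. -/
noncomputable def eulerHom :
    H (0 : USl2 k) →ₐ[k] TrivSqZeroExt (H (0 : USl2 k)) (H (0 : USl2 k)) :=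
  liftH (isSl2Rel_inl k) (isVRel_inl_add_inr k) (inl_add_inr_commutator k)

variable {k}

theorem eulerHom_ofV (v : V k) : eulerHom k (H.ofV 0 v) =
    TrivSqZeroExt.inl (H.ofV 0 v) + TrivSqZeroExt.inr (H.ofV 0 v) := by
  refine (liftH_ofV _ _ _ v).trans ?_
  rw [ofV_eq, liftV_apply]
  ext <;> simp

theorem eulerHom_ofU (u : USl2 k) : eulerHom k (H.ofU 0 u) = TrivSqZeroExt.inl (H.ofU 0 u) := by
  refine (liftH_ofU _ _ _ u).trans ?_
  have h : liftU (isSl2Rel_inl k) =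
      (TrivSqZeroExt.inlAlgHom k (H (0 : USl2 k)) (H (0 : USl2 k))).comp (H.ofU 0) :=
    (algHom_eq_liftU (isSl2Rel_inl k) _ rfl rfl rfl).symm
  rw [h]
  rfl

theorem fst_eulerHom (a : H (0 : USl2 k)) : (eulerHom k a).fst = a := by
  have h : (TrivSqZeroExt.fstHom k (H (0 : USl2 k)) (H (0 : USl2 k))).comp (eulerHom k) =
      AlgHom.id k _ := by
    refine AlgHom.ext_of_adjoin_eq_top (adjoin_h_eq_top (0 : USl2 k)) ?_
    rintro _ (rfl | rfl | rfl | rfl | rfl) <;> simp [eulerHom_ofU, hX, hY, eulerHom_ofV]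
  exact AlgHom.congr_fun h a

variable (k) in
/-- The Euler derivation of `H_0`. -/
noncomputable def euler : H (0 : USl2 k) →ₗ[k] H (0 : USl2 k) where
  toFun a := (eulerHom k a).snd
  map_add' a b := by rw [map_add, TrivSqZeroExt.snd_add]
  map_smul' c a := by rw [map_smul, TrivSqZeroExt.snd_smul, RingHom.id_apply]

theorem euler_mul (a b : H (0 : USl2 k)) : euler k (a * b) = a * euler k b + euler k a * b := by
  change (eulerHom k (a * b)).snd = a * (eulerHom k b).snd + (eulerHom k a).snd * b
  rw [map_mul, TrivSqZeroExt.snd_mul, fst_eulerHom, fst_eulerHom]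
  rfl

theorem euler_ofU (u : USl2 k) : euler k (H.ofU 0 u) = 0 := by
  change (eulerHom k _).snd = 0
  rw [eulerHom_ofU, TrivSqZeroExt.snd_inl]

theorem euler_ofV (v : V k) : euler k (H.ofV 0 v) = H.ofV 0 v := by
  change (eulerHom k _).snd = _
  rw [eulerHom_ofV, TrivSqZeroExt.snd_add, TrivSqZeroExt.snd_inl, TrivSqZeroExt.snd_inr, zero_add]

theorem mem_cocycle1_iff {A : Type*} [Ring A] [Algebra k A] {D : A →ₗ[k] A} :
    D ∈ Cocycle1 k A ↔ ∀ a b, D (a * b) = a * D b + D a * b := by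
  rw [LinearMap.mem_ker, LinearMap.ext_iff₂]
  refine forall₂_congr fun a b => ?_
  change a * D b - D (a * b) + D a * b = 0 ↔ _
  rw [sub_add_eq_add_sub, sub_eq_zero, eq_comm]

variable (k) in
/-- The Euler derivation as a Hochschild cocycle. -/
noncomputable def eulerCocycle : Cocycle1 k (H (0 : USl2 k)) :=
  ⟨euler k, mem_cocycle1_iff.mpr euler_mul⟩

variable [CharZero k]

/-- If `r` times the Euler derivation is inner by `a`, then `a` commutes with `sl₂`, so `a =
Q(t,c)`. The value at `y` says that `Q` changes by the same `-q(t)` when the row goes up or down by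
one. -/
theorem smul_eulerCocycle_eq_zero (d : Potential (0 : USl2 k))
    {r : Subalgebra.center k (H (0 : USl2 k))}
    (h : r • (Submodule.Quotient.mk (eulerCocycle k) : HH1 k (H (0 : USl2 k))) = 0) : r = 0 := by
  rw [← Submodule.Quotient.mk_smul, Submodule.Quotient.mk_eq_zero] at h
  obtain ⟨a, ha⟩ := h
  have ha' : ∀ b, b * a - a * b = (r : H (0 : USl2 k)) * euler k b := fun b =>
    LinearMap.congr_fun ha b
  have hU : ∀ u, Commute (H.ofU 0 u) a := fun u => by
    have h1 := ha' (H.ofU 0 u)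
    rw [euler_ofU, mul_zero] at h1
    exact sub_eq_zero.mp h1
  obtain ⟨Q, rfl⟩ := d.exists_evC_eq (hU _) (hU _) (hU _)
  obtain ⟨q, hq⟩ := d.exists_aeval_t_eq (Subalgebra.mem_center_iff.mp r.2)
  have hy := ha' (hY 0)
  have hey : euler k (hY 0) = hY 0 := euler_ofV _
  rw [hey, ← Subalgebra.mem_center_iff.mp r.2, ← hq, ← d.evC_map_C, sub_eq_iff_eq_add,
    ← sub_eq_iff_eq_add', ← mul_sub, ← map_sub] at hy
  -- Going from row `0` to row `-1` and back adds `-q` twice, so `2q = 0`.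
  have h1 := (d.evLam_eq_of_evC_mul_hY hy.symm 0).2
  have h2 := (d.evLam_eq_of_evC_mul_hY hy.symm (0 - 1)).1
  rw [sub_add_cancel, map_sub, evLam_map_C] at h2
  rw [map_sub, evLam_map_C, h2, sub_sub, eq_comm, sub_eq_self, add_self_eq_zero,
    Polynomial.map_eq_zero_iff (algebraMap k (GenField k)).injective] at h1
  rw [h1, map_zero] at hq
  exact Subtype.ext hq.symm

theorem exists_mk_eq_smul (d : Potential (0 : USl2 k)) (D : Cocycle1 k (H (0 : USl2 k))) :
    ∃ r : Subalgebra.center k (H (0 : USl2 k)), r • (Submodule.Quotient.mk (eulerCocycle k) :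
      HH1 k (H (0 : USl2 k))) = Submodule.Quotient.mk D := by
  have hD := mem_cocycle1_iff.mp D.2
  obtain ⟨c, R, hU, hx, hy, -, hR⟩ := exists_adj_evC_pot hD d
  obtain ⟨q, rfl⟩ := hR (d.g_eq_zero_of_eq_zero rfl)
  obtain ⟨r, hr⟩ : ∃ r, r = aeval d.tCenter q := ⟨_, rfl⟩
  have hrq : (r : H (0 : USl2 k)) = d.evC (q.map C) := by
    rw [d.evC_map_C, hr]
    exact aeval_subalgebra_coe q _ _
  have hcomm := Subalgebra.mem_center_iff.mp r.2
  rw [← hrq, hcomm] at hx hy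
  refine ⟨r, ?_⟩
  have hex : euler k (hX 0) = hX 0 := euler_ofV _
  have hey : euler k (hY 0) = hY 0 := euler_ofV _
  rw [← Submodule.Quotient.mk_smul, Submodule.Quotient.eq]
  refine ⟨c, LinearMap.ext fun a => ?_⟩
  have h := eq_adj_add_mul hD c r (euler k) euler_mul hcomm euler_ofU hU
    (by rw [hex, hx]) (by rw [hey, hy]) a
  change a * c - c * a = (r : H (0 : USl2 k)) * euler k a - D.1 a
  rw [h, adj_apply]
  abel

theorem exists_basis_HH1 (d : Potential (0 : USl2 k)) :
    ∃ b : Module.Basis Unit (Subalgebra.center k (H (0 : USl2 k))) (HH1 k (H (0 : USl2 k))),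
      b () = Submodule.Quotient.mk (eulerCocycle k) := by
  refine ⟨Module.Basis.mk (v := fun _ => Submodule.Quotient.mk (eulerCocycle k)) ?_ ?_, ?_⟩
  · rw [Fintype.linearIndependent_iff]
    intro r hr i
    rw [Fintype.sum_unique] at hr
    exact smul_eulerCocycle_eq_zero d hr
  · rintro x -
    obtain ⟨D, rfl⟩ := Submodule.Quotient.mk_surjective _ x
    obtain ⟨r, hr⟩ := exists_mk_eq_smul d D
    rw [← hr]
    exact Submodule.smul_mem _ _ (Submodule.subset_span ⟨(), rfl⟩)
  · rw [Module.Basis.mk_apply]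

end Euler

end InfHecke

open InfHecke in
theorem theorem2p1 {k : Type*} [Field k] [IsAlgClosed k] [CharZero k]
    (z : USl2 k) (hz : z ∈ Subalgebra.center k (USl2 k)) :
    (∃ t : Subalgebra.center k (H z),
      Function.Bijective
        (Polynomial.aeval t : Polynomial k →ₐ[k] Subalgebra.center k (H z)) ∧
      (t : H z) ∈ H.filtration z 2 ∧ (t : H z) ∉ H.filtration z 1) ∧
    (z = 0 →
      ∃ eu : Cocycle1 k (H z),
        (∀ u : USl2 k, eu.1 (H.ofU z u) = 0) ∧
        (∀ v : V k, eu.1 (H.ofV z v) = H.ofV z v) ∧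
        ∃ b : Module.Basis Unit (Subalgebra.center k (H z)) (HH1 k (H z)),
          b () = Submodule.Quotient.mk eu) ∧
    (z ≠ 0 →
      ∀ D : H z →ₗ[k] H z, (∀ a b : H z, D (a * b) = a * D b + D a * b) →
        ∃ c : H z, ∀ a : H z, D a = c * a - a * c) := by
  obtain ⟨d⟩ := nonempty_potential hz
  refine ⟨⟨d.tCenter, d.aeval_tCenter_bijective, d.t_mem_filtration, d.t_notMem_filtration⟩, ?_, ?_⟩
  · rintro rfl
    exact ⟨eulerCocycle k, euler_ofU, euler_ofV, exists_basis_HH1 d⟩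
  · intro h0 D hD
    obtain ⟨c, R, hU, hx, hy, hR, -⟩ := exists_adj_evC_pot hD d
    rw [hR (d.g_ne_C h0), map_zero, mul_zero] at hx hy
    refine ⟨c, fun a => ?_⟩
    -- Since `R = 0`, the outer part is taken to be zero, and `D` is determined by its inner part on
    -- generators.
    have h := eq_adj_add_mul hD c 0 0 (fun a b => by simp) (fun a => by simp) (fun u => rfl) hU
      (by rw [hx, zero_mul]) (by rw [hy, zero_mul]) a
    rwa [zero_mul, add_zero] at h
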